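/- **Conventions.** Let $\mathbb K=\mathbb R$ (smooth category) or $\mathbb K=\mathbb C$ (holomorphic category). A bi-flat $F$-manifold is a manifold $M$ with a commutative associative product $\circ$ on $TM$ with unit $e$ satisfying the Hertling–Manin condition, an invertible Euler vector field $E$ (so $X*Y=X\circ Y\circ E^{-1}$ is again an $F$-manifold product, and $[e,E]=e$), and two flat torsionless affine connections $\nabla^{(1)},\nabla^{(2)}$ such that $\nabla^{(1)}e=0$, $\nabla^{(2)}E=0$, $(\nabla^{(1)}_X\circ)(Y,Z)=(\nabla^{(1)}_Y\circ)(X,Z)$, $(\nabla^{(2)}_X*)(Y,Z)=(\nabla^{(2)}_Y*)(X,Z)$, and $(d_{\nabla^{(1)}}-d_{\nabla^{(2)}})(X\circ)=0$, $(d_{\nabla^{(1)}}-d_{\nabla^{(2)}})(X*)=0$ for all vector fields $X$. In coordinates $\nabla_{\partial_j}\partial_k=\sum_i\Gamma^i_{jk}\partial_i$. Consider the three-dimensional regular ones for which, at every point, $L=E\circ$ has exactly two distinct eigenvalues, one of them with a $2\times 2$ Jordan block. For functions $F_1,\dots,F_6$ of one variable $z$ put $z=(u^3-u^1)/u^2$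 and $f_i=F_i(z)/u^2$. The *model with profile* $F=(F_1,\dots,F_6)$ over a set $S\subseteq\mathbb K\setminus\{0\}$ consists of the following data on $\Omega_S=\{u\in\mathbb K^3: u^1,u^2,u^3\ne0,\ u^1\neq u^3,\ z\in S\}$: the product $\partial_1\circ\partial_1=\partial_1$, $\partial_1\circ\partial_2=\partial_2$, $\partial_3\circ\partial_3=\partial_3$, $\partial_2\circ\partial_2=\partial_1\circ\partial_3=\partial_2\circ\partial_3=0$; $e=\partial_1+\partial_3$; $E=u^1\partial_1+u^2\partial_2+u^3\partial_3$; the connection $\nabla^{(1)}$ with Christoffel symbols (symmetric in the lower indices, those not listed being $0$) $$\Gamma^1_{13}=f_2,\ \Gamma^1_{11}=\Gamma^1_{33}=-f_2,\ \Gamma^1_{22}=f_3,\quad \Gamma^2_{13}=f_5,\ \Gamma^2_{11}=\Gamma^2_{33}=-f_5,\ \Gamma^2_{12}=-f_2,\ \Gamma^2_{23}=f_2,\ \Gamma^2_{22}=f_6,$$ $$\Gamma^3_{13}=f_4,\ \Gamma^3_{11}=\Gamma^3_{33}=-f_4,\ \Gamma^3_{23}=f_1,\ \Gamma^3_{12}=-f_1;$$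 and the connection $\nabla^{(2)}$ with Christoffel symbols (symmetric, those not listed being $0$) $$\Gamma^1_{11}=\tfrac{f_3(u^2)^2-f_2u^1u^3-u^1}{(u^1)^2},\ \Gamma^1_{12}=-\tfrac{f_3u^2}{u^1},\ \Gamma^1_{13}=f_2,\ \Gamma^1_{22}=f_3,\ \Gamma^1_{33}=-\tfrac{f_2u^1}{u^3},$$ $$\Gamma^2_{11}=\tfrac{f_2u^2u^3-f_5u^1u^3+f_6(u^2)^2+u^2}{(u^1)^2},\ \Gamma^2_{12}=-\tfrac{f_2u^3+f_6u^2+1}{u^1},\ \Gamma^2_{13}=f_5,\ \Gamma^2_{22}=f_6,\ \Gamma^2_{23}=f_2,\ \Gamma^2_{33}=-\tfrac{f_5u^1+f_2u^2}{u^3},$$ $$\Gamma^3_{11}=\tfrac{f_1u^2u^3-f_4u^1u^3}{(u^1)^2},\ \Gamma^3_{12}=-\tfrac{f_1u^3}{u^1},\ \Gamma^3_{13}=f_4,\ \Gamma^3_{23}=f_1,\ \Gamma^3_{33}=-\tfrac{f_1u^2+f_4u^1+1}{u^3}.$$ Painlevé V with parameters $a,b,g,d$ is $$y''=\Big(\frac1{2y}+\frac1{y-1}\Big)y'^2-\frac{y'}{x}+\frac{(y-1)^2}{x^2}\Big(ay+\frac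 by\Big)+\frac{gy}{x}+\frac{dy(y+1)}{y-1};$$ a solution on an open set $X\subseteq\mathbb K\setminus\{0\}$ is understood to be twice differentiable with values different from $0$ and $1$. **Theorem.** (1) Around every point of such a manifold there are local coordinates $(u^1,u^2,u^3)$, with values in $\Omega_S$ for some connected open $S\subseteq\mathbb K\setminus\{0\}$, in which the structure is a model with some profile $F$ over $S$, and this model is bi-flat on all of $\Omega_S$. (2) Let $S\subseteq\mathbb K\setminus\{0\}$ be open and connected, and let the model with profile $F$ be bi-flat on $\Omega_S$. Then there are constants $I_1,I_2,I_3,a$ such that on $S$ $$F_3=I_1,\qquad F_1-zF_4=I_2,\qquad F_6+2zF_2=I_3,\qquad \tfrac12\big[(F_6-I_2)^2+4(zF_5-F_2)(I_1-zF_1)\big]=a .$$ Suppose $I_1\ne0$. On the open set of those $x$ for which $z=1/x$ lies in $S$ and $F_1(z)\neq0$, $zF_1(z)\ne I_1$, the function $$y(x)=\frac{zF_1(z)}{zF_1(z)-I_1},\qquad z=\frac1x,$$ solves Painlevé V with parameters $$a,\qquad b=-\tfrac12I_2^2,\qquad g=I_1I_3+I_1,\qquad d=-\tfrac12I_1^2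 .$$ Moreover either $F_1\equiv0$ on $S$, or $zF_1\equiv I_1$ on $S$, or the excluded points of $S$ (those with $F_1(z)=0$ or $zF_1(z)=I_1$) do not accumulate in $S$. (3) Conversely, let $y$ be a solution of Painlevé V with parameters $a,b,g,d$ on an open set $X\subseteq\mathbb K\setminus\{0\}$, and let $I_1\neq0,I_2,I_3$ satisfy $-2d=I_1^2$, $-2b=I_2^2$, $g=I_1I_3+I_1$ (for $\mathbb K=\mathbb C$ such numbers exist whenever $d\ne0$). Put $S=\{1/x:x\in X\}$. Then there is a profile $F$, unique on $S$, such that the model with profile $F$ is bi-flat on $\Omega_S$, the four identities in (2) hold on $S$ with these $I_1,I_2,I_3,a$, and $y(x)=zF_1(z)/(zF_1(z)-I_1)$ for $z=1/x$, $x\in X$. For it $F_1(z)\neq 0$ and $zF_1(z)\ne I_1$ on $S$, and at every point of $\Omega_S$ the operator $L$ has two distinct eigenvalues, one of them with a $2\times2$ Jordan block. -/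

import Mathlib

open Set Filter Topology
open scoped Manifold ContDiff

noncomputable section

/-- The partial derivative `∂_s f` at `u`. -/
def pd {𝕜 : Type*} [RCLike 𝕜] {n : ℕ} (s : Fin n) (f : (Fin n → 𝕜) → 𝕜) (u : Fin n → 𝕜) : 𝕜 :=
  fderiv 𝕜 f u (Pi.single s 1)

/-- A field of components with one upper and two lower indices: `T u i j k` is `T^i_{jk}(u)`.
For a connection, `Γ^i_{jk}` is determined by `∇_{∂_j} ∂_k = ∑ i, Γ^i_{jk} ∂_i`. -/
abbrev Comp (𝕜 : Type*) (n : ℕ) : Type _ := (Fin n → 𝕜) → Fin n → Fin n → Fin n → 𝕜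

section Components

variable {𝕜 : Type*} [RCLike 𝕜] {n : ℕ}

/-- All components are smooth (over `ℂ`: holomorphic) on `Ω`. -/
def SmoothComp (T : Comp 𝕜 n) (Ω : Set (Fin n → 𝕜)) : Prop :=
  ∀ i j k, ContDiffOn 𝕜 ∞ (fun u => T u i j k) Ω

/-- The product with components `c` is commutative and associative with unit `e`, and satisfies
the Hertling–Manin condition `P_{X ∘ Y}(Z, W) = X ∘ P_Y(Z, W) + Y ∘ P_X(Z, W)`, where
`P_X(Z, W) = [X, Z ∘ W] - [X, Z] ∘ W - Z ∘ [X, W]`. The latter is tensorial, and it is written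
here for `X = ∂_a`, `Y = ∂_b`, `Z = ∂_p`, `W = ∂_q`. -/
structure IsFManifoldOn (c : Comp 𝕜 n) (e : (Fin n → 𝕜) → Fin n → 𝕜)
    (Ω : Set (Fin n → 𝕜)) : Prop where
  smooth_c : SmoothComp c Ω
  smooth_e : ContDiffOn 𝕜 ∞ e Ω
  comm : ∀ u ∈ Ω, ∀ i j k, c u i j k = c u i k j
  assoc : ∀ u ∈ Ω, ∀ i j k m, ∑ l, c u i j l * c u l k m = ∑ l, c u i k l * c u l j m
  unit : ∀ u ∈ Ω, ∀ i j, ∑ s, c u i s j * e u s = if i = j then 1 else 0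
  hertlingManin : ∀ u ∈ Ω, ∀ a b p q k,
    ∑ s, (c u s a b * pd s (fun v => c v k p q) u - c u s p q * pd s (fun v => c v k a b) u
        + c u k s q * pd p (fun v => c v s a b) u + c u k p s * pd q (fun v => c v s a b) u)
      = ∑ s, (c u k a s * pd b (fun v => c v s p q) u + c u k b s * pd a (fun v => c v s p q) u)

/-- The component `∇_i c^k_{lj}` of the covariant derivative of the product. -/
def covDerivProduct (Γ c : Comp 𝕜 n) (u : Fin n → 𝕜) (i k l j : Fin n) : 𝕜 :=
  pd i (fun v => c v k l j) u
    + ∑ s, (Γ u k i s * c u s l j - Γ u s i l * c u k s j - Γ u s i j * c u k l s)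

/-- The components of `R(∂_i, ∂_j) ∂_l`. -/
def curvature (Γ : Comp 𝕜 n) (u : Fin n → 𝕜) (k l i j : Fin n) : 𝕜 :=
  pd i (fun v => Γ v k j l) u - pd j (fun v => Γ v k i l) u
    + ∑ s, (Γ u k i s * Γ u s j l - Γ u k j s * Γ u s i l)

/-- The connection `Γ` is smooth, torsionless and flat, its covariant derivative of the product
`c` is symmetric, and the vector field `e` is parallel. -/
structure IsFlatCompatibleOn (Γ c : Comp 𝕜 n) (e : (Fin n → 𝕜) → Fin n → 𝕜)
    (Ω : Set (Fin n → 𝕜)) : Prop where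
  smooth_Γ : SmoothComp Γ Ω
  torsionless : ∀ u ∈ Ω, ∀ i j k, Γ u i j k = Γ u i k j
  flat : ∀ u ∈ Ω, ∀ k l i j, curvature Γ u k l i j = 0
  compatible : ∀ u ∈ Ω, ∀ i k l j, covDerivProduct Γ c u i k l j = covDerivProduct Γ c u l k i j
  parallel : ∀ u ∈ Ω, ∀ i k, pd i (fun v => e v k) u + ∑ s, Γ u k i s * e u s = 0

/-- The `k`-th component of `(d_∇ W)(∂_i, ∂_j)`, where `W u k j` is the endomorphism field
`W^k_j` regarded as a one-form with values in the tangent bundle. -/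
def dNabla (Γ : Comp 𝕜 n) (W : (Fin n → 𝕜) → Fin n → Fin n → 𝕜)
    (u : Fin n → 𝕜) (k i j : Fin n) : 𝕜 :=
  (pd i (fun v => W v k j) u + ∑ s, Γ u k i s * W u s j)
    - (pd j (fun v => W v k i) u + ∑ s, Γ u k j s * W u s i)

/-- The endomorphism field `X ∘`. -/
def mulBy (c : Comp 𝕜 n) (X : (Fin n → 𝕜) → Fin n → 𝕜) (u : Fin n → 𝕜) (k j : Fin n) : 𝕜 :=
  ∑ s, c u k s j * X u s

/-- `(d_∇ - d_∇') (X ∘) = 0` for all vector fields `X`. -/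
def AlmostHydroEquivOn (Γ Γ' c : Comp 𝕜 n) (Ω : Set (Fin n → 𝕜)) : Prop :=
  ∀ X : (Fin n → 𝕜) → Fin n → 𝕜, ContDiffOn 𝕜 ∞ X Ω →
    ∀ u ∈ Ω, ∀ k i j, dNabla Γ (mulBy c X) u k i j = dNabla Γ' (mulBy c X) u k i j

/-- The product `X * Y = X ∘ Y ∘ E⁻¹`. -/
def dualProduct (c : Comp 𝕜 n) (Einv : (Fin n → 𝕜) → Fin n → 𝕜) : Comp 𝕜 n :=
  fun u i j k => ∑ m, ∑ l, c u i m l * Einv u m * c u l j k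

end Components

/-- The components, in one coordinate system, of a product `∘`, its unit `e`, a vector field `E`
with its inverse `E⁻¹` for `∘`, and two affine connections. -/
structure BiFlatData (𝕜 : Type*) (n : ℕ) where
  c : Comp 𝕜 n
  e : (Fin n → 𝕜) → Fin n → 𝕜
  E : (Fin n → 𝕜) → Fin n → 𝕜
  Einv : (Fin n → 𝕜) → Fin n → 𝕜
  Γ₁ : Comp 𝕜 n
  Γ₂ : Comp 𝕜 n

section BiFlat

variable {𝕜 : Type*} [RCLike 𝕜] {n : ℕ}

/-- The matrix of `L = E ∘`. -/
def BiFlatData.L (D : BiFlatData 𝕜 n) (u : Fin n → 𝕜) : Matrix (Fin n) (Fin n) 𝕜 :=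
  Matrix.of (mulBy D.c D.E u)

/-- The dual product `*`. -/
def BiFlatData.cStar (D : BiFlatData 𝕜 n) : Comp 𝕜 n := dualProduct D.c D.Einv

/-- The components `D` form a bi-flat `F`-manifold structure on the coordinate domain `Ω`. -/
structure IsBiFlatOn (D : BiFlatData 𝕜 n) (Ω : Set (Fin n → 𝕜)) : Prop where
  fManifold : IsFManifoldOn D.c D.e Ω
  smooth_E : ContDiffOn 𝕜 ∞ D.E Ω
  smooth_Einv : ContDiffOn 𝕜 ∞ D.Einv Ω
  /-- `E ∘ E⁻¹ = e` -/
  inverse : ∀ u ∈ Ω, ∀ i, ∑ j, ∑ k, D.c u i j k * D.E u j * D.Einv u k = D.e u i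
  /-- `E` is an eventual identity. -/
  eventual : IsFManifoldOn D.cStar D.E Ω
  /-- `[e, E] = e` -/
  euler : ∀ u ∈ Ω, VectorField.lieBracket 𝕜 D.e D.E u = D.e u
  flat₁ : IsFlatCompatibleOn D.Γ₁ D.c D.e Ω
  flat₂ : IsFlatCompatibleOn D.Γ₂ D.cStar D.E Ω
  hydro : AlmostHydroEquivOn D.Γ₁ D.Γ₂ D.c Ω
  hydroStar : AlmostHydroEquivOn D.Γ₁ D.Γ₂ D.cStar Ω

/-- At the point `u`, the components `D` are transformed into the components `D'` by the change of
coordinates `τ`. -/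
structure TransformsAt (D D' : BiFlatData 𝕜 n) (τ : (Fin n → 𝕜) → (Fin n → 𝕜))
    (u : Fin n → 𝕜) : Prop where
  product : ∀ i a b,
    ∑ j, ∑ k, D'.c (τ u) i j k * pd a (fun v => τ v j) u * pd b (fun v => τ v k) u
      = ∑ l, pd l (fun v => τ v i) u * D.c u l a b
  unit : D'.e (τ u) = fderiv 𝕜 τ u (D.e u)
  field : D'.E (τ u) = fderiv 𝕜 τ u (D.E u)
  fieldInv : D'.Einv (τ u) = fderiv 𝕜 τ u (D.Einv u)
  connection₁ : ∀ i a b,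
    ∑ j, ∑ k, D'.Γ₁ (τ u) i j k * pd a (fun v => τ v j) u * pd b (fun v => τ v k) u
        + pd a (fun v => pd b (fun w => τ w i) v) u
      = ∑ l, pd l (fun v => τ v i) u * D.Γ₁ u l a b
  connection₂ : ∀ i a b,
    ∑ j, ∑ k, D'.Γ₂ (τ u) i j k * pd a (fun v => τ v j) u * pd b (fun v => τ v k) u
        + pd a (fun v => pd b (fun w => τ w i) v) u
      = ∑ l, pd l (fun v => τ v i) u * D.Γ₂ u l a b

end BiFlat

/-- A bi-flat `F`-manifold structure on a real or complex manifold `M` (smooth over `ℝ`,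
holomorphic over `ℂ`), given by its components in all charts of the maximal atlas. -/
structure BiFlatFManifold (𝕜 : Type*) [RCLike 𝕜] (n : ℕ) (M : Type*) [TopologicalSpace M]
    [ChartedSpace (Fin n → 𝕜) M] [IsManifold 𝓘(𝕜, Fin n → 𝕜) ∞ M] where
  data : OpenPartialHomeomorph M (Fin n → 𝕜) → BiFlatData 𝕜 n
  isBiFlat : ∀ φ ∈ IsManifold.maximalAtlas 𝓘(𝕜, Fin n → 𝕜) ∞ M, IsBiFlatOn (data φ) φ.target
  transform : ∀ φ ∈ IsManifold.maximalAtlas 𝓘(𝕜, Fin n → 𝕜) ∞ M,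
    ∀ ψ ∈ IsManifold.maximalAtlas 𝓘(𝕜, Fin n → 𝕜) ∞ M,
      ∀ u ∈ (φ.symm.trans ψ).source, TransformsAt (data φ) (data ψ) (φ.symm.trans ψ) u

section Jordan

variable {𝕜 : Type*} [RCLike 𝕜]

/-- The matrix has exactly two distinct eigenvalues in `𝕜`, with one Jordan block for each of
them, of sizes two and one. -/
def HasJordanTypeTwoOne (A : Matrix (Fin 3) (Fin 3) 𝕜) : Prop :=
  ∃ (μ ν : 𝕜) (P : Matrix (Fin 3) (Fin 3) 𝕜), μ ≠ ν ∧ IsUnit P.det ∧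
    A * P = P * !![μ, 1, 0; 0, μ, 0; 0, 0, ν]

/-- `M` is regular and, at each point, `L = E ∘` has two distinct eigenvalues, one of them with a
`2 × 2` Jordan block. -/
def BiFlatFManifold.IsRegularTwoOne {M : Type*} [TopologicalSpace M]
    [ChartedSpace (Fin 3 → 𝕜) M] [IsManifold 𝓘(𝕜, Fin 3 → 𝕜) ∞ M]
    (B : BiFlatFManifold 𝕜 3 M) : Prop :=
  ∀ φ ∈ IsManifold.maximalAtlas 𝓘(𝕜, Fin 3 → 𝕜) ∞ M,
    ∀ u ∈ φ.target, HasJordanTypeTwoOne ((B.data φ).L u)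

end Jordan

/-- Six functions of one variable. -/
structure Profile (𝕜 : Type*) where
  F₁ : 𝕜 → 𝕜
  F₂ : 𝕜 → 𝕜
  F₃ : 𝕜 → 𝕜
  F₄ : 𝕜 → 𝕜
  F₅ : 𝕜 → 𝕜
  F₆ : 𝕜 → 𝕜

section Model

variable {𝕜 : Type*} [RCLike 𝕜]

/-- The variable `z = (u³ - u¹) / u²` (superscripts are indices). -/
def zCoord (u : Fin 3 → 𝕜) : 𝕜 := (u 2 - u 0) / u 1

/-- The points with `u¹ ≠ 0`, `u² ≠ 0`, `u³ ≠ 0`, `u¹ ≠ u³` at which `z` lies in `S`. -/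
def domainOver (S : Set 𝕜) : Set (Fin 3 → 𝕜) :=
  {u | u 0 ≠ 0 ∧ u 1 ≠ 0 ∧ u 2 ≠ 0 ∧ u 0 ≠ u 2 ∧ zCoord u ∈ S}

/-- The Christoffel symbols of the first connection in canonical coordinates. -/
def modelΓ₁ (F : Profile 𝕜) : Comp 𝕜 3 := fun u =>
  let f₁ := F.F₁ (zCoord u) / u 1
  let f₂ := F.F₂ (zCoord u) / u 1
  let f₃ := F.F₃ (zCoord u) / u 1
  let f₄ := F.F₄ (zCoord u) / u 1
  let f₅ := F.F₅ (zCoord u) / u 1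
  let f₆ := F.F₆ (zCoord u) / u 1
  ![![![-f₂, 0, f₂], ![0, f₃, 0], ![f₂, 0, -f₂]],
    ![![-f₅, -f₂, f₅], ![-f₂, f₆, f₂], ![f₅, f₂, -f₅]],
    ![![-f₄, -f₁, f₄], ![-f₁, 0, f₁], ![f₄, f₁, -f₄]]]

/-- The Christoffel symbols of the second connection in canonical coordinates. -/
def modelΓ₂ (F : Profile 𝕜) : Comp 𝕜 3 := fun u =>
  let f₁ := F.F₁ (zCoord u) / u 1
  let f₂ := F.F₂ (zCoord u) / u 1
  let f₃ := F.F₃ (zCoord u) / u 1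
  let f₄ := F.F₄ (zCoord u) / u 1
  let f₅ := F.F₅ (zCoord u) / u 1
  let f₆ := F.F₆ (zCoord u) / u 1
  let x := u 0
  let y := u 1
  let w := u 2
  ![![![(f₃ * y ^ 2 - f₂ * w * x - x) / x ^ 2, -(f₃ * y) / x, f₂],
      ![-(f₃ * y) / x, f₃, 0],
      ![f₂, 0, -(f₂ * x) / w]],
    ![![(f₂ * w * y - f₅ * w * x + f₆ * y ^ 2 + y) / x ^ 2, -(f₂ * w + f₆ * y + 1) / x, f₅],
      ![-(f₂ * w + f₆ * y + 1) / x, f₆, f₂],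
      ![f₅, f₂, -(f₅ * x + f₂ * y) / w]],
    ![![(f₁ * y * w - f₄ * x * w) / x ^ 2, -(f₁ * w) / x, f₄],
      ![-(f₁ * w) / x, 0, f₁],
      ![f₄, f₁, -(f₁ * y + f₄ * x + 1) / w]]]

/-- The structure in canonical coordinates: `∂₁ ∘ ∂₁ = ∂₁`, `∂₁ ∘ ∂₂ = ∂₂`, `∂₂ ∘ ∂₂ = 0`,
`∂₃ ∘ ∂₃ = ∂₃`, `∂₃ ∘ ∂₁ = ∂₃ ∘ ∂₂ = 0`, `e = ∂₁ + ∂₃`, `E = u¹ ∂₁ + u² ∂₂ + u³ ∂₃`. -/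
def model (F : Profile 𝕜) : BiFlatData 𝕜 3 where
  c := fun _ =>
    ![![![1, 0, 0], ![0, 0, 0], ![0, 0, 0]],
      ![![0, 1, 0], ![1, 0, 0], ![0, 0, 0]],
      ![![0, 0, 0], ![0, 0, 0], ![0, 0, 1]]]
  e := fun _ => ![1, 0, 1]
  E := fun u => u
  Einv := fun u => ![1 / u 0, -(u 1) / u 0 ^ 2, 1 / u 2]
  Γ₁ := modelΓ₁ F
  Γ₂ := modelΓ₂ F

/-- The components `D` and `D'` agree on `Ω`. -/
structure BiFlatData.AgreeOn {n : ℕ} (D D' : BiFlatData 𝕜 n) (Ω : Set (Fin n → 𝕜)) : Prop where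
  c : EqOn D.c D'.c Ω
  e : EqOn D.e D'.e Ω
  E : EqOn D.E D'.E Ω
  Einv : EqOn D.Einv D'.Einv Ω
  Γ₁ : EqOn D.Γ₁ D'.Γ₁ Ω
  Γ₂ : EqOn D.Γ₂ D'.Γ₂ Ω

/-- The profiles `F` and `G` agree on `S`. -/
structure Profile.AgreeOn (F G : Profile 𝕜) (S : Set 𝕜) : Prop where
  F₁ : EqOn F.F₁ G.F₁ S
  F₂ : EqOn F.F₂ G.F₂ S
  F₃ : EqOn F.F₃ G.F₃ S
  F₄ : EqOn F.F₄ G.F₄ S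
  F₅ : EqOn F.F₅ G.F₅ S
  F₆ : EqOn F.F₆ G.F₆ S

/-- The four expressions on the left are constant on `S`, with the given values. -/
structure Profile.HasIntegrals (F : Profile 𝕜) (S : Set 𝕜) (I₁ I₂ I₃ a : 𝕜) : Prop where
  first : ∀ z ∈ S, F.F₃ z = I₁
  second : ∀ z ∈ S, F.F₁ z - z * F.F₄ z = I₂
  third : ∀ z ∈ S, F.F₆ z + 2 * z * F.F₂ z = I₃
  fourth : ∀ z ∈ S,
    ((F.F₆ z - I₂) ^ 2 + 4 * (z * F.F₅ z - F.F₂ z) * (I₁ - z * F.F₁ z)) / 2 = a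

/-- `y(x) = z F₁(z) / (z F₁(z) - I₁)` with `z = 1 / x`. -/
def Profile.painleveFunction (F : Profile 𝕜) (I₁ : 𝕜) : 𝕜 → 𝕜 := fun x =>
  x⁻¹ * F.F₁ x⁻¹ / (x⁻¹ * F.F₁ x⁻¹ - I₁)

/-- The points `z` of `S` at which `z F₁(z) / (z F₁(z) - I₁)` is finite and not zero. -/
def Profile.genericSet (F : Profile 𝕜) (I₁ : 𝕜) (S : Set 𝕜) : Set 𝕜 :=
  {z | z ∈ S ∧ F.F₁ z ≠ 0 ∧ z * F.F₁ z ≠ I₁}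

/-- `y` solves the fifth Painlevé equation with parameters `a`, `b`, `g`, `d` on the open
set `X`, and it avoids the singular values `0` and `1` of the equation there. -/
structure IsPainleveVSolution (a b g d : 𝕜) (X : Set 𝕜) (y : 𝕜 → 𝕜) : Prop where
  isOpen : IsOpen X
  ne_zero : ∀ x ∈ X, x ≠ 0
  value_ne_zero : ∀ x ∈ X, y x ≠ 0
  value_ne_one : ∀ x ∈ X, y x ≠ 1
  differentiableAt : ∀ x ∈ X, DifferentiableAt 𝕜 y x
  differentiableAt_deriv : ∀ x ∈ X, DifferentiableAt 𝕜 (deriv y) x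
  equation : ∀ x ∈ X, deriv (deriv y) x =
    (1 / (2 * y x) + 1 / (y x - 1)) * deriv y x ^ 2 - deriv y x / x
      + (y x - 1) ^ 2 * (a * y x + b / y x) / x ^ 2 + g * y x / x
      + d * y x * (y x + 1) / (y x - 1)

end Model

end

/-! Everything is reduced to a system of ordinary differential equations in z, `Profile.SystemAt`.
For a model, the algebraic axioms hold for every profile (smoothness and flatness aside), and
flatness of ∇⁽¹⁾ at one point over z already gives the system at z. Conversely the system makes both
connections flat. So over an open S without 0 a model is bi-flat exactly when its profile is smooth
and solves the system (`isBiFlatOn_model`, `smoothOn_and_systemAt`).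

Local form. The eigenvalues μ (double) and ν (simple) of L are rational in its entries, hence
smooth. With X = E - μe, the field R = X∘X/(ν - μ)² is idempotent, P = e - R is the complementary
idempotent, N = X - (ν - μ)R is nilpotent, and E = μP + N + νR. The Hertling–Manin condition makes
the product invariant under P and R (`lieDerivative_idempotent`); since E is an eventual identity
with [e, E] = e, the Lie derivative of the product along E is the product itself
(`lieDerivative_euler`). Differentiating the multiplication table of P, N, R then shows that these
fields commute and that μ and ν have derivatives (1, 0, 0) and (0, 0, 1) along P, N, R
(`frame_relations`). By the Poincaré lemma there is t with derivatives (0, 1, 0), and (μ, exp t, ν)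
are canonical coordinates: P = ∂₁, N = u²∂₂, R = ∂₃ (`BiFlatFManifold.exists_isCanonicalOn`).

In these coordinates ∇⁽¹⁾e = 0 and the symmetry of ∇⁽¹⁾∘ leave six free components of ∇⁽¹⁾. The
conditions on d_∇ make ∇⁽²⁾ share them, and ∇⁽²⁾E = 0 fixes the rest of ∇⁽²⁾. A parallel field of a
flat torsionless connection is an infinitesimal affine symmetry, so the shared components are
invariant under e and homogeneous of degree -1 under E; hence u² times such a component depends on z
only (`IsCanonicalOn.mul_component_eq`), which defines the profile (`IsCanonicalOn.exists_profile`).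

Painlevé V. The first three integrals come directly from the system. Put w = zF₁ - I₁, v = F₆ - I₂,
q = zF₅ - F₂. These satisfy a homogeneous linear system that preserves v² - 4qw = 2a, the fourth
integral. In x = 1/z, eliminating F₂, F₄, F₅ through the integrals leaves a first-order system for y
and h = F₆, `IsPainleveVSystem`. It is equivalent to Painlevé V: where y avoids 0 and 1 its first
equation can be solved for h, and its second then is the Painlevé equation. Reading the
substitutions backwards gives the converse, and F₁ ≠ 0, zF₁ ≠ I₁ make the profile unique.

The excluded points do not accumulate unless a whole alternative holds, because linear equations
have unique solutions (`eq_zero_of_norm_deriv_le`): a degenerate zero of F₁, or a common zero of w,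
v, q, forces identical vanishing. -/

open Set Filter Topology
open scoped Manifold ContDiff

noncomputable section

/-! ### Calculus of partial derivatives -/

section Gradient

variable {𝕜 : Type*} [RCLike 𝕜] {n : ℕ}

/-- `f` is differentiable at `u` with partial derivatives `g`. -/
def HasGrad (f : (Fin n → 𝕜) → 𝕜) (g : Fin n → 𝕜) (u : Fin n → 𝕜) : Prop :=
  DifferentiableAt 𝕜 f u ∧ ∀ s, pd s f u = g s

theorem HasGrad.congr_grad {f : (Fin n → 𝕜) → 𝕜} {g g' : Fin n → 𝕜} {u : Fin n → 𝕜}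
    (h : HasGrad f g u) (hg : ∀ s, g s = g' s) : HasGrad f g' u :=
  ⟨h.1, fun s => (h.2 s).trans (hg s)⟩

theorem HasGrad.const (a : 𝕜) (u : Fin n → 𝕜) : HasGrad (fun _ => a) (fun _ => 0) u :=
  ⟨differentiableAt_const a, fun s => by simp [pd]⟩

theorem HasGrad.coord (i : Fin n) (u : Fin n → 𝕜) :
    HasGrad (fun v => v i) (Pi.single i 1) u := by
  refine ⟨differentiableAt_apply i u, fun s => ?_⟩
  have h : HasFDerivAt (fun v : Fin n → 𝕜 => v i)
    (ContinuousLinearMap.proj (R := 𝕜) (φ := fun _ : Fin n => 𝕜) i) u := hasFDerivAt_apply i u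
  simp [pd, h.fderiv, Pi.single_apply, eq_comm]

theorem HasGrad.add {f f' : (Fin n → 𝕜) → 𝕜} {g g' : Fin n → 𝕜} {u : Fin n → 𝕜}
    (h : HasGrad f g u) (h' : HasGrad f' g' u) :
    HasGrad (fun v => f v + f' v) (fun s => g s + g' s) u :=
  ⟨h.1.add h'.1, fun s => by
    beta_reduce; rw [← h.2, ← h'.2]; simp [pd, fderiv_fun_add h.1 h'.1]⟩

theorem HasGrad.neg {f : (Fin n → 𝕜) → 𝕜} {g : Fin n → 𝕜} {u : Fin n → 𝕜}
    (h : HasGrad f g u) : HasGrad (fun v => -f v) (fun s => -g s) u :=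
  ⟨h.1.neg, fun s => by beta_reduce; rw [← h.2]; simp [pd]⟩

theorem HasGrad.sub {f f' : (Fin n → 𝕜) → 𝕜} {g g' : Fin n → 𝕜} {u : Fin n → 𝕜}
    (h : HasGrad f g u) (h' : HasGrad f' g' u) :
    HasGrad (fun v => f v - f' v) (fun s => g s - g' s) u :=
  ⟨h.1.sub h'.1, fun s => by
    beta_reduce; rw [← h.2, ← h'.2]; simp [pd, fderiv_fun_sub h.1 h'.1]⟩

theorem HasGrad.mul {f f' : (Fin n → 𝕜) → 𝕜} {g g' : Fin n → 𝕜} {u : Fin n → 𝕜}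
    (h : HasGrad f g u) (h' : HasGrad f' g' u) :
    HasGrad (fun v => f v * f' v) (fun s => g s * f' u + f u * g' s) u :=
  ⟨h.1.mul h'.1, fun s => by
    beta_reduce; rw [← h.2, ← h'.2]; simp [pd, fderiv_fun_mul h.1 h'.1]; ring⟩

theorem HasGrad.comp_deriv {F : 𝕜 → 𝕜} {F' : 𝕜} {f : (Fin n → 𝕜) → 𝕜} {g : Fin n → 𝕜}
    {u : Fin n → 𝕜} (hF : HasDerivAt F F' (f u)) (h : HasGrad f g u) :
    HasGrad (fun v => F (f v)) (fun s => F' * g s) u := by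
  have h2 := hF.comp_hasFDerivAt u h.1.hasFDerivAt
  refine ⟨h2.differentiableAt, fun s => ?_⟩
  have : fderiv 𝕜 (fun v => F (f v)) u = F' • fderiv 𝕜 f u := h2.fderiv
  beta_reduce
  rw [← h.2]
  simp [pd, this]

theorem HasGrad.div {f f' : (Fin n → 𝕜) → 𝕜} {g g' : Fin n → 𝕜} {u : Fin n → 𝕜}
    (h : HasGrad f g u) (h' : HasGrad f' g' u) (h0 : f' u ≠ 0) :
    HasGrad (fun v => f v / f' v) (fun s => (g s * f' u - f u * g' s) / f' u ^ 2) u := by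
  have h1 := h.mul (HasGrad.comp_deriv (hasDerivAt_inv h0) h')
  change HasGrad (fun v => f v * (f' v)⁻¹) _ u at h1
  simp only [← div_eq_mul_inv] at h1
  refine h1.congr_grad fun s => ?_
  field_simp
  ring

theorem HasGrad.pow_two {f : (Fin n → 𝕜) → 𝕜} {g : Fin n → 𝕜} {u : Fin n → 𝕜}
    (h : HasGrad f g u) : HasGrad (fun v => f v ^ 2) (fun s => 2 * f u * g s) u := by
  have h2 := (h.mul h).congr_grad (g' := fun s => 2 * f u * g s) fun s => by ring
  have e : (fun v => f v ^ 2) = fun v => f v * f v := by funext v; ring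
  rwa [e]

end Gradient

/-! ### The differential system for the profile and flatness of the first connection -/

section ProfileSystem

variable {𝕜 : Type*} [RCLike 𝕜]

theorem hasGrad_zCoord {u : Fin 3 → 𝕜} (h1 : u 1 ≠ 0) :
    HasGrad zCoord ![-(1 / u 1), -(zCoord u / u 1), 1 / u 1] u := by
  refine (((HasGrad.coord 2 u).sub (HasGrad.coord 0 u)).div (HasGrad.coord 1 u) h1).congr_grad
    fun s => ?_
  fin_cases s <;> simp [zCoord] <;> field_simp
  ring

/-- `F(z) / u²` has the expected partial derivatives. -/
theorem hasGrad_profile {F : 𝕜 → 𝕜} {u : Fin 3 → 𝕜} (h1 : u 1 ≠ 0)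
    (hF : DifferentiableAt 𝕜 F (zCoord u)) :
    HasGrad (fun v => F (zCoord v) / v 1)
      ![-(deriv F (zCoord u) / u 1 ^ 2),
        -((zCoord u * deriv F (zCoord u) + F (zCoord u)) / u 1 ^ 2),
        deriv F (zCoord u) / u 1 ^ 2] u := by
  refine ((HasGrad.comp_deriv hF.hasDerivAt (hasGrad_zCoord h1)).div
    (HasGrad.coord 1 u) h1).congr_grad fun s => ?_
  fin_cases s <;> simp <;> field_simp
  ring

/-- The system of ordinary differential equations for the profile that expresses flatness. -/
structure Profile.SystemAt (F : Profile 𝕜) (z : 𝕜) : Prop where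
  eq₁ : z * deriv F.F₁ z = F.F₁ z ^ 2 - F.F₁ z * F.F₆ z - F.F₁ z - F.F₃ z * F.F₄ z
  eq₂ : z * deriv F.F₂ z = -(F.F₁ z * F.F₂ z) - F.F₂ z + F.F₃ z * F.F₅ z
  eq₃ : deriv F.F₃ z = 0
  eq₄ : z * deriv F.F₄ z + F.F₄ z = deriv F.F₁ z
  eq₅ : z * deriv F.F₅ z - deriv F.F₂ z
    = -(F.F₁ z * F.F₅ z) + F.F₂ z * F.F₄ z + F.F₅ z * F.F₆ z - F.F₅ z
  eq₆ : deriv F.F₆ z + z * deriv F.F₂ z = F.F₁ z * F.F₂ z - F.F₂ z - F.F₃ z * F.F₅ z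

/-- The six functions of the profile are smooth on `S`. -/
structure Profile.SmoothOn (F : Profile 𝕜) (S : Set 𝕜) : Prop where
  F₁ : ContDiffOn 𝕜 ∞ F.F₁ S
  F₂ : ContDiffOn 𝕜 ∞ F.F₂ S
  F₃ : ContDiffOn 𝕜 ∞ F.F₃ S
  F₄ : ContDiffOn 𝕜 ∞ F.F₄ S
  F₅ : ContDiffOn 𝕜 ∞ F.F₅ S
  F₆ : ContDiffOn 𝕜 ∞ F.F₆ S

/-- The six functions of the profile are differentiable at `z`. -/
structure Profile.DiffAt (F : Profile 𝕜) (z : 𝕜) : Prop where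
  F₁ : DifferentiableAt 𝕜 F.F₁ z
  F₂ : DifferentiableAt 𝕜 F.F₂ z
  F₃ : DifferentiableAt 𝕜 F.F₃ z
  F₄ : DifferentiableAt 𝕜 F.F₄ z
  F₅ : DifferentiableAt 𝕜 F.F₅ z
  F₆ : DifferentiableAt 𝕜 F.F₆ z

theorem Profile.SmoothOn.diffAt {F : Profile 𝕜} {S : Set 𝕜} (h : F.SmoothOn S) (hS : IsOpen S)
    {z : 𝕜} (hz : z ∈ S) : F.DiffAt z := by
  have key : ∀ {f : 𝕜 → 𝕜}, ContDiffOn 𝕜 ∞ f S → DifferentiableAt 𝕜 f z := fun hf =>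
    (hf.contDiffAt (hS.mem_nhds hz)).differentiableAt (by simp)
  exact ⟨key h.F₁, key h.F₂, key h.F₃, key h.F₄, key h.F₅, key h.F₆⟩

/-- A connection whose components have the partial derivatives `dΓ`. -/
theorem curvature_eq_of_hasGrad {n : ℕ} {Γ : Comp 𝕜 n} {u : Fin n → 𝕜}
    {dΓ : Fin n → Fin n → Fin n → Fin n → 𝕜}
    (h : ∀ i j k, HasGrad (fun v => Γ v i j k) (dΓ i j k) u) (k l i j : Fin n) :
    curvature Γ u k l i j = dΓ k j l i - dΓ k i l j
      + ∑ s, (Γ u k i s * Γ u s j l - Γ u k j s * Γ u s i l) := by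
  rw [curvature, (h k j l).2, (h k i l).2]

theorem curvature_antisymm {n : ℕ} (Γ : Comp 𝕜 n) (u : Fin n → 𝕜) (k l i j : Fin n) :
    curvature Γ u k l i j = -curvature Γ u k l j i := by
  simp only [curvature, Finset.sum_sub_distrib]
  ring

theorem curvature_eq_zero_of_lt {Γ : Comp 𝕜 3} {u : Fin 3 → 𝕜}
    (h01 : ∀ k l, curvature Γ u k l 0 1 = 0) (h02 : ∀ k l, curvature Γ u k l 0 2 = 0)
    (h12 : ∀ k l, curvature Γ u k l 1 2 = 0) (k l i j : Fin 3) : curvature Γ u k l i j = 0 := by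
  have hd : ∀ i, curvature Γ u k l i i = 0 := fun i => by
    simp only [curvature, sub_self, Finset.sum_const_zero, add_zero]
  have h10 : curvature Γ u k l 1 0 = 0 := by rw [curvature_antisymm, h01, neg_zero]
  have h20 : curvature Γ u k l 2 0 = 0 := by rw [curvature_antisymm, h02, neg_zero]
  have h21 : curvature Γ u k l 2 1 = 0 := by rw [curvature_antisymm, h12, neg_zero]
  fin_cases i <;> fin_cases j
  exacts [hd 0, h01 k l, h02 k l, h10, hd 1, h12 k l, h20, h21, hd 2]

/-- The partial derivatives of `F(z) / u²`. -/
def profileGrad (F : 𝕜 → 𝕜) (u : Fin 3 → 𝕜) : Fin 3 → 𝕜 :=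
  ![-(deriv F (zCoord u) / u 1 ^ 2),
    -((zCoord u * deriv F (zCoord u) + F (zCoord u)) / u 1 ^ 2),
    deriv F (zCoord u) / u 1 ^ 2]

/-- The partial derivatives of the components of the first connection. -/
def modelΓ₁Grad (F : Profile 𝕜) (u : Fin 3 → 𝕜) : Fin 3 → Fin 3 → Fin 3 → Fin 3 → 𝕜 :=
  let g₁ := profileGrad F.F₁ u
  let g₂ := profileGrad F.F₂ u
  let g₃ := profileGrad F.F₃ u
  let g₄ := profileGrad F.F₄ u
  let g₅ := profileGrad F.F₅ u
  let g₆ := profileGrad F.F₆ u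
  ![![![-g₂, 0, g₂], ![0, g₃, 0], ![g₂, 0, -g₂]],
    ![![-g₅, -g₂, g₅], ![-g₂, g₆, g₂], ![g₅, g₂, -g₅]],
    ![![-g₄, -g₁, g₄], ![-g₁, 0, g₁], ![g₄, g₁, -g₄]]]

theorem hasGrad_modelΓ₁ {F : Profile 𝕜} {u : Fin 3 → 𝕜} (h1 : u 1 ≠ 0)
    (hF : F.DiffAt (zCoord u)) (i j k : Fin 3) :
    HasGrad (fun v => modelΓ₁ F v i j k) (modelΓ₁Grad F u i j k) u := by
  have h₁ := hasGrad_profile h1 hF.F₁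
  have h₂ := hasGrad_profile h1 hF.F₂
  have h₃ := hasGrad_profile h1 hF.F₃
  have h₄ := hasGrad_profile h1 hF.F₄
  have h₅ := hasGrad_profile h1 hF.F₅
  have h₆ := hasGrad_profile h1 hF.F₆
  have h0 : HasGrad (fun _ => (0 : 𝕜)) 0 u := HasGrad.const 0 u
  fin_cases i <;> fin_cases j <;> fin_cases k
  exacts [h₂.neg, h0, h₂, h0, h₃, h0, h₂, h0, h₂.neg,
    h₅.neg, h₂.neg, h₅, h₂.neg, h₆, h₂, h₅, h₂, h₅.neg,
    h₄.neg, h₁.neg, h₄, h₁.neg, h0, h₁, h₄, h₁, h₄.neg]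

theorem modelΓ₁_curvature {F : Profile 𝕜} {u : Fin 3 → 𝕜} (h1 : u 1 ≠ 0)
    (hF : F.DiffAt (zCoord u)) (k l i j : Fin 3) :
    curvature (modelΓ₁ F) u k l i j = modelΓ₁Grad F u k j l i - modelΓ₁Grad F u k i l j
      + ∑ s, (modelΓ₁ F u k i s * modelΓ₁ F u s j l - modelΓ₁ F u k j s * modelΓ₁ F u s i l) :=
  curvature_eq_of_hasGrad (hasGrad_modelΓ₁ h1 hF) k l i j

/-- If the first connection is flat at one point over `z`, then the system holds at `z`. -/
theorem systemAt_of_curvature_eq_zero {F : Profile 𝕜} {u : Fin 3 → 𝕜} (h1 : u 1 ≠ 0)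
    (hF : F.DiffAt (zCoord u)) (h : ∀ k l i j, curvature (modelΓ₁ F) u k l i j = 0) :
    F.SystemAt (zCoord u) := by
  -- Six components of R(∂₁, ∂₂) are enough: up to nonzero factors they are the six equations, in
  -- this order.
  have e1 := h 2 1 0 1
  have e2 := h 0 0 0 1
  have e3 := h 0 1 0 1
  have e4 := h 2 0 0 1
  have e5 := h 1 0 0 1
  have e6 := h 1 1 0 1
  rw [modelΓ₁_curvature h1 hF] at e1 e2 e3 e4 e5 e6
  simp [modelΓ₁Grad, modelΓ₁, profileGrad, Fin.sum_univ_three] at e1 e2 e3 e4 e5 e6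
  field_simp at e1 e2 e3 e4 e5 e6
  constructor
  · linear_combination -e1
  · linear_combination -e2
  · simpa [h1] using e3
  · linear_combination -e4
  · linear_combination -e5
  · linear_combination -e6

end ProfileSystem

/-! ### Flatness of both connections from the system -/

section SecondConnection

variable {𝕜 : Type*} [RCLike 𝕜]

/-- The partial derivatives of the components of the second connection. -/
def modelΓ₂Grad (F : Profile 𝕜) (u : Fin 3 → 𝕜) : Fin 3 → Fin 3 → Fin 3 → Fin 3 → 𝕜 :=
  let f₁ := F.F₁ (zCoord u) / u 1
  let f₂ := F.F₂ (zCoord u) / u 1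
  let f₃ := F.F₃ (zCoord u) / u 1
  let f₄ := F.F₄ (zCoord u) / u 1
  let f₅ := F.F₅ (zCoord u) / u 1
  let f₆ := F.F₆ (zCoord u) / u 1
  let g₁ := profileGrad F.F₁ u
  let g₂ := profileGrad F.F₂ u
  let g₃ := profileGrad F.F₃ u
  let g₄ := profileGrad F.F₄ u
  let g₅ := profileGrad F.F₅ u
  let g₆ := profileGrad F.F₆ u
  let x := u 0
  let y := u 1
  let w := u 2
  let X : Fin 3 → 𝕜 := Pi.single 0 1
  let Y : Fin 3 → 𝕜 := Pi.single 1 1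
  let W : Fin 3 → 𝕜 := Pi.single 2 1
  let c11 : Fin 3 → 𝕜 := fun s =>
    ((g₃ s * y ^ 2 + f₃ * (2 * y * Y s) - ((g₂ s * w + f₂ * W s) * x + f₂ * w * X s) - X s) * x ^ 2
      - (f₃ * y ^ 2 - f₂ * w * x - x) * (2 * x * X s)) / (x ^ 2) ^ 2
  let c12 : Fin 3 → 𝕜 := fun s => (-(g₃ s * y + f₃ * Y s) * x - -(f₃ * y) * X s) / x ^ 2
  let c33 : Fin 3 → 𝕜 := fun s => (-(g₂ s * x + f₂ * X s) * w - -(f₂ * x) * W s) / w ^ 2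
  let d11 : Fin 3 → 𝕜 := fun s =>
    (((g₂ s * w + f₂ * W s) * y + f₂ * w * Y s - ((g₅ s * w + f₅ * W s) * x + f₅ * w * X s)
      + (g₆ s * y ^ 2 + f₆ * (2 * y * Y s)) + Y s) * x ^ 2
      - (f₂ * w * y - f₅ * w * x + f₆ * y ^ 2 + y) * (2 * x * X s)) / (x ^ 2) ^ 2
  let d12 : Fin 3 → 𝕜 := fun s =>
    (-(g₂ s * w + f₂ * W s + (g₆ s * y + f₆ * Y s) + 0) * x - -(f₂ * w + f₆ * y + 1) * X s) / x ^ 2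
  let d33 : Fin 3 → 𝕜 := fun s =>
    (-(g₅ s * x + f₅ * X s + (g₂ s * y + f₂ * Y s)) * w - -(f₅ * x + f₂ * y) * W s) / w ^ 2
  let e11 : Fin 3 → 𝕜 := fun s =>
    (((g₁ s * y + f₁ * Y s) * w + f₁ * y * W s - ((g₄ s * x + f₄ * X s) * w + f₄ * x * W s)) * x ^ 2
      - (f₁ * y * w - f₄ * x * w) * (2 * x * X s)) / (x ^ 2) ^ 2
  let e12 : Fin 3 → 𝕜 := fun s => (-(g₁ s * w + f₁ * W s) * x - -(f₁ * w) * X s) / x ^ 2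
  let e33 : Fin 3 → 𝕜 := fun s =>
    (-(g₁ s * y + f₁ * Y s + (g₄ s * x + f₄ * X s) + 0) * w - -(f₁ * y + f₄ * x + 1) * W s) / w ^ 2
  ![![![c11, c12, g₂], ![c12, g₃, 0], ![g₂, 0, c33]],
    ![![d11, d12, g₅], ![d12, g₆, g₂], ![g₅, g₂, d33]],
    ![![e11, e12, g₄], ![e12, 0, g₁], ![g₄, g₁, e33]]]

theorem hasGrad_modelΓ₂ {F : Profile 𝕜} {u : Fin 3 → 𝕜} (h0 : u 0 ≠ 0) (h1 : u 1 ≠ 0)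
    (h2 : u 2 ≠ 0) (hF : F.DiffAt (zCoord u)) (i j k : Fin 3) :
    HasGrad (fun v => modelΓ₂ F v i j k) (modelΓ₂Grad F u i j k) u := by
  have f₁ := hasGrad_profile h1 hF.F₁
  have f₂ := hasGrad_profile h1 hF.F₂
  have f₃ := hasGrad_profile h1 hF.F₃
  have f₄ := hasGrad_profile h1 hF.F₄
  have f₅ := hasGrad_profile h1 hF.F₅
  have f₆ := hasGrad_profile h1 hF.F₆
  have x := HasGrad.coord 0 u
  have y := HasGrad.coord 1 u
  have w := HasGrad.coord 2 u
  have one : HasGrad (fun _ => (1 : 𝕜)) (fun _ => 0) u := HasGrad.const 1 u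
  have o : HasGrad (fun _ => (0 : 𝕜)) 0 u := HasGrad.const 0 u
  have hx2 : u 0 ^ 2 ≠ 0 := pow_ne_zero 2 h0
  have c11 := (((f₃.mul y.pow_two).sub ((f₂.mul w).mul x)).sub x).div x.pow_two hx2
  have c12 := (f₃.mul y).neg.div x h0
  have c33 := (f₂.mul x).neg.div w h2
  have d11 := (((((f₂.mul w).mul y).sub ((f₅.mul w).mul x)).add (f₆.mul y.pow_two)).add y).div
    x.pow_two hx2
  have d12 := (((f₂.mul w).add (f₆.mul y)).add one).neg.div x h0
  have d33 := ((f₅.mul x).add (f₂.mul y)).neg.div w h2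
  have e11 := (((f₁.mul y).mul w).sub ((f₄.mul x).mul w)).div x.pow_two hx2
  have e12 := (f₁.mul w).neg.div x h0
  have e33 := (((f₁.mul y).add (f₄.mul x)).add one).neg.div w h2
  fin_cases i <;> fin_cases j <;> fin_cases k
  exacts [c11, c12, f₂, c12, f₃, o, f₂, o, c33, d11, d12, f₅, d12, f₆, f₂, f₅, f₂, d33,
    e11, e12, f₄, e12, o, f₁, f₄, f₁, e33]

theorem zCoord_ne_zero {u : Fin 3 → 𝕜} (h1 : u 1 ≠ 0) (h02 : u 0 ≠ u 2) : zCoord u ≠ 0 :=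
  div_ne_zero (sub_ne_zero.2 h02.symm) h1

theorem eq_add_zCoord_mul {u : Fin 3 → 𝕜} (h1 : u 1 ≠ 0) : u 2 = u 0 + zCoord u * u 1 := by
  rw [zCoord, div_mul_cancel₀ _ h1]; ring

/-- The system, solved for the derivatives. -/
theorem Profile.SystemAt.solved {F : Profile 𝕜} {z : 𝕜} (h : F.SystemAt z) (hz : z ≠ 0) :
    deriv F.F₁ z = (F.F₁ z ^ 2 - F.F₁ z * F.F₆ z - F.F₁ z - F.F₃ z * F.F₄ z) / z ∧
    deriv F.F₂ z = (-(F.F₁ z * F.F₂ z) - F.F₂ z + F.F₃ z * F.F₅ z) / z ∧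
    deriv F.F₃ z = 0 ∧
    deriv F.F₄ z =
      (F.F₁ z ^ 2 - F.F₁ z * F.F₆ z - F.F₁ z - F.F₃ z * F.F₄ z - z * F.F₄ z) / z ^ 2 ∧
    deriv F.F₅ z = ((-(F.F₁ z * F.F₂ z) - F.F₂ z + F.F₃ z * F.F₅ z) / z
      - F.F₁ z * F.F₅ z + F.F₂ z * F.F₄ z + F.F₅ z * F.F₆ z - F.F₅ z) / z ∧
    deriv F.F₆ z = 2 * (F.F₁ z * F.F₂ z - F.F₃ z * F.F₅ z) := by
  have h1 : deriv F.F₁ z = (F.F₁ z ^ 2 - F.F₁ z * F.F₆ z - F.F₁ z - F.F₃ z * F.F₄ z) / z := by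
    rw [eq_div_iff hz]; linear_combination h.eq₁
  have h2 : deriv F.F₂ z = (-(F.F₁ z * F.F₂ z) - F.F₂ z + F.F₃ z * F.F₅ z) / z := by
    rw [eq_div_iff hz]; linear_combination h.eq₂
  refine ⟨h1, h2, h.eq₃, ?_, ?_, ?_⟩
  · rw [eq_div_iff (pow_ne_zero 2 hz)]; linear_combination h.eq₁ + z * h.eq₄
  · rw [← h2, eq_div_iff hz]; linear_combination h.eq₅
  · linear_combination h.eq₆ - h.eq₂

/-- Since z ≠ 0, the system can be solved for all six derivatives; after this substitution each
curvature component is a rational identity in u and the values of the profile. -/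
theorem modelΓ₁_flat {F : Profile 𝕜} {u : Fin 3 → 𝕜} (h1 : u 1 ≠ 0) (h02 : u 0 ≠ u 2)
    (hF : F.DiffAt (zCoord u)) (hs : F.SystemAt (zCoord u)) (k l i j : Fin 3) :
    curvature (modelΓ₁ F) u k l i j = 0 := by
  have hz := zCoord_ne_zero h1 h02
  obtain ⟨d1, d2, d3, d4, d5, d6⟩ := hs.solved hz
  refine curvature_eq_zero_of_lt ?_ ?_ ?_ k l i j <;> intro k l <;>
    rw [modelΓ₁_curvature h1 hF] <;> fin_cases k <;> fin_cases l <;>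
    simp only [modelΓ₁Grad, modelΓ₁, profileGrad, Fin.sum_univ_three, d1, d2, d3, d4, d5, d6,
      Matrix.cons_val_zero, Matrix.cons_val_one, Matrix.cons_val, Fin.zero_eta, Fin.mk_one,
      Fin.reduceFinMk] <;>
    simp <;> field_simp <;> ring

set_option maxHeartbeats 4000000 in
theorem modelΓ₂_flat {F : Profile 𝕜} {u : Fin 3 → 𝕜} (h0 : u 0 ≠ 0) (h1 : u 1 ≠ 0)
    (h2 : u 2 ≠ 0) (h02 : u 0 ≠ u 2)
    (hF : F.DiffAt (zCoord u)) (hs : F.SystemAt (zCoord u)) (k l i j : Fin 3) :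
    curvature (modelΓ₂ F) u k l i j = 0 := by
  have hz := zCoord_ne_zero h1 h02
  obtain ⟨d1, d2, d3, d4, d5, d6⟩ := hs.solved hz
  -- The coefficients of ∇⁽²⁾ contain u³ besides z, so the identities are checked modulo u³ = u¹ + z
  -- u².
  have hw := eq_add_zCoord_mul h1
  refine curvature_eq_zero_of_lt ?_ ?_ ?_ k l i j <;> intro k l <;>
    rw [curvature_eq_of_hasGrad (hasGrad_modelΓ₂ h0 h1 h2 hF)] <;> fin_cases k <;> fin_cases l <;>
    simp only [modelΓ₂Grad, modelΓ₂, profileGrad, Fin.sum_univ_three, d1, d2, d3, d4, d5, d6,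
      Matrix.cons_val_zero, Matrix.cons_val_one, Matrix.cons_val, Fin.zero_eta, Fin.mk_one,
      Fin.reduceFinMk, Pi.single_eq_same] <;>
    simp <;> field_simp <;> (try rw [hw]) <;> ring

end SecondConnection

/-! ### The product of the model and its dual product -/

section ModelStructure

variable {𝕜 : Type*} [RCLike 𝕜]

/-- The components of the product `∘` in canonical coordinates. -/
def stdProduct (𝕜 : Type*) [RCLike 𝕜] : Fin 3 → Fin 3 → Fin 3 → 𝕜 :=
  ![![![1, 0, 0], ![0, 0, 0], ![0, 0, 0]],
    ![![0, 1, 0], ![1, 0, 0], ![0, 0, 0]],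
    ![![0, 0, 0], ![0, 0, 0], ![0, 0, 1]]]

theorem model_c (F : Profile 𝕜) (u : Fin 3 → 𝕜) : (model F).c u = stdProduct 𝕜 := rfl

/-- The components of the product with `X` in canonical coordinates. -/
def stdMul (X : Fin 3 → 𝕜) : Fin 3 → Fin 3 → 𝕜 :=
  ![![X 0, 0, 0], ![X 1, X 0, 0], ![0, 0, X 2]]

/-- The components of the product `∘` followed by the product with `v`. -/
def stdDual (v : Fin 3 → 𝕜) : Fin 3 → Fin 3 → Fin 3 → 𝕜 :=
  ![![![v 0, 0, 0], ![0, 0, 0], ![0, 0, 0]],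
    ![![v 1, v 0, 0], ![v 0, 0, 0], ![0, 0, 0]],
    ![![0, 0, 0], ![0, 0, 0], ![0, 0, v 2]]]

theorem mulBy_stdProduct {c : Comp 𝕜 3} {u : Fin 3 → 𝕜} (hc : c u = stdProduct 𝕜)
    (X : (Fin 3 → 𝕜) → Fin 3 → 𝕜) : mulBy c X u = stdMul (X u) := by
  funext k j
  simp only [mulBy, hc]
  fin_cases k <;> fin_cases j <;> simp [stdProduct, stdMul, Fin.sum_univ_three]

theorem dualProduct_stdProduct {c : Comp 𝕜 3} {u : Fin 3 → 𝕜} (hc : c u = stdProduct 𝕜)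
    (I : (Fin 3 → 𝕜) → Fin 3 → 𝕜) : dualProduct c I u = stdDual (I u) := by
  funext i j k
  simp only [dualProduct, hc]
  fin_cases i <;> fin_cases j <;> fin_cases k <;>
    simp [stdProduct, stdDual, Fin.sum_univ_three]

theorem mulBy_stdDual {c : Comp 𝕜 3} {u v : Fin 3 → 𝕜} (hc : c u = stdDual v)
    (X : (Fin 3 → 𝕜) → Fin 3 → 𝕜) :
    mulBy c X u = stdMul ![v 0 * X u 0, v 1 * X u 0 + v 0 * X u 1, v 2 * X u 2] := by
  funext k j
  simp only [mulBy, hc]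
  fin_cases k <;> fin_cases j <;> simp [stdDual, stdMul, Fin.sum_univ_three]

/-- The partial derivatives of the components of `E⁻¹`. -/
def modelEinvGrad (u : Fin 3 → 𝕜) : Fin 3 → Fin 3 → 𝕜 :=
  ![![-1 / u 0 ^ 2, 0, 0], ![2 * u 1 / u 0 ^ 3, -1 / u 0 ^ 2, 0], ![0, 0, -1 / u 2 ^ 2]]

theorem hasGrad_modelEinv (F : Profile 𝕜) {u : Fin 3 → 𝕜} (h0 : u 0 ≠ 0) (h2 : u 2 ≠ 0)
    (i : Fin 3) : HasGrad (fun v => (model F).Einv v i) (modelEinvGrad u i) u := by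
  have x := HasGrad.coord 0 u
  have y := HasGrad.coord 1 u
  have w := HasGrad.coord 2 u
  have one : HasGrad (fun _ => (1 : 𝕜)) (fun _ => 0) u := HasGrad.const 1 u
  fin_cases i
  · refine (one.div x h0).congr_grad fun s => ?_
    fin_cases s <;> simp [modelEinvGrad]
  · refine (y.neg.div x.pow_two (pow_ne_zero 2 h0)).congr_grad fun s => ?_
    fin_cases s <;> simp [modelEinvGrad] <;> field_simp
  · refine (one.div w h2).congr_grad fun s => ?_
    fin_cases s <;> simp [modelEinvGrad]

/-- The partial derivatives of the components of the dual product. -/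
def modelStarGrad (u : Fin 3 → 𝕜) : Fin 3 → Fin 3 → Fin 3 → Fin 3 → 𝕜 :=
  let g := modelEinvGrad u
  ![![![g 0, 0, 0], ![0, 0, 0], ![0, 0, 0]],
    ![![g 1, g 0, 0], ![g 0, 0, 0], ![0, 0, 0]],
    ![![0, 0, 0], ![0, 0, 0], ![0, 0, g 2]]]

theorem model_cStar (F : Profile 𝕜) (u : Fin 3 → 𝕜) :
    (model F).cStar u = stdDual ((model F).Einv u) :=
  dualProduct_stdProduct (model_c F u) _

theorem hasGrad_model_cStar (F : Profile 𝕜) {u : Fin 3 → 𝕜} (h0 : u 0 ≠ 0) (h2 : u 2 ≠ 0)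
    (i j k : Fin 3) :
    HasGrad (fun v => (model F).cStar v i j k) (modelStarGrad u i j k) u := by
  have o : HasGrad (fun _ => (0 : 𝕜)) 0 u := HasGrad.const 0 u
  have e := hasGrad_modelEinv F h0 h2
  simp only [model_cStar]
  fin_cases i <;> fin_cases j <;> fin_cases k
  exacts [e 0, o, o, o, o, o, o, o, o, e 1, e 0, o, e 0, o, o, o, o, o, o, o, o, o, o, o, o, o, e 2]

theorem pd_const {n : ℕ} (s : Fin n) (a : 𝕜) (u : Fin n → 𝕜) : pd s (fun _ => a) u = 0 :=
  (HasGrad.const a u).2 s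

theorem isFManifoldOn_model (F : Profile 𝕜) (Ω : Set (Fin 3 → 𝕜)) :
    IsFManifoldOn (model F).c (model F).e Ω where
  smooth_c i j k := contDiffOn_const
  smooth_e := contDiffOn_const
  comm u _ i j k := by
    rw [model_c]
    fin_cases i <;> fin_cases j <;> fin_cases k <;> simp [stdProduct]
  assoc u _ i j k m := by
    simp only [model_c]
    fin_cases i <;> fin_cases j <;> fin_cases k <;> fin_cases m <;>
      simp only [stdProduct, Fin.sum_univ_three, Matrix.cons_val_zero, Matrix.cons_val_one, Matrix.cons_val,
      Fin.zero_eta, Fin.mk_one, Fin.reduceFinMk] <;>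
      ring
  unit u _ i j := by
    simp only [model_c]
    fin_cases i <;> fin_cases j <;> simp [model, stdProduct, Fin.sum_univ_three]
  hertlingManin u _ a b p q k := by
    simp [model_c, pd_const]

theorem contDiffOn_modelEinv (F : Profile 𝕜) {Ω : Set (Fin 3 → 𝕜)}
    (h : ∀ u ∈ Ω, u 0 ≠ 0 ∧ u 2 ≠ 0) (i : Fin 3) :
    ContDiffOn 𝕜 ∞ (fun u => (model F).Einv u i) Ω := by
  have c : ∀ i : Fin 3, ContDiffOn 𝕜 ∞ (fun u : Fin 3 → 𝕜 => u i) Ω := fun i =>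
    (contDiff_apply 𝕜 𝕜 i).contDiffOn
  fin_cases i
  · exact contDiffOn_const.div (c 0) fun u hu => (h u hu).1
  · exact (c 1).neg.div ((c 0).pow 2) fun u hu => pow_ne_zero 2 (h u hu).1
  · exact contDiffOn_const.div (c 2) fun u hu => (h u hu).2

-- Conceptually, the dual product has constant components in the local coordinates log u¹, u²/u¹,
-- log u³, whose coordinate fields are u¹∂₁ + u²∂₂, u¹∂₂, u³∂₃. The proof instead checks the
-- condition index by index in the coordinates u.
set_option maxHeartbeats 4000000 in
theorem hertlingManin_model_cStar (F : Profile 𝕜) {u : Fin 3 → 𝕜} (h0 : u 0 ≠ 0) (h2 : u 2 ≠ 0)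
    (a b p q k : Fin 3) :
    ∑ s, ((model F).cStar u s a b * pd s (fun v => (model F).cStar v k p q) u
        - (model F).cStar u s p q * pd s (fun v => (model F).cStar v k a b) u
        + (model F).cStar u k s q * pd p (fun v => (model F).cStar v s a b) u
        + (model F).cStar u k p s * pd q (fun v => (model F).cStar v s a b) u)
      = ∑ s, ((model F).cStar u k a s * pd b (fun v => (model F).cStar v s p q) u
        + (model F).cStar u k b s * pd a (fun v => (model F).cStar v s p q) u) := by
  simp only [(hasGrad_model_cStar F h0 h2 _ _ _).2]
  simp only [model_cStar, Fin.sum_univ_three]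
  fin_cases k <;> fin_cases a <;> fin_cases b <;> fin_cases p <;> fin_cases q <;>
    simp only [stdDual, modelStarGrad, modelEinvGrad, model, Matrix.cons_val_zero, Matrix.cons_val_one, Matrix.cons_val,
      Fin.zero_eta, Fin.mk_one, Fin.reduceFinMk] <;>
    simp

theorem isFManifoldOn_model_cStar (F : Profile 𝕜) {Ω : Set (Fin 3 → 𝕜)}
    (h : ∀ u ∈ Ω, u 0 ≠ 0 ∧ u 2 ≠ 0) :
    IsFManifoldOn (model F).cStar (model F).E Ω where
  smooth_c i j k := by
    have o : ContDiffOn 𝕜 ∞ (fun _ : Fin 3 → 𝕜 => (0 : 𝕜)) Ω := contDiffOn_const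
    have e := contDiffOn_modelEinv F h
    simp only [model_cStar]
    fin_cases i <;> fin_cases j <;> fin_cases k
    exacts [e 0, o, o, o, o, o, o, o, o, e 1, e 0, o, e 0, o, o, o, o, o, o, o, o, o, o, o, o, o,
      e 2]
  smooth_e := contDiff_id.contDiffOn
  comm u _ i j k := by
    rw [model_cStar]
    fin_cases i <;> fin_cases j <;> fin_cases k <;> simp [stdDual]
  assoc u _ i j k m := by
    simp only [model_cStar]
    fin_cases i <;> fin_cases j <;> fin_cases k <;> fin_cases m <;>
      simp only [stdDual, Fin.sum_univ_three, Matrix.cons_val_zero, Matrix.cons_val_one, Matrix.cons_val,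
      Fin.zero_eta, Fin.mk_one, Fin.reduceFinMk] <;>
      ring
  unit u hu i j := by
    obtain ⟨h0, h2⟩ := h u hu
    simp only [model_cStar]
    fin_cases i <;> fin_cases j <;> simp [model, stdDual, Fin.sum_univ_three, h0, h2]
    field_simp
    ring
  hertlingManin u hu a b p q k := by
    exact hertlingManin_model_cStar F (h u hu).1 (h u hu).2 a b p q k

end ModelStructure

/-! ### Bi-flat models are the smooth solutions of the system -/

section ModelBiFlat

variable {𝕜 : Type*} [RCLike 𝕜]

theorem contDiffOn_zCoord {Ω : Set (Fin 3 → 𝕜)} (h : ∀ u ∈ Ω, u 1 ≠ 0) :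
    ContDiffOn 𝕜 ∞ (zCoord (𝕜 := 𝕜)) Ω :=
  ((contDiff_apply 𝕜 𝕜 2).sub (contDiff_apply 𝕜 𝕜 0)).contDiffOn.div
    (contDiff_apply 𝕜 𝕜 1).contDiffOn h

theorem contDiffOn_profile {f : 𝕜 → 𝕜} {S : Set 𝕜} (hf : ContDiffOn 𝕜 ∞ f S) :
    ContDiffOn 𝕜 ∞ (fun u : Fin 3 → 𝕜 => f (zCoord u) / u 1) (domainOver S) :=
  (hf.comp (contDiffOn_zCoord fun _ hu => hu.2.1) fun _ hu => hu.2.2.2.2).div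
    (contDiff_apply 𝕜 𝕜 1).contDiffOn fun _ hu => hu.2.1

theorem smoothComp_modelΓ₁ {F : Profile 𝕜} {S : Set 𝕜} (hF : F.SmoothOn S) :
    SmoothComp (modelΓ₁ F) (domainOver S) := by
  have f₁ := contDiffOn_profile hF.F₁
  have f₂ := contDiffOn_profile hF.F₂
  have f₃ := contDiffOn_profile hF.F₃
  have f₄ := contDiffOn_profile hF.F₄
  have f₅ := contDiffOn_profile hF.F₅
  have f₆ := contDiffOn_profile hF.F₆
  have o : ContDiffOn 𝕜 ∞ (fun _ : Fin 3 → 𝕜 => (0 : 𝕜)) (domainOver S) := contDiffOn_const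
  intro i j k
  fin_cases i <;> fin_cases j <;> fin_cases k
  exacts [f₂.neg, o, f₂, o, f₃, o, f₂, o, f₂.neg, f₅.neg, f₂.neg, f₅, f₂.neg, f₆, f₂, f₅, f₂,
    f₅.neg, f₄.neg, f₁.neg, f₄, f₁.neg, o, f₁, f₄, f₁, f₄.neg]

theorem smoothComp_modelΓ₂ {F : Profile 𝕜} {S : Set 𝕜} (hF : F.SmoothOn S) :
    SmoothComp (modelΓ₂ F) (domainOver S) := by
  have f₁ := contDiffOn_profile hF.F₁
  have f₂ := contDiffOn_profile hF.F₂
  have f₃ := contDiffOn_profile hF.F₃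
  have f₄ := contDiffOn_profile hF.F₄
  have f₅ := contDiffOn_profile hF.F₅
  have f₆ := contDiffOn_profile hF.F₆
  have o : ContDiffOn 𝕜 ∞ (fun _ : Fin 3 → 𝕜 => (0 : 𝕜)) (domainOver S) := contDiffOn_const
  have one : ContDiffOn 𝕜 ∞ (fun _ : Fin 3 → 𝕜 => (1 : 𝕜)) (domainOver S) := contDiffOn_const
  have c : ∀ i : Fin 3, ContDiffOn 𝕜 ∞ (fun u : Fin 3 → 𝕜 => u i) (domainOver S) := fun i =>
    (contDiff_apply 𝕜 𝕜 i).contDiffOn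
  have hx : ∀ u ∈ domainOver S, u 0 ≠ 0 := fun u hu => hu.1
  have hx2 : ∀ u ∈ domainOver S, u 0 ^ 2 ≠ 0 := fun u hu => pow_ne_zero 2 hu.1
  have hw : ∀ u ∈ domainOver S, u 2 ≠ 0 := fun u hu => hu.2.2.1
  have x := c 0
  have y := c 1
  have w := c 2
  have c11 := (((f₃.mul (y.pow 2)).sub ((f₂.mul w).mul x)).sub x).div (x.pow 2) hx2
  have c12 := (f₃.mul y).neg.div x hx
  have c33 := (f₂.mul x).neg.div w hw
  have d11 := (((((f₂.mul w).mul y).sub ((f₅.mul w).mul x)).add (f₆.mul (y.pow 2))).add y).div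
    (x.pow 2) hx2
  have d12 := (((f₂.mul w).add (f₆.mul y)).add one).neg.div x hx
  have d33 := ((f₅.mul x).add (f₂.mul y)).neg.div w hw
  have e11 := (((f₁.mul y).mul w).sub ((f₄.mul x).mul w)).div (x.pow 2) hx2
  have e12 := (f₁.mul w).neg.div x hx
  have e33 := (((f₁.mul y).add (f₄.mul x)).add one).neg.div w hw
  intro i j k
  fin_cases i <;> fin_cases j <;> fin_cases k
  exacts [c11, c12, f₂, c12, f₃, o, f₂, o, c33, d11, d12, f₅, d12, f₆, f₂, f₅, f₂, d33,
    e11, e12, f₄, e12, o, f₁, f₄, f₁, e33]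

theorem isFlatCompatibleOn_modelΓ₁ {F : Profile 𝕜} {S : Set 𝕜} (hS : IsOpen S)
    (hF : F.SmoothOn S) (hs : ∀ z ∈ S, F.SystemAt z) :
    IsFlatCompatibleOn (modelΓ₁ F) (model F).c (model F).e (domainOver S) where
  smooth_Γ := smoothComp_modelΓ₁ hF
  torsionless u _ i j k := by
    fin_cases i <;> fin_cases j <;> fin_cases k <;> simp [modelΓ₁]
  flat u hu k l i j :=
    modelΓ₁_flat hu.2.1 hu.2.2.2.1 (hF.diffAt hS hu.2.2.2.2) (hs _ hu.2.2.2.2) k l i j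
  compatible u _ i k l j := by
    simp only [covDerivProduct, model_c, pd_const, Fin.sum_univ_three]
    fin_cases i <;> fin_cases l <;> fin_cases k <;> fin_cases j <;>
      simp only [modelΓ₁, stdProduct, Matrix.cons_val_zero, Matrix.cons_val_one, Matrix.cons_val,
      Fin.zero_eta, Fin.mk_one, Fin.reduceFinMk] <;>
      ring
  parallel u _ i k := by
    have : ∀ k, pd i (fun v => (model F).e v k) u = 0 := fun k => pd_const i _ u
    rw [this, Fin.sum_univ_three]
    fin_cases i <;> fin_cases k <;> simp [model, modelΓ₁]

theorem pd_coord {n : ℕ} (s i : Fin n) (u : Fin n → 𝕜) :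
    pd s (fun v => v i) u = Pi.single (M := fun _ => 𝕜) i 1 s := (HasGrad.coord i u).2 s

set_option maxHeartbeats 1000000 in
theorem covDerivProduct_modelΓ₂_symm {F : Profile 𝕜} {u : Fin 3 → 𝕜} (h0 : u 0 ≠ 0)
    (h1 : u 1 ≠ 0) (h2 : u 2 ≠ 0) (i k l j : Fin 3) :
    covDerivProduct (modelΓ₂ F) (model F).cStar u i k l j
      = covDerivProduct (modelΓ₂ F) (model F).cStar u l k i j := by
  simp only [covDerivProduct, (hasGrad_model_cStar F h0 h2 _ _ _).2]
  simp only [model_cStar, Fin.sum_univ_three]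
  have key : ∀ i l, i < l → ∀ k j, modelStarGrad u k l j i
      + (modelΓ₂ F u k i 0 * stdDual ((model F).Einv u) 0 l j
          - modelΓ₂ F u 0 i l * stdDual ((model F).Einv u) k 0 j
          - modelΓ₂ F u 0 i j * stdDual ((model F).Einv u) k l 0
        + (modelΓ₂ F u k i 1 * stdDual ((model F).Einv u) 1 l j
          - modelΓ₂ F u 1 i l * stdDual ((model F).Einv u) k 1 j
          - modelΓ₂ F u 1 i j * stdDual ((model F).Einv u) k l 1)
        + (modelΓ₂ F u k i 2 * stdDual ((model F).Einv u) 2 l j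
          - modelΓ₂ F u 2 i l * stdDual ((model F).Einv u) k 2 j
          - modelΓ₂ F u 2 i j * stdDual ((model F).Einv u) k l 2))
      = modelStarGrad u k i j l
      + (modelΓ₂ F u k l 0 * stdDual ((model F).Einv u) 0 i j
          - modelΓ₂ F u 0 l i * stdDual ((model F).Einv u) k 0 j
          - modelΓ₂ F u 0 l j * stdDual ((model F).Einv u) k i 0
        + (modelΓ₂ F u k l 1 * stdDual ((model F).Einv u) 1 i j
          - modelΓ₂ F u 1 l i * stdDual ((model F).Einv u) k 1 j
          - modelΓ₂ F u 1 l j * stdDual ((model F).Einv u) k i 1)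
        + (modelΓ₂ F u k l 2 * stdDual ((model F).Einv u) 2 i j
          - modelΓ₂ F u 2 l i * stdDual ((model F).Einv u) k 2 j
          - modelΓ₂ F u 2 l j * stdDual ((model F).Einv u) k i 2)) := by
    intro i l hil k j
    fin_cases i <;> fin_cases l <;> simp at hil <;> fin_cases k <;> fin_cases j <;>
      simp only [stdDual, modelΓ₂, modelStarGrad, modelEinvGrad, model, Matrix.cons_val_zero, Matrix.cons_val_one, Matrix.cons_val,
      Fin.zero_eta, Fin.mk_one, Fin.reduceFinMk, Pi.zero_apply] <;>
      field_simp <;> ring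
  rcases lt_trichotomy i l with h | rfl | h
  · exact key i l h k j
  · rfl
  · exact (key l i h k j).symm

theorem isFlatCompatibleOn_modelΓ₂ {F : Profile 𝕜} {S : Set 𝕜} (hS : IsOpen S)
    (hF : F.SmoothOn S) (hs : ∀ z ∈ S, F.SystemAt z) :
    IsFlatCompatibleOn (modelΓ₂ F) (model F).cStar (model F).E (domainOver S) where
  smooth_Γ := smoothComp_modelΓ₂ hF
  torsionless u _ i j k := by
    fin_cases i <;> fin_cases j <;> fin_cases k <;> simp [modelΓ₂]
  flat u hu k l i j :=
    modelΓ₂_flat hu.1 hu.2.1 hu.2.2.1 hu.2.2.2.1 (hF.diffAt hS hu.2.2.2.2) (hs _ hu.2.2.2.2)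
      k l i j
  compatible u hu i k l j := covDerivProduct_modelΓ₂_symm hu.1 hu.2.1 hu.2.2.1 i k l j
  parallel u hu i k := by
    obtain ⟨h0, h1, h2, -⟩ := hu
    have : ∀ k, pd i (fun v => (model F).E v k) u = Pi.single (M := fun _ => 𝕜) k 1 i :=
      fun k => pd_coord i k u
    rw [this, Fin.sum_univ_three]
    fin_cases i <;> fin_cases k <;> simp [model, modelΓ₂] <;> field_simp <;> ring

/-- If `X ∘` has the components `W`, the condition on the difference of two connections is
algebraic. -/
theorem dNabla_eq_iff {n : ℕ} (Γ Γ' : Comp 𝕜 n) (W : (Fin n → 𝕜) → Fin n → Fin n → 𝕜)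
    (u : Fin n → 𝕜) (k i j : Fin n) :
    dNabla Γ W u k i j = dNabla Γ' W u k i j ↔
      ∑ s, (Γ u k i s - Γ' u k i s) * W u s j = ∑ s, (Γ u k j s - Γ' u k j s) * W u s i := by
  simp only [dNabla, sub_mul, Finset.sum_sub_distrib]
  constructor <;> intro h <;> linear_combination h

/-- Multiplication by a vector has the shape `stdMul` for ∘ and for * alike, so this one algebraic
identity serves both conditions on d_∇. It holds for every profile. -/
theorem sum_modelΓ_sub_mul_stdMul {F : Profile 𝕜} {u : Fin 3 → 𝕜} (Y : Fin 3 → 𝕜)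
    (k i j : Fin 3) :
    ∑ s, (modelΓ₁ F u k i s - modelΓ₂ F u k i s) * stdMul Y s j
      = ∑ s, (modelΓ₁ F u k j s - modelΓ₂ F u k j s) * stdMul Y s i := by
  simp only [Fin.sum_univ_three]
  fin_cases k <;> fin_cases i <;> fin_cases j <;> simp [modelΓ₁, modelΓ₂, stdMul]

/-- The model is bi-flat wherever the profile satisfies the system. -/
theorem isBiFlatOn_model {F : Profile 𝕜} {S : Set 𝕜} (hS : IsOpen S) (hF : F.SmoothOn S)
    (hs : ∀ z ∈ S, F.SystemAt z) : IsBiFlatOn (model F) (domainOver S) where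
  fManifold := isFManifoldOn_model F _
  smooth_E := contDiff_id.contDiffOn
  smooth_Einv := contDiffOn_pi.2 (contDiffOn_modelEinv F fun _ hu => ⟨hu.1, hu.2.2.1⟩)
  inverse u hu i := by
    obtain ⟨h0, h1, h2, -⟩ := hu
    simp only [model_c, Fin.sum_univ_three]
    fin_cases i <;> simp [model, stdProduct, h0, h2]
    field_simp
    ring
  eventual := isFManifoldOn_model_cStar F fun _ hu => ⟨hu.1, hu.2.2.1⟩
  euler u _ := by
    have h1 : (model F).e = fun _ => ![1, 0, 1] := rfl
    have h2 : (model F).E = id := rfl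
    simp [VectorField.lieBracket, h1, h2]
  flat₁ := isFlatCompatibleOn_modelΓ₁ hS hF hs
  flat₂ := isFlatCompatibleOn_modelΓ₂ hS hF hs
  hydro X _ u _ k i j := by
    rw [dNabla_eq_iff, mulBy_stdProduct (model_c F u)]
    exact sum_modelΓ_sub_mul_stdMul _ k i j
  hydroStar X _ u _ k i j := by
    rw [dNabla_eq_iff, mulBy_stdDual (model_cStar F u)]
    exact sum_modelΓ_sub_mul_stdMul _ k i j

theorem section_mem_domainOver {S : Set 𝕜} {t z : 𝕜} (ht : t ≠ 0) (htz : t + z ≠ 0)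
    (h0 : z ≠ 0) (hz : z ∈ S) : ![t, 1, t + z] ∈ domainOver S :=
  ⟨ht, one_ne_zero, htz, by simpa [eq_comm] using h0, by simpa [zCoord] using hz⟩

theorem zCoord_section (t z : 𝕜) : zCoord ![t, 1, t + z] = z := by simp [zCoord]

theorem exists_section_param (z : 𝕜) : ∃ t : 𝕜, t ≠ 0 ∧ t + z ≠ 0 := by
  by_cases h : (1 : 𝕜) + z = 0
  · refine ⟨2, two_ne_zero, ?_⟩
    have : (2 : 𝕜) + z = 1 := by linear_combination h
    rw [this]; exact one_ne_zero
  · exact ⟨1, one_ne_zero, h⟩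

/-- On the line u = (t, 1, t + z) the function f(z)/u² restricts to f itself. The parameter t
depends on the point considered, because u¹ and u³ must not vanish; 0 ∉ S provides u¹ ≠ u³. -/
theorem contDiffOn_of_contDiffOn_profile {f : 𝕜 → 𝕜} {S : Set 𝕜} (hS : IsOpen S)
    (h0 : (0 : 𝕜) ∉ S)
    (hf : ContDiffOn 𝕜 ∞ (fun u : Fin 3 → 𝕜 => f (zCoord u) / u 1) (domainOver S)) :
    ContDiffOn 𝕜 ∞ f S := by
  intro z hz
  obtain ⟨t, ht, htz⟩ := exists_section_param z
  have hO : IsOpen (S ∩ {x | t + x ≠ 0}) :=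
    hS.inter (isOpen_ne.preimage (continuous_const.add continuous_id))
  have hsec : ContDiff 𝕜 ∞ (fun x : 𝕜 => (![t, 1, t + x] : Fin 3 → 𝕜)) := by
    rw [contDiff_pi]
    intro i
    fin_cases i
    · exact contDiff_const
    · exact contDiff_const
    · exact contDiff_const.add contDiff_id
  have h := hf.comp (s := S ∩ {x | t + x ≠ 0}) hsec.contDiffOn fun x hx =>
    section_mem_domainOver ht hx.2 (fun h => h0 (h ▸ hx.1)) hx.1
  have h2 := h.contDiffAt (hO.mem_nhds ⟨hz, htz⟩)
  have e : ((fun u : Fin 3 → 𝕜 => f (zCoord u) / u 1) ∘ fun x : 𝕜 => ![t, 1, t + x]) = f := by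
    funext x
    simp [zCoord_section]
  rw [e] at h2
  exact h2.contDiffWithinAt

theorem smoothOn_of_smoothComp {F : Profile 𝕜} {S : Set 𝕜} (hS : IsOpen S) (h0 : (0 : 𝕜) ∉ S)
    (h : SmoothComp (modelΓ₁ F) (domainOver S)) : F.SmoothOn S where
  F₁ := contDiffOn_of_contDiffOn_profile hS h0 (h 2 1 2)
  F₂ := contDiffOn_of_contDiffOn_profile hS h0 (h 0 0 2)
  F₃ := contDiffOn_of_contDiffOn_profile hS h0 (h 0 1 1)
  F₄ := contDiffOn_of_contDiffOn_profile hS h0 (h 2 0 2)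
  F₅ := contDiffOn_of_contDiffOn_profile hS h0 (h 1 0 2)
  F₆ := contDiffOn_of_contDiffOn_profile hS h0 (h 1 1 1)

/-- A bi-flat model has a smooth profile, which satisfies the system. -/
theorem smoothOn_and_systemAt {F : Profile 𝕜} {S : Set 𝕜} (hS : IsOpen S) (h0 : (0 : 𝕜) ∉ S)
    (h : IsBiFlatOn (model F) (domainOver S)) : F.SmoothOn S ∧ ∀ z ∈ S, F.SystemAt z := by
  have hF := smoothOn_of_smoothComp hS h0 h.flat₁.smooth_Γ
  refine ⟨hF, fun z hz => ?_⟩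
  obtain ⟨t, ht, htz⟩ := exists_section_param z
  have hm := section_mem_domainOver ht htz (fun h => h0 (h ▸ hz)) hz
  have hd : F.DiffAt (zCoord ![t, 1, t + z]) := by
    rw [zCoord_section]; exact hF.diffAt hS hz
  have := systemAt_of_curvature_eq_zero hm.2.1 hd (h.flat₁.flat _ hm)
  rwa [zCoord_section] at this

end ModelBiFlat

/-! ### Painlevé V as a first-order system -/

section PainleveSystem

variable {𝕜 : Type*} [RCLike 𝕜]

/-- A first-order system for two functions, equivalent to the fifth Painlevé equation for `y`. -/
structure IsPainleveVSystem (I₁ I₂ I₃ a : 𝕜) (X : Set 𝕜) (y h : 𝕜 → 𝕜) : Prop where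
  isOpen : IsOpen X
  ne_zero : ∀ x ∈ X, x ≠ 0
  value_ne_zero : ∀ x ∈ X, y x ≠ 0
  value_ne_one : ∀ x ∈ X, y x ≠ 1
  hasDerivAt_y : ∀ x ∈ X,
    HasDerivAt y ((I₁ * x * y x - h x * y x * (y x - 1) + I₂ * (y x - 1) ^ 2) / x) x
  hasDerivAt_h : ∀ x ∈ X,
    HasDerivAt h ((-(I₁ * x * (I₃ - h x)) / (y x - 1)
      + ((h x - I₂) ^ 2 - 2 * a) * (y x - 1) / 2) / x) x

/-- Differentiate the equation for y once more and replace y' and h' by the right sides of the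
system: Painlevé V becomes an identity between rational functions of x, y and h. -/
theorem IsPainleveVSystem.isPainleveVSolution {I₁ I₂ I₃ a : 𝕜} {X : Set 𝕜} {y h : 𝕜 → 𝕜}
    (H : IsPainleveVSystem I₁ I₂ I₃ a X y h) :
    IsPainleveVSolution a (-I₂ ^ 2 / 2) (I₁ * I₃ + I₁) (-I₁ ^ 2 / 2) X y := by
  have key : ∀ x ∈ X, HasDerivAt (deriv y)
      (((I₁ * y x + I₁ * x * deriv y x - (deriv h x * y x * (y x - 1)
        + h x * deriv y x * (2 * y x - 1)) + 2 * I₂ * (y x - 1) * deriv y x) * x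
        - (I₁ * x * y x - h x * y x * (y x - 1) + I₂ * (y x - 1) ^ 2)) / x ^ 2) x := by
    intro x hx
    have e : deriv y =ᶠ[𝓝 x] fun x =>
        (I₁ * x * y x - h x * y x * (y x - 1) + I₂ * (y x - 1) ^ 2) / x := by
      filter_upwards [H.isOpen.mem_nhds hx] with x' hx' using (H.hasDerivAt_y x' hx').deriv
    have hy := (H.hasDerivAt_y x hx).differentiableAt.hasDerivAt
    have hh := (H.hasDerivAt_h x hx).differentiableAt.hasDerivAt
    have hx' := hasDerivAt_id x
    have := (((((hx'.const_mul I₁).mul hy).sub ((hh.mul hy).mul (hy.sub_const 1))).add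
      (((hy.sub_const 1).pow 2).const_mul I₂)).div hx' (H.ne_zero x hx))
    refine (this.congr_of_eventuallyEq e).congr_deriv ?_
    simp
    ring
  refine ⟨H.isOpen, H.ne_zero, H.value_ne_zero, H.value_ne_one,
    fun x hx => (H.hasDerivAt_y x hx).differentiableAt,
    fun x hx => (key x hx).differentiableAt, fun x hx => ?_⟩
  rw [(key x hx).deriv, (H.hasDerivAt_y x hx).deriv, (H.hasDerivAt_h x hx).deriv]
  have h0 := H.ne_zero x hx
  have h1 := H.value_ne_zero x hx
  have h2 := sub_ne_zero.2 (H.value_ne_one x hx)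
  field_simp
  ring

/-- The second unknown of the first-order system, expressed by a solution of the equation. -/
def painleveConjugate (I₁ I₂ : 𝕜) (y : 𝕜 → 𝕜) (x : 𝕜) : 𝕜 :=
  (I₁ * x * y x + I₂ * (y x - 1) ^ 2 - x * deriv y x) / (y x * (y x - 1))

/-- `painleveConjugate` is the first equation solved for h, which is possible because y avoids 0 and
1; the second equation is then Painlevé V solved for y''. The parameters b and d fix only the
squares of I₂ and I₁, and any choice of signs is admissible. -/
theorem IsPainleveVSolution.isPainleveVSystem {a b g d I₁ I₂ I₃ : 𝕜} {X : Set 𝕜} {y : 𝕜 → 𝕜}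
    (H : IsPainleveVSolution a b g d X y) (hd : -2 * d = I₁ ^ 2)
    (hb : -2 * b = I₂ ^ 2) (hg : g = I₁ * I₃ + I₁) :
    IsPainleveVSystem I₁ I₂ I₃ a X y (painleveConjugate I₁ I₂ y) := by
  refine ⟨H.isOpen, H.ne_zero, H.value_ne_zero, H.value_ne_one, fun x hx => ?_, fun x hx => ?_⟩
  · refine (H.differentiableAt x hx).hasDerivAt.congr_deriv ?_
    have h0 := H.ne_zero x hx
    have h1 := H.value_ne_zero x hx
    have h2 := sub_ne_zero.2 (H.value_ne_one x hx)
    rw [painleveConjugate]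
    field_simp
    ring
  · have h0 := H.ne_zero x hx
    have h1 := H.value_ne_zero x hx
    have h2 := sub_ne_zero.2 (H.value_ne_one x hx)
    have hy := (H.differentiableAt x hx).hasDerivAt
    have hy' := (H.differentiableAt_deriv x hx).hasDerivAt
    have hx' := hasDerivAt_id x
    have := ((((hx'.const_mul I₁).mul hy).add (((hy.sub_const 1).pow 2).const_mul I₂)).sub
      (hx'.mul hy')).div (hy.mul (hy.sub_const 1)) (mul_ne_zero h1 h2)
    refine this.congr_deriv ?_
    have hd' : d = -I₁ ^ 2 / 2 := by rw [← hd]; ring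
    have hb' : b = -I₂ ^ 2 / 2 := by rw [← hb]; ring
    simp [H.equation x hx, hd', hb', hg]
    rw [painleveConjugate]
    generalize deriv y x = p
    generalize y x = q at *
    field_simp
    ring

/-- Bootstrapping: the right sides are rational in x, y, h with nonvanishing denominators, so Cⁿ
solutions are Cⁿ⁺¹. Solutions of Painlevé V are only assumed twice differentiable, whereas profiles
must be smooth. -/
theorem IsPainleveVSystem.contDiffOn {I₁ I₂ I₃ a : 𝕜} {X : Set 𝕜} {y h : 𝕜 → 𝕜}
    (H : IsPainleveVSystem I₁ I₂ I₃ a X y h) : ContDiffOn 𝕜 ∞ y X ∧ ContDiffOn 𝕜 ∞ h X := by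
  have key : ∀ n : ℕ, ContDiffOn 𝕜 n y X ∧ ContDiffOn 𝕜 n h X := by
    intro n
    induction n with
    | zero =>
      exact ⟨contDiffOn_zero.2 fun x hx => (H.hasDerivAt_y x hx).continuousAt.continuousWithinAt,
        contDiffOn_zero.2 fun x hx => (H.hasDerivAt_h x hx).continuousAt.continuousWithinAt⟩
    | succ n ih =>
      obtain ⟨hy, hh⟩ := ih
      have hi : ContDiffOn 𝕜 n (fun x : 𝕜 => x) X := contDiffOn_id
      have hy1 : ContDiffOn 𝕜 n (fun x => y x - 1) X := hy.sub contDiffOn_const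
      push_cast
      rw [contDiffOn_succ_iff_deriv_of_isOpen H.isOpen, contDiffOn_succ_iff_deriv_of_isOpen H.isOpen]
      refine ⟨⟨fun x hx => (H.hasDerivAt_y x hx).differentiableAt.differentiableWithinAt, by simp,
        ?_⟩, ⟨fun x hx => (H.hasDerivAt_h x hx).differentiableAt.differentiableWithinAt, by simp,
        ?_⟩⟩
      · refine ContDiffOn.congr ?_ fun x hx => (H.hasDerivAt_y x hx).deriv
        exact ((((contDiffOn_const.mul hi).mul hy).sub ((hh.mul hy).mul hy1)).add
          (contDiffOn_const.mul (hy1.pow 2))).div hi H.ne_zero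
      · refine ContDiffOn.congr ?_ fun x hx => (H.hasDerivAt_h x hx).deriv
        exact ((((contDiffOn_const.mul hi).mul (contDiffOn_const.sub hh)).neg.div hy1
          fun x hx => sub_ne_zero.2 (H.value_ne_one x hx)).add
          (((((hh.sub contDiffOn_const).pow 2).sub contDiffOn_const).mul hy1).div_const 2)).div hi
          H.ne_zero
  exact ⟨contDiffOn_infty.2 fun n => (key n).1, contDiffOn_infty.2 fun n => (key n).2⟩

end PainleveSystem

/-! ### Uniqueness for linear differential equations -/

section LinearUniqueness

variable {𝕜 : Type*} [RCLike 𝕜] {V : Type*} [NormedAddCommGroup V] [NormedSpace 𝕜 V]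

/-- A function whose derivative is locally bounded by a multiple of the function vanishes on a
neighbourhood of each of its zeros. -/
theorem eventually_eq_zero_of_norm_deriv_le {Y Y' : 𝕜 → V} {z₀ : 𝕜} {C : ℝ} (h0 : Y z₀ = 0)
    (hd : ∀ᶠ z in 𝓝 z₀, HasDerivAt Y (Y' z) z) (hC : ∀ᶠ z in 𝓝 z₀, ‖Y' z‖ ≤ C * ‖Y z‖) :
    ∀ᶠ z in 𝓝 z₀, Y z = 0 := by
  obtain ⟨r, hr, hball⟩ := Metric.eventually_nhds_iff_ball.1 (hd.and hC)
  have hCpos : 0 < |C| + 1 := by positivity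
  -- The radius is so small that (|C| + 1)ρ ≤ 1/2: the mean value inequality at a point m where ‖Y‖
  -- is maximal gives ‖Y m‖ ≤ ‖Y m‖/2, hence Y = 0 on the ball.
  set ρ : ℝ := min (r / 2) (1 / (2 * (|C| + 1))) with hρ
  have hρ0 : 0 < ρ := by positivity
  have hρr : ρ < r := lt_of_le_of_lt (min_le_left _ _) (by linarith)
  have hsub : Metric.closedBall z₀ ρ ⊆ Metric.ball z₀ r := Metric.closedBall_subset_ball hρr
  have hcont : ContinuousOn (fun z => ‖Y z‖) (Metric.closedBall z₀ ρ) := fun z hz =>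
    (hball z (hsub hz)).1.continuousAt.norm.continuousWithinAt
  obtain ⟨m, hm, hmax⟩ := (isCompact_closedBall z₀ ρ).exists_isMaxOn
    ⟨z₀, Metric.mem_closedBall_self hρ0.le⟩ hcont
  have hbound : ‖Y m - Y z₀‖ ≤ ((|C| + 1) * ‖Y m‖) * ‖m - z₀‖ := by
    refine Convex.norm_image_sub_le_of_norm_hasDerivWithin_le (𝕜 := 𝕜) (f' := Y')
      (s := Metric.closedBall z₀ ρ)
      (fun z hz => (hball z (hsub hz)).1.hasDerivWithinAt) (fun z hz => ?_)
      (convex_closedBall z₀ ρ) (Metric.mem_closedBall_self hρ0.le) hm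
    calc ‖Y' z‖ ≤ C * ‖Y z‖ := (hball z (hsub hz)).2
      _ ≤ (|C| + 1) * ‖Y z‖ := by gcongr; linarith [le_abs_self C]
      _ ≤ (|C| + 1) * ‖Y m‖ := by gcongr; exact hmax hz
  rw [h0, sub_zero] at hbound
  have hmρ : ‖m - z₀‖ ≤ 1 / (2 * (|C| + 1)) :=
    (mem_closedBall_iff_norm.1 hm).trans (min_le_right _ _)
  have hhalf : ‖Y m‖ ≤ ‖Y m‖ / 2 := by
    calc ‖Y m‖ ≤ ((|C| + 1) * ‖Y m‖) * ‖m - z₀‖ := hbound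
      _ ≤ ((|C| + 1) * ‖Y m‖) * (1 / (2 * (|C| + 1))) := by gcongr
      _ = ‖Y m‖ / 2 := by field_simp
  have hm0 : ‖Y m‖ ≤ 0 := by linarith
  filter_upwards [Metric.closedBall_mem_nhds z₀ hρ0] with z hz
  exact norm_le_zero_iff.1 ((hmax hz).trans hm0)

/-- Uniqueness for linear systems on a connected open set. -/
theorem eq_zero_of_norm_deriv_le {Y Y' : 𝕜 → V} {C : 𝕜 → ℝ} {S : Set 𝕜} (hS : IsOpen S)
    (hc : IsPreconnected S) (hd : ∀ z ∈ S, HasDerivAt Y (Y' z) z) (hC : ContinuousOn C S)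
    (hY : ∀ z ∈ S, ‖Y' z‖ ≤ C z * ‖Y z‖) {z₀ : 𝕜} (hz₀ : z₀ ∈ S) (h0 : Y z₀ = 0) :
    ∀ z ∈ S, Y z = 0 := by
  have hopen : ∀ z ∈ S, Y z = 0 → ∀ᶠ w in 𝓝 z, Y w = 0 := by
    intro z hz h
    have hCz := (hC.continuousAt (hS.mem_nhds hz)).eventually (gt_mem_nhds (lt_add_one (C z)))
    refine eventually_eq_zero_of_norm_deriv_le (Y' := Y') (C := C z + 1) h ?_ ?_
    · filter_upwards [hS.mem_nhds hz] with w hw using hd w hw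
    · filter_upwards [hS.mem_nhds hz, hCz] with w hw hw'
      exact (hY w hw).trans (by gcongr)
  have hcontY : ContinuousOn Y S := fun z hz => (hd z hz).continuousAt.continuousWithinAt
  have h1 : IsOpen {z | z ∈ S ∧ Y z = 0} := by
    rw [isOpen_iff_mem_nhds]
    rintro z ⟨hz, h⟩
    filter_upwards [hS.mem_nhds hz, hopen z hz h] with w hw hw' using ⟨hw, hw'⟩
  have h2 : IsOpen (S ∩ Y ⁻¹' {0}ᶜ) := hcontY.isOpen_inter_preimage hS isOpen_compl_singleton
  intro z hz
  by_contra hne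
  -- Zeros and non-zeros both form open subsets of S, so connectedness forbids that both occur.
  obtain ⟨w, -, hw1, hw2⟩ := hc _ _ h1 h2
    (fun w hw => (em (Y w = 0)).imp (fun h => ⟨hw, h⟩) fun h => ⟨hw, h⟩)
    ⟨z₀, hz₀, hz₀, h0⟩ ⟨z, hz, hz, hne⟩
  exact hw2.2 hw1.2

end LinearUniqueness

/-! ### The four integrals and the passage from a profile to Painlevé V -/

section Integrals

variable {𝕜 : Type*} [RCLike 𝕜]

theorem exists_eq_const_of_hasDerivAt {S : Set 𝕜} (hS : IsOpen S) (hc : IsPreconnected S)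
    {f : 𝕜 → 𝕜} (h : ∀ z ∈ S, HasDerivAt f 0 z) : ∃ a, ∀ z ∈ S, f z = a :=
  hS.exists_is_const_of_deriv_eq_zero hc
    (fun z hz => (h z hz).differentiableAt.differentiableWithinAt) fun z hz => (h z hz).deriv

/-- The derivatives of F₁ - zF₄ and F₆ + 2zF₂ vanish by `eq₄` and by `eq₂` + `eq₆`. The fourth
expression is half of v² - 4qw with w = zF₁ - I₁, v = F₆ - I₂, q = zF₅ - F₂, a quadratic form
preserved by the linear system for (w, v, q); its definition needs the constants I₁ and I₂ found
before. -/
theorem exists_hasIntegrals {F : Profile 𝕜} {S : Set 𝕜} (hS : IsOpen S) (hc : IsPreconnected S)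
    (h0 : (0 : 𝕜) ∉ S) (hF : F.SmoothOn S) (hs : ∀ z ∈ S, F.SystemAt z) :
    ∃ I₁ I₂ I₃ a, F.HasIntegrals S I₁ I₂ I₃ a := by
  have hz0 : ∀ z ∈ S, z ≠ 0 := fun z hz h => h0 (h ▸ hz)
  obtain ⟨I₁, h₁⟩ := exists_eq_const_of_hasDerivAt hS hc (f := F.F₃) fun z hz => by
    rw [← (hs z hz).eq₃]; exact (hF.diffAt hS hz).F₃.hasDerivAt
  obtain ⟨I₂, h₂⟩ := exists_eq_const_of_hasDerivAt hS hc (f := fun z => F.F₁ z - z * F.F₄ z)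
    fun z hz => by
      have d := hF.diffAt hS hz
      refine (d.F₁.hasDerivAt.sub ((hasDerivAt_id z).mul d.F₄.hasDerivAt)).congr_deriv ?_
      simp only [id]
      linear_combination -(hs z hz).eq₄
  obtain ⟨I₃, h₃⟩ := exists_eq_const_of_hasDerivAt hS hc (f := fun z => F.F₆ z + 2 * z * F.F₂ z)
    fun z hz => by
      have d := hF.diffAt hS hz
      refine (d.F₆.hasDerivAt.add (((hasDerivAt_id z).const_mul 2).mul
        d.F₂.hasDerivAt)).congr_deriv ?_
      simp only [id]
      linear_combination (hs z hz).eq₆ + (hs z hz).eq₂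
  obtain ⟨a, h₄⟩ := exists_eq_const_of_hasDerivAt hS hc
    (f := fun z => ((F.F₆ z - I₂) ^ 2 + 4 * (z * F.F₅ z - F.F₂ z) * (I₁ - z * F.F₁ z)) / 2)
    fun z hz => by
      have d := hF.diffAt hS hz
      have hi := hasDerivAt_id z
      refine (((((d.F₆.hasDerivAt.sub_const I₂).pow 2).add
        ((((hi.mul d.F₅.hasDerivAt).sub d.F₂.hasDerivAt).const_mul 4).mul
          ((hi.mul d.F₁.hasDerivAt).const_sub I₁))).div_const 2)).congr_deriv ?_
      obtain ⟨e1, e2, -, -, e5, e6⟩ := (hs z hz).solved (hz0 z hz)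
      have h4 : F.F₄ z = (F.F₁ z - I₂) / z := by
        rw [eq_div_iff (hz0 z hz)]; linear_combination -h₂ z hz
      have hz := hz0 z hz
      simp [e1, e2, e5, e6, h4, h₁ z ‹_›]
      field_simp
      ring
  exact ⟨I₁, I₂, I₃, a, h₁, h₂, h₃, h₄⟩

theorem hasDerivAt_comp_inv {f : 𝕜 → 𝕜} {f' x : 𝕜} (hx : x ≠ 0) (hf : HasDerivAt f f' x⁻¹) :
    HasDerivAt (fun x => f x⁻¹) (-(f' / x ^ 2)) x := by
  refine (hf.comp x (hasDerivAt_inv hx)).congr_deriv ?_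
  field_simp

theorem isOpen_setOf_inv_mem {S : Set 𝕜} (hS : IsOpen S) (h0 : (0 : 𝕜) ∉ S) :
    IsOpen {x : 𝕜 | x⁻¹ ∈ S} := by
  rw [isOpen_iff_mem_nhds]
  intro x hx
  have hx0 : x ≠ 0 := by
    rintro rfl
    exact h0 (by simpa using hx)
  exact (continuousAt_inv₀ hx0).preimage_mem_nhds (hS.mem_nhds hx)

theorem isOpen_genericSet {F : Profile 𝕜} {S : Set 𝕜} (hS : IsOpen S) (hF : F.SmoothOn S)
    (I₁ : 𝕜) : IsOpen (F.genericSet I₁ S) := by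
  have hc := hF.F₁.continuousOn
  have h1 := hc.isOpen_inter_preimage hS (isOpen_compl_singleton (x := (0 : 𝕜)))
  have h2 := (continuousOn_id.mul hc).isOpen_inter_preimage hS (isOpen_compl_singleton (x := I₁))
  convert h1.inter h2 using 1
  ext z
  simp [Profile.genericSet]

/-- The profile of a flat model gives a solution of the first-order system. -/
theorem isPainleveVSystem_of_systemAt {F : Profile 𝕜} {S : Set 𝕜} {I₁ I₂ I₃ a : 𝕜}
    (hS : IsOpen S) (h0 : (0 : 𝕜) ∉ S) (hF : F.SmoothOn S) (hs : ∀ z ∈ S, F.SystemAt z)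
    (hI : F.HasIntegrals S I₁ I₂ I₃ a) (h₁ : I₁ ≠ 0) :
    IsPainleveVSystem I₁ I₂ I₃ a {x | x⁻¹ ∈ F.genericSet I₁ S} (F.painleveFunction I₁)
      (fun x => F.F₆ x⁻¹) := by
  have hx0 : ∀ x ∈ {x : 𝕜 | x⁻¹ ∈ F.genericSet I₁ S}, x ≠ 0 := by
    rintro x hx rfl
    exact h0 (by simpa using hx.1)
  refine ⟨isOpen_setOf_inv_mem (isOpen_genericSet hS hF I₁) fun h => h0 h.1, hx0, ?_, ?_, ?_, ?_⟩
  · rintro x hx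
    exact div_ne_zero (mul_ne_zero (inv_ne_zero (hx0 x hx)) hx.2.1) (sub_ne_zero.2 hx.2.2)
  · intro x hx h
    rw [Profile.painleveFunction, div_eq_one_iff_eq (sub_ne_zero.2 hx.2.2)] at h
    exact h₁ (by linear_combination h)
  · intro x hx
    have hx' := hx0 x hx
    have hw := sub_ne_zero.2 hx.2.2
    have d := hF.diffAt hS hx.1
    have hz := inv_ne_zero hx'
    have hi : HasDerivAt (fun x : 𝕜 => x⁻¹) (-(x ^ 2)⁻¹) x := hasDerivAt_inv hx'
    have hW := hi.mul (hasDerivAt_comp_inv hx' d.F₁.hasDerivAt)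
    refine (hW.div (hW.sub_const I₁) hw).congr_deriv ?_
    obtain ⟨e1, -⟩ := (hs _ hx.1).solved hz
    have h4 : F.F₄ x⁻¹ = (F.F₁ x⁻¹ - I₂) * x := by
      linear_combination -x * hI.second _ hx.1 - F.F₄ x⁻¹ * mul_inv_cancel₀ hx'
    simp only [Pi.mul_apply, e1, h4, hI.first _ hx.1, Profile.painleveFunction]
    clear hW h4 e1 d
    generalize F.F₁ x⁻¹ = p at *
    generalize F.F₆ x⁻¹ = r at *
    have hw2 : p - x * I₁ ≠ 0 := by
      intro h; apply hw; field_simp; simpa using h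
    simp
    field_simp
    ring
  · intro x hx
    have hx' := hx0 x hx
    have hw := sub_ne_zero.2 hx.2.2
    have d := hF.diffAt hS hx.1
    have hz := inv_ne_zero hx'
    refine (hasDerivAt_comp_inv hx' d.F₆.hasDerivAt).congr_deriv ?_
    obtain ⟨-, -, -, -, -, e6⟩ := (hs _ hx.1).solved hz
    have h2 : F.F₂ x⁻¹ = x * (I₃ - F.F₆ x⁻¹) / 2 := by
      rw [← hI.third _ hx.1]; field_simp; ring
    -- The third integral has given F₂; the fourth now gives F₅, with a division by zF₁ - I₁ that is
    -- allowed on the generic set.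
    have h5 : F.F₅ x⁻¹ = x * (((F.F₆ x⁻¹ - I₂) ^ 2 - 2 * a) / (4 * (x⁻¹ * F.F₁ x⁻¹ - I₁))
        + F.F₂ x⁻¹) := by
      have h := hI.fourth _ hx.1
      generalize F.F₆ x⁻¹ = r at *
      generalize F.F₅ x⁻¹ = s at *
      generalize F.F₂ x⁻¹ = t at *
      generalize F.F₁ x⁻¹ = p at *
      have e : (r - I₂) ^ 2 - 2 * a = 4 * (x⁻¹ * p - I₁) * (x⁻¹ * s - t) := by
        linear_combination 2 * h
      rw [e, mul_assoc, mul_div_mul_left _ _ (by norm_num), mul_div_cancel_left₀ _ hw]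
      field_simp
      ring
    simp only [e6, h5, h2, hI.first _ hx.1, Profile.painleveFunction]
    clear h5 h2 e6 d
    generalize F.F₁ x⁻¹ = p at *
    generalize F.F₆ x⁻¹ = r at *
    have hw2 : p - x * I₁ ≠ 0 := by
      intro h; apply hw; field_simp; simpa using h
    have hy : x⁻¹ * p / (x⁻¹ * p - I₁) - 1 = I₁ / (x⁻¹ * p - I₁) := by
      field_simp; ring
    rw [hy]
    field_simp
    ring

end Integrals

/-! ### The exceptional points are isolated or fill S -/

section Trichotomy

variable {𝕜 : Type*} [RCLike 𝕜]

theorem eventually_ne_of_hasDerivAt_of_ne {f : 𝕜 → 𝕜} {z₀ : 𝕜} (c : 𝕜)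
    (hf : DifferentiableAt 𝕜 f z₀) (h : f z₀ ≠ c ∨ deriv f z₀ ≠ 0) :
    ∀ᶠ z in 𝓝[≠] z₀, f z ≠ c := by
  rcases h with h | h
  · exact (hf.continuousAt.eventually_ne h).filter_mono nhdsWithin_le_nhds
  · exact hf.hasDerivAt.eventually_ne h

/-- A zero of F₁ with nonzero derivative is isolated. If F₁ and its derivative vanish at a common
point, then I₂ = 0, so F₄ = F₁/z, and the first equation becomes linear and homogeneous in F₁; by
uniqueness F₁ vanishes identically. -/
theorem F₁_eq_zero_or_eventually_ne {F : Profile 𝕜} {S : Set 𝕜} {I₁ I₂ I₃ a : 𝕜}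
    (hS : IsOpen S) (hc : IsPreconnected S) (h0 : (0 : 𝕜) ∉ S) (hF : F.SmoothOn S)
    (hs : ∀ z ∈ S, F.SystemAt z) (hI : F.HasIntegrals S I₁ I₂ I₃ a) (h₁ : I₁ ≠ 0) :
    (∀ z ∈ S, F.F₁ z = 0) ∨ ∀ z ∈ S, ∀ᶠ w in 𝓝[≠] z, F.F₁ w ≠ 0 := by
  have hz0 : ∀ z ∈ S, z ≠ 0 := fun z hz h => h0 (h ▸ hz)
  by_cases h : ∀ z ∈ S, F.F₁ z ≠ 0 ∨ deriv F.F₁ z ≠ 0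
  · exact Or.inr fun z hz => eventually_ne_of_hasDerivAt_of_ne 0 (hF.diffAt hS hz).F₁ (h z hz)
  left
  push Not at h
  obtain ⟨z₀, hz₀, hv, hd⟩ := h
  have hI₂ : I₂ = 0 := by
    have e1 := (hs z₀ hz₀).eq₁
    have e2 := hI.second z₀ hz₀
    rw [hd, hv, hI.first z₀ hz₀] at e1
    rw [hv] at e2
    have : I₁ * I₂ = 0 := by linear_combination -z₀ * e1 - I₁ * e2
    exact (mul_eq_zero.1 this).resolve_left h₁
  have hcoef : ContinuousOn (fun z => ‖(F.F₁ z - F.F₆ z - 1 - I₁ / z) / z‖) S :=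
    ((((hF.F₁.continuousOn.sub hF.F₆.continuousOn).sub continuousOn_const).sub
      (continuousOn_const.div continuousOn_id hz0)).div continuousOn_id hz0).norm
  refine eq_zero_of_norm_deriv_le hS hc (fun z hz => (hF.diffAt hS hz).F₁.hasDerivAt) hcoef
    (fun z hz => ?_) hz₀ hv
  rw [← norm_mul]
  refine le_of_eq (congrArg _ ?_)
  have hz' := hz0 z hz
  rw [((hs z hz).solved hz').1, hI.first z hz]
  have h4 : F.F₄ z = F.F₁ z / z := by
    rw [eq_div_iff hz']; linear_combination -hI.second z hz - hI₂
  rw [h4]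
  field_simp

/-- With w = zF₁ - I₁, v = F₆ - I₂, q = zF₅ - F₂ the equations read zw' = (F₁ - F₆)w - I₁v, zv' =
2F₂w - 2I₁q, zq' = (F₆ - F₁)q + F₂v. A common zero of w, v, q forces w to vanish identically. At a
zero of w with v ≠ 0 the derivative of w is nonzero. The remaining case w = v = 0 ≠ q, where w has a
multiple zero, is settled by the fourth integral. -/
theorem mul_F₁_eq_or_eventually_ne {F : Profile 𝕜} {S : Set 𝕜} {I₁ I₂ I₃ a : 𝕜}
    (hS : IsOpen S) (hc : IsPreconnected S) (h0 : (0 : 𝕜) ∉ S) (hF : F.SmoothOn S)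
    (hs : ∀ z ∈ S, F.SystemAt z) (hI : F.HasIntegrals S I₁ I₂ I₃ a) (h₁ : I₁ ≠ 0) :
    (∀ z ∈ S, z * F.F₁ z = I₁) ∨ ∀ z ∈ S, ∀ᶠ w in 𝓝[≠] z, w * F.F₁ w ≠ I₁ := by
  have hz0 : ∀ z ∈ S, z ≠ 0 := fun z hz h => h0 (h ▸ hz)
  have hi : ∀ z : 𝕜, HasDerivAt (fun z : 𝕜 => z) 1 z := fun z => hasDerivAt_id z
  have dw : ∀ z ∈ S, HasDerivAt (fun z => z * F.F₁ z - I₁)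
      (((F.F₁ z - F.F₆ z) * (z * F.F₁ z - I₁) - I₁ * (F.F₆ z - I₂)) / z) z := fun z hz => by
    have hz' := hz0 z hz
    refine (((hi z).mul (hF.diffAt hS hz).F₁.hasDerivAt).sub_const I₁).congr_deriv ?_
    rw [((hs z hz).solved hz').1, hI.first z hz]
    have h4 : F.F₄ z = (F.F₁ z - I₂) / z := by
      rw [eq_div_iff hz']; linear_combination -hI.second z hz
    rw [h4]
    field_simp
    ring
  have dv : ∀ z ∈ S, HasDerivAt (fun z => F.F₆ z - I₂)
      ((2 * F.F₂ z * (z * F.F₁ z - I₁) - 2 * I₁ * (z * F.F₅ z - F.F₂ z)) / z) z := fun z hz => by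
    have hz' := hz0 z hz
    refine ((hF.diffAt hS hz).F₆.hasDerivAt.sub_const I₂).congr_deriv ?_
    rw [((hs z hz).solved hz').2.2.2.2.2, hI.first z hz]
    field_simp
    ring
  have dq : ∀ z ∈ S, HasDerivAt (fun z => z * F.F₅ z - F.F₂ z)
      (((F.F₆ z - F.F₁ z) * (z * F.F₅ z - F.F₂ z) + F.F₂ z * (F.F₆ z - I₂)) / z) z :=
    fun z hz => by
    have hz' := hz0 z hz
    have d := hF.diffAt hS hz
    refine (((hi z).mul d.F₅.hasDerivAt).sub d.F₂.hasDerivAt).congr_deriv ?_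
    obtain ⟨-, e2, -, -, e5, -⟩ := (hs z hz).solved hz'
    rw [e2, e5, hI.first z hz]
    have h4 : F.F₄ z = (F.F₁ z - I₂) / z := by
      rw [eq_div_iff hz']; linear_combination -hI.second z hz
    rw [h4]
    field_simp
    ring
  by_cases h : ∃ z ∈ S, z * F.F₁ z - I₁ = 0 ∧ F.F₆ z - I₂ = 0 ∧ z * F.F₅ z - F.F₂ z = 0
  · left
    obtain ⟨z₀, hz₀, e1, e2, e3⟩ := h
    -- The sum of the norms of all coefficients bounds each of the three rows, which suffices for
    -- the uniqueness lemma.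
    have hcont : ContinuousOn (fun z => (‖F.F₁ z - F.F₆ z‖ + ‖I₁‖ + ‖2 * F.F₂ z‖ + ‖2 * I₁‖
        + ‖F.F₆ z - F.F₁ z‖ + ‖F.F₂ z‖) / ‖z‖) S := by
      have c1 := hF.F₁.continuousOn
      have c2 := hF.F₂.continuousOn
      have c6 := hF.F₆.continuousOn
      exact (((((((c1.sub c6).norm.add continuousOn_const).add
        (continuousOn_const.mul c2).norm).add continuousOn_const).add (c6.sub c1).norm).add
          c2.norm)).div continuousOn_id.norm fun z hz => norm_ne_zero_iff.2 (hz0 z hz)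
    have := eq_zero_of_norm_deriv_le hS hc
      (fun z hz => (dw z hz).prodMk ((dv z hz).prodMk (dq z hz))) hcont (fun z hz => ?_) hz₀
      (by simp only [e1, e2, e3]; rfl)
    · intro z hz
      have h2 := congrArg Prod.fst (this z hz)
      exact sub_eq_zero.1 h2
    · set w := z * F.F₁ z - I₁
      set v := F.F₆ z - I₂
      set q := z * F.F₅ z - F.F₂ z
      have n1 : ‖w‖ ≤ ‖(w, v, q)‖ := norm_fst_le (w, v, q)
      have n2 : ‖v‖ ≤ ‖(w, v, q)‖ := (norm_fst_le (v, q)).trans (norm_snd_le (w, v, q))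
      have n3 : ‖q‖ ≤ ‖(w, v, q)‖ := (norm_snd_le (v, q)).trans (norm_snd_le (w, v, q))
      set N := ‖(w, v, q)‖
      have hN : 0 ≤ N := norm_nonneg _
      have key : ∀ α β s t : 𝕜, ‖s‖ ≤ N → ‖t‖ ≤ N → ∀ K : ℝ, ‖α‖ + ‖β‖ ≤ K →
          ‖(α * s + β * t) / z‖ ≤ K / ‖z‖ * N := by
        intro α β s t hs ht K hK
        rw [norm_div, div_mul_eq_mul_div]
        gcongr
        calc ‖α * s + β * t‖ ≤ ‖α‖ * ‖s‖ + ‖β‖ * ‖t‖ := by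
              rw [← norm_mul, ← norm_mul]; exact norm_add_le _ _
          _ ≤ ‖α‖ * N + ‖β‖ * N := by gcongr
          _ = (‖α‖ + ‖β‖) * N := by ring
          _ ≤ K * N := by gcongr
      have p1 := norm_nonneg (F.F₁ z - F.F₆ z)
      have p2 := norm_nonneg I₁
      have p3 := norm_nonneg (2 * F.F₂ z)
      have p4 := norm_nonneg (2 * I₁)
      have p5 := norm_nonneg (F.F₆ z - F.F₁ z)
      have p6 := norm_nonneg (F.F₂ z)
      refine norm_prod_le_iff.2 ⟨?_, norm_prod_le_iff.2 ⟨?_, ?_⟩⟩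
      · have := key (F.F₁ z - F.F₆ z) (-I₁) w v n1 n2 _
          (le_trans (by rw [norm_neg]) (by linarith :
            ‖F.F₁ z - F.F₆ z‖ + ‖I₁‖ ≤ ‖F.F₁ z - F.F₆ z‖ + ‖I₁‖ + ‖2 * F.F₂ z‖ + ‖2 * I₁‖
              + ‖F.F₆ z - F.F₁ z‖ + ‖F.F₂ z‖))
        simpa only [neg_mul, ← sub_eq_add_neg] using this
      · have := key (2 * F.F₂ z) (-(2 * I₁)) w q n1 n3 _
          (le_trans (by rw [norm_neg]) (by linarith :
            ‖2 * F.F₂ z‖ + ‖2 * I₁‖ ≤ ‖F.F₁ z - F.F₆ z‖ + ‖I₁‖ + ‖2 * F.F₂ z‖ + ‖2 * I₁‖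
              + ‖F.F₆ z - F.F₁ z‖ + ‖F.F₂ z‖))
        simpa only [neg_mul, ← sub_eq_add_neg] using this
      · exact key (F.F₆ z - F.F₁ z) (F.F₂ z) q v n3 n2 _ (by linarith)
  · right
    push Not at h
    intro z hz
    have hz' := hz0 z hz
    have hsub : (∀ᶠ w in 𝓝[≠] z, w * F.F₁ w - I₁ ≠ 0) → ∀ᶠ w in 𝓝[≠] z, w * F.F₁ w ≠ I₁ :=
      fun h => h.mono fun w hw => sub_ne_zero.1 hw
    apply hsub
    by_cases hw : z * F.F₁ z - I₁ = 0
    swap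
    · exact eventually_ne_of_hasDerivAt_of_ne 0 (dw z hz).differentiableAt (Or.inl hw)
    by_cases hv : F.F₆ z - I₂ = 0
    swap
    · refine eventually_ne_of_hasDerivAt_of_ne 0 (dw z hz).differentiableAt (Or.inr ?_)
      rw [(dw z hz).deriv, hw, mul_zero, zero_sub]
      exact div_ne_zero (neg_ne_zero.2 (mul_ne_zero h₁ hv)) hz'
    have hq := h z hz hw hv
    -- Here w = v = 0, so the fourth integral v² - 4qw = 2a gives a = 0. Since q ≠ 0, the derivative
    -- of v is nonzero and v ≠ 0 at nearby points; a zero of w at such a point would give v² = 0.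
    have ha : a = 0 := by
      rw [← hI.fourth z hz, hv]
      linear_combination -2 * (z * F.F₅ z - F.F₂ z) * hw
    have hv' : ∀ᶠ w in 𝓝[≠] z, F.F₆ w - I₂ ≠ 0 := by
      refine eventually_ne_of_hasDerivAt_of_ne 0 (dv z hz).differentiableAt (Or.inr ?_)
      rw [(dv z hz).deriv, hw, mul_zero, zero_sub]
      exact div_ne_zero (neg_ne_zero.2 (mul_ne_zero (mul_ne_zero two_ne_zero h₁) hq)) hz'
    filter_upwards [hv', nhdsWithin_le_nhds (hS.mem_nhds hz)] with x hx hxS hw'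
    have := hI.fourth x hxS
    rw [ha] at this
    apply hx
    have : (F.F₆ x - I₂) ^ 2 = 0 := by
      linear_combination 2 * this + 4 * (x * F.F₅ x - F.F₂ x) * hw'
    exact pow_eq_zero_iff two_ne_zero |>.1 this

/-- The profile of a bi-flat model: integrals, the solution of Painlevé V, exceptional points. -/
theorem painleve_of_isBiFlatOn_model {S : Set 𝕜} {F : Profile 𝕜} (hS : IsOpen S)
    (hc : IsPreconnected S) (h0 : (0 : 𝕜) ∉ S) (h : IsBiFlatOn (model F) (domainOver S)) :
    ∃ I₁ I₂ I₃ a : 𝕜, F.HasIntegrals S I₁ I₂ I₃ a ∧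
      (I₁ ≠ 0 →
        IsPainleveVSolution a (-I₂ ^ 2 / 2) (I₁ * I₃ + I₁) (-I₁ ^ 2 / 2)
          {x | x⁻¹ ∈ F.genericSet I₁ S} (F.painleveFunction I₁) ∧
        ((∀ z ∈ S, F.F₁ z = 0) ∨ (∀ z ∈ S, z * F.F₁ z = I₁) ∨
          ∀ z ∈ S, ∀ᶠ w in 𝓝[≠] z, w ∈ F.genericSet I₁ S)) := by
  obtain ⟨hF, hs⟩ := smoothOn_and_systemAt hS h0 h
  obtain ⟨I₁, I₂, I₃, a, hI⟩ := exists_hasIntegrals hS hc h0 hF hs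
  refine ⟨I₁, I₂, I₃, a, hI, fun h₁ =>
    ⟨(isPainleveVSystem_of_systemAt hS h0 hF hs hI h₁).isPainleveVSolution, ?_⟩⟩
  rcases F₁_eq_zero_or_eventually_ne hS hc h0 hF hs hI h₁ with h1 | h1
  · exact Or.inl h1
  rcases mul_F₁_eq_or_eventually_ne hS hc h0 hF hs hI h₁ with h2 | h2
  · exact Or.inr (Or.inl h2)
  refine Or.inr (Or.inr fun z hz => ?_)
  filter_upwards [h1 z hz, h2 z hz, nhdsWithin_le_nhds (hS.mem_nhds hz)] with w a b c
  exact ⟨c, a, b⟩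

end Trichotomy

/-! ### From a solution of Painlevé V to a unique model -/

section Converse

variable {𝕜 : Type*} [RCLike 𝕜]

/-- The profile constructed from a solution `y`, `h` of the first-order system. -/
def painleveProfile (I₁ I₂ I₃ a : 𝕜) (y h : 𝕜 → 𝕜) : Profile 𝕜 where
  F₁ z := I₁ * y z⁻¹ / (z * (y z⁻¹ - 1))
  F₂ z := (I₃ - h z⁻¹) / (2 * z)
  F₃ _ := I₁
  F₄ z := (I₁ * y z⁻¹ / (z * (y z⁻¹ - 1)) - I₂) / z
  F₅ z := (((h z⁻¹ - I₂) ^ 2 - 2 * a) * (y z⁻¹ - 1) / (4 * I₁) + (I₃ - h z⁻¹) / (2 * z)) / z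
  F₆ z := h z⁻¹

theorem ne_zero_of_inv_mem {X : Set 𝕜} (h0 : ∀ x ∈ X, x ≠ 0) {z : 𝕜} (hz : z⁻¹ ∈ X) : z ≠ 0 :=
  fun h => h0 _ hz (by rw [h, inv_zero])

variable {I₁ I₂ I₃ a : 𝕜} {X : Set 𝕜} {y h : 𝕜 → 𝕜}

theorem IsPainleveVSystem.smoothOn_painleveProfile (H : IsPainleveVSystem I₁ I₂ I₃ a X y h) :
    (painleveProfile I₁ I₂ I₃ a y h).SmoothOn {z | z⁻¹ ∈ X} := by
  have hz0 : ∀ z ∈ {z : 𝕜 | z⁻¹ ∈ X}, z ≠ 0 := fun z hz => ne_zero_of_inv_mem H.ne_zero hz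
  have hi : ContDiffOn 𝕜 ∞ (fun z : 𝕜 => z⁻¹) {z | z⁻¹ ∈ X} := contDiffOn_id.inv hz0
  have hid : ContDiffOn 𝕜 ∞ (fun z : 𝕜 => z) {z | z⁻¹ ∈ X} := contDiffOn_id
  have cy : ContDiffOn 𝕜 ∞ (fun z => y z⁻¹) {z | z⁻¹ ∈ X} := H.contDiffOn.1.comp hi fun _ hz => hz
  have ch : ContDiffOn 𝕜 ∞ (fun z => h z⁻¹) {z | z⁻¹ ∈ X} := H.contDiffOn.2.comp hi fun _ hz => hz
  have c1 : ContDiffOn 𝕜 ∞ (fun z => y z⁻¹ - 1) {z | z⁻¹ ∈ X} := cy.sub contDiffOn_const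
  have cF₁ : ContDiffOn 𝕜 ∞ (fun z => I₁ * y z⁻¹ / (z * (y z⁻¹ - 1))) {z | z⁻¹ ∈ X} :=
    (contDiffOn_const.mul cy).div (hid.mul c1) fun z hz =>
      mul_ne_zero (hz0 z hz) (sub_ne_zero.2 (H.value_ne_one _ hz))
  have cF₂ : ContDiffOn 𝕜 ∞ (fun z => (I₃ - h z⁻¹) / (2 * z)) {z | z⁻¹ ∈ X} :=
    (contDiffOn_const.sub ch).div (contDiffOn_const.mul hid) fun z hz =>
      mul_ne_zero two_ne_zero (hz0 z hz)
  exact ⟨cF₁, cF₂, contDiffOn_const, (cF₁.sub contDiffOn_const).div hid hz0,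
    ((((((ch.sub contDiffOn_const).pow 2).sub contDiffOn_const).mul c1).div_const _).add cF₂).div
      hid hz0, ch⟩

/-- The derivatives in z = 1/x are expressed through the first-order system by the chain rule; each
equation is then a rational identity in z, y and h. -/
theorem IsPainleveVSystem.systemAt_painleveProfile (H : IsPainleveVSystem I₁ I₂ I₃ a X y h)
    (h₁ : I₁ ≠ 0) {z : 𝕜} (hz : z⁻¹ ∈ X) : (painleveProfile I₁ I₂ I₃ a y h).SystemAt z := by
  have hz0 := ne_zero_of_inv_mem H.ne_zero hz
  have hi : HasDerivAt (fun z : 𝕜 => z) 1 z := hasDerivAt_id z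
  have dy := hasDerivAt_comp_inv hz0 (H.hasDerivAt_y _ hz)
  have dh := hasDerivAt_comp_inv hz0 (H.hasDerivAt_h _ hz)
  have hy1 := sub_ne_zero.2 (H.value_ne_one _ hz)
  have hd : z * (y z⁻¹ - 1) ≠ 0 := mul_ne_zero hz0 hy1
  have d₁ := (dy.const_mul I₁).div (hi.mul (dy.sub_const 1)) hd
  have d₂ := (dh.const_sub I₃).div (hi.const_mul 2) (mul_ne_zero two_ne_zero hz0)
  have d₄ := (d₁.sub_const I₂).div hi hz0
  have d₅ := ((((((dh.sub_const I₂).pow 2).sub_const (2 * a)).mul (dy.sub_const 1)).div_const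
    (4 * I₁)).add d₂).div hi hz0
  have e₁ : deriv (painleveProfile I₁ I₂ I₃ a y h).F₁ z = _ := d₁.deriv
  have e₂ : deriv (painleveProfile I₁ I₂ I₃ a y h).F₂ z = _ := d₂.deriv
  have e₃ : deriv (painleveProfile I₁ I₂ I₃ a y h).F₃ z = 0 := deriv_const z I₁
  have e₄ : deriv (painleveProfile I₁ I₂ I₃ a y h).F₄ z = _ := d₄.deriv
  have e₅ : deriv (painleveProfile I₁ I₂ I₃ a y h).F₅ z = _ := d₅.deriv
  have e₆ : deriv (painleveProfile I₁ I₂ I₃ a y h).F₆ z = _ := dh.deriv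
  clear d₁ d₂ d₄ d₅ dy dh hi
  constructor
  · rw [e₁]
    simp [painleveProfile]
    generalize y z⁻¹ = p at *
    generalize h z⁻¹ = r at *
    field_simp
    ring
  · rw [e₂]
    simp [painleveProfile]
    generalize y z⁻¹ = p at *
    generalize h z⁻¹ = r at *
    field_simp
    ring
  · exact e₃
  · rw [e₄, e₁]
    simp [painleveProfile]
    generalize y z⁻¹ = p at *
    generalize h z⁻¹ = r at *
    field_simp
    ring
  · rw [e₅, e₂]
    simp [painleveProfile]
    generalize y z⁻¹ = p at *
    generalize h z⁻¹ = r at *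
    field_simp
    ring
  · rw [e₆, e₂]
    simp [painleveProfile]
    generalize y z⁻¹ = p at *
    generalize h z⁻¹ = r at *
    field_simp
    ring

theorem mul_painleveProfile_F₁ {z : 𝕜} (hz : z ≠ 0) :
    z * (painleveProfile I₁ I₂ I₃ a y h).F₁ z = I₁ * y z⁻¹ / (y z⁻¹ - 1) := by
  change z * (I₁ * y z⁻¹ / (z * (y z⁻¹ - 1))) = _
  rw [← mul_div_assoc, mul_div_mul_left _ _ hz]

theorem IsPainleveVSystem.hasIntegrals_painleveProfile
    (H : IsPainleveVSystem I₁ I₂ I₃ a X y h) (h₁ : I₁ ≠ 0) :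
    (painleveProfile I₁ I₂ I₃ a y h).HasIntegrals {z | z⁻¹ ∈ X} I₁ I₂ I₃ a where
  first _ _ := rfl
  second z hz := by
    have hz0 := ne_zero_of_inv_mem H.ne_zero hz
    simp only [painleveProfile]
    rw [mul_div_cancel₀ _ hz0]
    ring
  third z hz := by
    have hz0 := ne_zero_of_inv_mem H.ne_zero hz
    simp only [painleveProfile]
    rw [mul_div_cancel₀ _ (mul_ne_zero two_ne_zero hz0)]
    ring
  fourth z hz := by
    have hz0 := ne_zero_of_inv_mem H.ne_zero hz
    have hy1 := sub_ne_zero.2 (H.value_ne_one _ hz)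
    rw [mul_painleveProfile_F₁ hz0]
    simp only [painleveProfile]
    generalize y z⁻¹ = p at *
    generalize h z⁻¹ = r at *
    field_simp
    ring

theorem IsPainleveVSystem.genericSet_painleveProfile
    (H : IsPainleveVSystem I₁ I₂ I₃ a X y h) (h₁ : I₁ ≠ 0) :
    (painleveProfile I₁ I₂ I₃ a y h).genericSet I₁ {z | z⁻¹ ∈ X} = {z | z⁻¹ ∈ X} := by
  refine Subset.antisymm (fun z hz => hz.1) fun z hz => ⟨hz, ?_, ?_⟩
  · exact div_ne_zero (mul_ne_zero h₁ (H.value_ne_zero _ hz))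
      (mul_ne_zero (ne_zero_of_inv_mem H.ne_zero hz) (sub_ne_zero.2 (H.value_ne_one _ hz)))
  · rw [mul_painleveProfile_F₁ (ne_zero_of_inv_mem H.ne_zero hz)]
    intro h
    rw [div_eq_iff (sub_ne_zero.2 (H.value_ne_one _ hz))] at h
    exact h₁ (by linear_combination h)

theorem IsPainleveVSystem.painleveFunction_painleveProfile
    (H : IsPainleveVSystem I₁ I₂ I₃ a X y h) (h₁ : I₁ ≠ 0) :
    EqOn ((painleveProfile I₁ I₂ I₃ a y h).painleveFunction I₁) y X := by
  intro x hx
  have hy1 := sub_ne_zero.2 (H.value_ne_one _ hx)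
  rw [Profile.painleveFunction, mul_painleveProfile_F₁ (inv_ne_zero (H.ne_zero x hx)), inv_inv]
  have : I₁ * y x / (y x - 1) - I₁ = I₁ / (y x - 1) := by field_simp; ring
  rw [this, div_div_div_cancel_right₀ hy1, mul_div_cancel_left₀ _ h₁]

/-- A flat profile is determined by its integrals and the function `y`. -/
theorem agreeOn_of_painleveFunction_eqOn {F G : Profile 𝕜} {S : Set 𝕜} (hS : IsOpen S)
    (h0 : (0 : 𝕜) ∉ S) (hsF : ∀ z ∈ S, F.SystemAt z) (hsG : ∀ z ∈ S, G.SystemAt z)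
    (hF : F.HasIntegrals S I₁ I₂ I₃ a) (hG : G.HasIntegrals S I₁ I₂ I₃ a)
    (hgen : F.genericSet I₁ S = S) (hgenG : G.genericSet I₁ S = S)
    (h₁ : I₁ ≠ 0) (hFG : ∀ z ∈ S, G.painleveFunction I₁ z⁻¹ = F.painleveFunction I₁ z⁻¹) :
    G.AgreeOn F S := by
  have hz0 : ∀ z ∈ S, z ≠ 0 := fun z hz h => h0 (h ▸ hz)
  have h1 : EqOn G.F₁ F.F₁ S := fun z hz => by
    have e := hFG z hz
    simp only [Profile.painleveFunction, inv_inv] at e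
    have hw : z * F.F₁ z - I₁ ≠ 0 := sub_ne_zero.2 (hgen.symm ▸ hz : z ∈ F.genericSet I₁ S).2.2
    have hw' : z * G.F₁ z - I₁ ≠ 0 :=
      sub_ne_zero.2 (hgenG.symm ▸ hz : z ∈ G.genericSet I₁ S).2.2
    rw [div_eq_div_iff hw' hw] at e
    -- The map from zF₁ to y is a Möbius transformation: after cross-multiplication the equality of
    -- the two quotients leaves only I₁z times the difference of the first functions.
    refine mul_left_cancel₀ (mul_ne_zero h₁ (hz0 z hz)) ?_
    linear_combination -e
  have h3 : EqOn G.F₃ F.F₃ S := fun z hz => (hG.first z hz).trans (hF.first z hz).symm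
  have h4 : EqOn G.F₄ F.F₄ S := fun z hz => by
    refine mul_left_cancel₀ (hz0 z hz) ?_
    linear_combination hF.second z hz - hG.second z hz + h1 hz
  -- The first equation contains F₆ with the factor F₁, which is nonzero on the generic set; the
  -- derivatives of the first functions coincide because these agree on an open set.
  have h6 : EqOn G.F₆ F.F₆ S := fun z hz => by
    have hd : deriv G.F₁ z = deriv F.F₁ z := by
      refine Filter.EventuallyEq.deriv_eq ?_
      filter_upwards [hS.mem_nhds hz] with w hw using h1 hw
    have e := (hsF z hz).eq₁
    have e' := (hsG z hz).eq₁
    rw [hd, h1 hz, h3 hz, h4 hz] at e'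
    refine mul_left_cancel₀ (hgen.symm ▸ hz : z ∈ F.genericSet I₁ S).2.1 ?_
    linear_combination e' - e
  have h2 : EqOn G.F₂ F.F₂ S := fun z hz => by
    refine mul_left_cancel₀ (mul_ne_zero two_ne_zero (hz0 z hz)) ?_
    linear_combination hG.third z hz - hF.third z hz - h6 hz
  refine ⟨h1, h2, h3, h4, fun z hz => ?_, h6⟩
  have hw : I₁ - z * F.F₁ z ≠ 0 :=
    sub_ne_zero.2 (hgen.symm ▸ hz : z ∈ F.genericSet I₁ S).2.2.symm
  have e := hF.fourth z hz
  have e' := hG.fourth z hz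
  rw [h1 hz, h2 hz, h6 hz] at e'
  refine mul_left_cancel₀ (mul_ne_zero (hz0 z hz) hw) ?_
  linear_combination (e' - e) / 2

/-- E∘ maps u²∂₂ to u¹ times itself and ∂₁ to u¹∂₁ + u²∂₂, so u²∂₂, ∂₁, ∂₃ is a Jordan basis; these
vectors are the columns of the matrix. -/
theorem hasJordanTypeTwoOne_stdMul {u : Fin 3 → 𝕜} (h1 : u 1 ≠ 0) (h02 : u 0 ≠ u 2) :
    HasJordanTypeTwoOne (Matrix.of (stdMul u)) := by
  refine ⟨u 0, u 2, !![0, 1, 0; u 1, 0, 0; 0, 0, 1], h02, ?_, ?_⟩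
  · simpa [Matrix.det_fin_three] using h1
  · ext i j
    fin_cases i <;> fin_cases j <;>
      simp [Matrix.mul_apply, Fin.sum_univ_three, stdMul, mul_comm]

theorem model_L (F : Profile 𝕜) (u : Fin 3 → 𝕜) : (model F).L u = Matrix.of (stdMul u) := by
  rw [BiFlatData.L, mulBy_stdProduct (model_c F u)]
  rfl

/-- Every solution of Painlevé V comes from exactly one bi-flat model with given integrals. -/
theorem exists_profile_of_isPainleveVSolution {a b g d : 𝕜} {X : Set 𝕜} {y : 𝕜 → 𝕜}
    (hy : IsPainleveVSolution a b g d X y) {I₁ I₂ I₃ : 𝕜} (h₁ : I₁ ≠ 0) (hd : -2 * d = I₁ ^ 2)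
    (hb : -2 * b = I₂ ^ 2) (hg : g = I₁ * I₃ + I₁) :
    ∃ F : Profile 𝕜,
      (IsBiFlatOn (model F) (domainOver {z | z⁻¹ ∈ X}) ∧
        F.HasIntegrals {z | z⁻¹ ∈ X} I₁ I₂ I₃ a ∧
        F.genericSet I₁ {z | z⁻¹ ∈ X} = {z | z⁻¹ ∈ X} ∧
        EqOn (F.painleveFunction I₁) y X) ∧
      (∀ u ∈ domainOver {z | z⁻¹ ∈ X}, HasJordanTypeTwoOne ((model F).L u)) ∧
      ∀ G : Profile 𝕜,
        IsBiFlatOn (model G) (domainOver {z | z⁻¹ ∈ X}) →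
        G.HasIntegrals {z | z⁻¹ ∈ X} I₁ I₂ I₃ a →
        EqOn (G.painleveFunction I₁) y X →
          G.AgreeOn F {z | z⁻¹ ∈ X} := by
  have H := hy.isPainleveVSystem (a := a) hd hb hg
  have hX0 : (0 : 𝕜) ∉ X := fun h => hy.ne_zero 0 h rfl
  have h0 : (0 : 𝕜) ∉ {z : 𝕜 | z⁻¹ ∈ X} := fun h => hX0 (by simpa using h)
  have hS : IsOpen {z : 𝕜 | z⁻¹ ∈ X} := isOpen_setOf_inv_mem hy.isOpen hX0
  refine ⟨painleveProfile I₁ I₂ I₃ a y (painleveConjugate I₁ I₂ y),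
    ⟨isBiFlatOn_model hS H.smoothOn_painleveProfile
      fun z hz => H.systemAt_painleveProfile h₁ hz,
      H.hasIntegrals_painleveProfile h₁, H.genericSet_painleveProfile h₁,
      H.painleveFunction_painleveProfile h₁⟩, fun u hu => ?_, fun G hG hGI hGy => ?_⟩
  · rw [model_L]
    exact hasJordanTypeTwoOne_stdMul hu.2.1 hu.2.2.2.1
  · obtain ⟨-, hGs⟩ := smoothOn_and_systemAt hS h0 hG
    refine agreeOn_of_painleveFunction_eqOn hS h0 (fun z hz => H.systemAt_painleveProfile h₁ hz)
      hGs (H.hasIntegrals_painleveProfile h₁) hGI (H.genericSet_painleveProfile h₁) ?_ h₁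
      fun z hz => (hGy hz).trans (H.painleveFunction_painleveProfile h₁ hz).symm
    -- Division by zero has the value 0, so `painleveFunction` is 0 both where F₁ = 0 and where zF₁
    -- = I₁. As y avoids 0, any competitor G with the same y is generic everywhere.
    refine Subset.antisymm (fun z hz => hz.1) fun z hz => ⟨hz, fun e => ?_, fun e => ?_⟩
    · refine hy.value_ne_zero _ hz ?_
      rw [← hGy hz, Profile.painleveFunction, inv_inv, e]
      simp
    · refine hy.value_ne_zero _ hz ?_
      rw [← hGy hz, Profile.painleveFunction, inv_inv, e]
      simp

end Converse

/-! ### Parallel fields as symmetries of a flat connection -/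

section Pd

variable {𝕜 : Type*} [RCLike 𝕜] {n : ℕ}

theorem pd_congr {Ω : Set (Fin n → 𝕜)} (hΩ : IsOpen Ω) {f g : (Fin n → 𝕜) → 𝕜}
    (h : ∀ u ∈ Ω, f u = g u) {u : Fin n → 𝕜} (hu : u ∈ Ω) (s : Fin n) : pd s f u = pd s g u := by
  have e : f =ᶠ[𝓝 u] g := by
    filter_upwards [hΩ.mem_nhds hu] with v hv using h v hv
  rw [pd, pd, e.fderiv_eq]

theorem hasGrad_of_contDiffOn {Ω : Set (Fin n → 𝕜)} (hΩ : IsOpen Ω) {f : (Fin n → 𝕜) → 𝕜}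
    (h : ContDiffOn 𝕜 ∞ f Ω) {u : Fin n → 𝕜} (hu : u ∈ Ω) : HasGrad f (fun s => pd s f u) u :=
  ⟨(h.contDiffAt (hΩ.mem_nhds hu)).differentiableAt (by simp), fun _ => rfl⟩

theorem HasGrad.fderiv_apply {f : (Fin n → 𝕜) → 𝕜} {g : Fin n → 𝕜} {u : Fin n → 𝕜}
    (h : HasGrad f g u) (v : Fin n → 𝕜) : fderiv 𝕜 f u v = ∑ s, v s * g s := by
  conv_lhs => rw [pi_eq_sum_univ' v]
  rw [map_sum]
  refine Finset.sum_congr rfl fun s _ => ?_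
  rw [map_smul, smul_eq_mul, ← h.2 s, pd]

theorem curvature_congr {Ω : Set (Fin n → 𝕜)} (hΩ : IsOpen Ω) {Γ Γ' : Comp 𝕜 n}
    (h : ∀ u ∈ Ω, Γ u = Γ' u) {u : Fin n → 𝕜} (hu : u ∈ Ω) (k l i j : Fin n) :
    curvature Γ u k l i j = curvature Γ' u k l i j := by
  simp only [curvature, h u hu]
  have e : ∀ s k i l, pd s (fun v => Γ v k i l) u = pd s (fun v => Γ' v k i l) u :=
    fun s k i l => pd_congr hΩ (fun v hv => by rw [h v hv]) hu s
  rw [e, e]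

/-- A flat torsionless connection is invariant under the flow of a parallel vector field with
constant partial derivatives. -/
theorem lieDerivative_connection_eq_zero {Ω : Set (Fin 3 → 𝕜)} (hΩ : IsOpen Ω) {Γ c : Comp 𝕜 3}
    {ξ : (Fin 3 → 𝕜) → Fin 3 → 𝕜} (h : IsFlatCompatibleOn Γ c ξ Ω) {A : Fin 3 → Fin 3 → 𝕜}
    (hA : ∀ u ∈ Ω, ∀ k, HasGrad (fun v => ξ v k) (fun s => A s k) u)
    {u : Fin 3 → 𝕜} (hu : u ∈ Ω) (k j l : Fin 3) :
    ∑ i, ξ u i * pd i (fun v => Γ v k j l) u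
      = ∑ i, (A i k * Γ u i j l - A j i * Γ u k i l - A l i * Γ u k j i) := by
  have hG : ∀ a b c, HasGrad (fun v => Γ v a b c) (fun s => pd s (fun v => Γ v a b c) u) u :=
    fun a b c => hasGrad_of_contDiffOn hΩ (h.smooth_Γ a b c) hu
  have hpar : ∀ v ∈ Ω, ∀ i k, A i k + ∑ s, Γ v k i s * ξ v s = 0 := fun v hv i k => by
    rw [← h.parallel v hv i k, (hA v hv k).2]
  -- This is the derivative in the direction ∂_j of the equation saying that ξ is parallel; the
  -- partial derivatives A of ξ are constant and drop out.
  have hder : ∑ i, (pd j (fun v => Γ v k l i) u * ξ u i + Γ u k l i * A j i) = 0 := by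
    have h1 := ((HasGrad.const (A l k) u).add
      ((((hG k l 0).mul (hA u hu 0)).add ((hG k l 1).mul (hA u hu 1))).add
        ((hG k l 2).mul (hA u hu 2)))).2 j
    rw [pd_congr hΩ (g := fun _ => 0) (fun v hv => by
      have := hpar v hv l k
      rwa [Fin.sum_univ_three] at this) hu, pd_const] at h1
    rw [Fin.sum_univ_three]
    linear_combination -h1
  have hsym : ∀ i, pd j (fun v => Γ v k i l) u = pd j (fun v => Γ v k l i) u := fun i =>
    pd_congr hΩ (fun v hv => h.torsionless v hv k i l) hu j
  have hc := fun i => h.flat u hu k l i j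
  have ht := h.torsionless u hu
  have hp : ∀ i k, A i k + ∑ s, Γ u k s i * ξ u s = 0 := fun i k => by
    rw [← hpar u hu i k]
    simp only [ht k i]
  simp only [curvature, Fin.sum_univ_three, hsym] at hc hp hder ⊢
  -- In components this is L_ξ∇ = ∇²ξ + R(ξ, ·): the terms `hc` are the curvature, while `hp` and
  -- `hder` express ∇ξ = 0 and its derivative.
  linear_combination ξ u 0 * hc 0 + ξ u 1 * hc 1 + ξ u 2 * hc 2 + hder
    - Γ u 0 j l * hp 0 k - Γ u 1 j l * hp 1 k - Γ u 2 j l * hp 2 k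
    + Γ u k j 0 * hp l 0 + Γ u k j 1 * hp l 1 + Γ u k j 2 * hp l 2
    + A j 0 * ht k 0 l + A j 1 * ht k 1 l + A j 2 * ht k 2 l

end Pd

/-! ### The Christoffel symbols in canonical coordinates -/

section ConnectionForm

variable {𝕜 : Type*} [RCLike 𝕜]

/-- The product, its unit and the Euler field have the canonical form on `Ω`. -/
structure IsCanonicalOn (D : BiFlatData 𝕜 3) (Ω : Set (Fin 3 → 𝕜)) : Prop where
  isOpen : IsOpen Ω
  isBiFlatOn : IsBiFlatOn D Ω
  mem : ∀ u ∈ Ω, u 0 ≠ 0 ∧ u 1 ≠ 0 ∧ u 2 ≠ 0 ∧ u 0 ≠ u 2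
  c : ∀ u ∈ Ω, D.c u = stdProduct 𝕜
  e : ∀ u ∈ Ω, D.e u = ![1, 0, 1]
  E : ∀ u ∈ Ω, D.E u = u

variable {D : BiFlatData 𝕜 3} {Ω : Set (Fin 3 → 𝕜)}

theorem IsCanonicalOn.Einv (H : IsCanonicalOn D Ω) {u : Fin 3 → 𝕜} (hu : u ∈ Ω) :
    D.Einv u = ![1 / u 0, -(u 1) / u 0 ^ 2, 1 / u 2] := by
  obtain ⟨h0, h1, h2, -⟩ := H.mem u hu
  have h := H.isBiFlatOn.inverse u hu
  simp only [H.c u hu, H.e u hu, H.E u hu, Fin.sum_univ_three] at h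
  have e0 := h 0
  have e1 := h 1
  have e2 := h 2
  simp [stdProduct] at e0 e1 e2
  funext i
  fin_cases i <;> simp <;> field_simp
  · linear_combination e0
  · linear_combination u 0 * e1 - u 1 * e0
  · linear_combination e2

/-- The components of the first connection that determine all others. -/
structure ConnectionMatches (D : BiFlatData 𝕜 3) (F : Profile 𝕜) (u : Fin 3 → 𝕜) : Prop where
  F₁ : F.F₁ (zCoord u) / u 1 = D.Γ₁ u 2 1 2
  F₂ : F.F₂ (zCoord u) / u 1 = D.Γ₁ u 0 0 2
  F₃ : F.F₃ (zCoord u) / u 1 = D.Γ₁ u 0 1 1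
  F₄ : F.F₄ (zCoord u) / u 1 = D.Γ₁ u 2 0 2
  F₅ : F.F₅ (zCoord u) / u 1 = D.Γ₁ u 1 0 2
  F₆ : F.F₆ (zCoord u) / u 1 = D.Γ₁ u 1 1 1

theorem IsCanonicalOn.pd_e (H : IsCanonicalOn D Ω) {u : Fin 3 → 𝕜} (hu : u ∈ Ω) (i k : Fin 3) :
    pd i (fun v => D.e v k) u = 0 := by
  rw [pd_congr H.isOpen (g := fun _ => (![1, 0, 1] : Fin 3 → 𝕜) k)
    (fun v hv => by rw [H.e v hv]) hu, pd_const]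

theorem IsCanonicalOn.pd_E (H : IsCanonicalOn D Ω) {u : Fin 3 → 𝕜} (hu : u ∈ Ω) (i k : Fin 3) :
    pd i (fun v => D.E v k) u = Pi.single (M := fun _ => 𝕜) k 1 i := by
  rw [pd_congr H.isOpen (g := fun v => v k) (fun v hv => by rw [H.E v hv]) hu, pd_coord]

/-- As e = ∂₁ + ∂₃ is parallel, exchanging a lower index 1 for 3 changes the sign; this leaves
Γ^k₁₃, Γ^k₂₃, Γ^k₂₂. Three instances of the symmetry of ∇∘ remove three of these nine, so that six
remain. -/
theorem IsCanonicalOn.Γ₁_relations (H : IsCanonicalOn D Ω) {u : Fin 3 → 𝕜} (hu : u ∈ Ω) :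
    (∀ k, D.Γ₁ u k 0 0 = -D.Γ₁ u k 0 2 ∧ D.Γ₁ u k 0 1 = -D.Γ₁ u k 1 2 ∧
      D.Γ₁ u k 1 0 = -D.Γ₁ u k 1 2 ∧ D.Γ₁ u k 2 0 = D.Γ₁ u k 0 2 ∧
      D.Γ₁ u k 2 1 = D.Γ₁ u k 1 2 ∧ D.Γ₁ u k 2 2 = -D.Γ₁ u k 0 2) ∧
    D.Γ₁ u 0 1 2 = 0 ∧ D.Γ₁ u 1 1 2 = D.Γ₁ u 0 0 2 ∧ D.Γ₁ u 2 1 1 = 0 := by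
  have hf := H.isBiFlatOn.flat₁
  have ht := hf.torsionless u hu
  have hp : ∀ i k, D.Γ₁ u k i 0 + D.Γ₁ u k i 2 = 0 := fun i k => by
    have := hf.parallel u hu i k
    rw [H.pd_e hu, H.e u hu, Fin.sum_univ_three] at this
    simpa using this
  have hc : ∀ i k l j, covDerivProduct D.Γ₁ D.c u i k l j = covDerivProduct D.Γ₁ D.c u l k i j :=
    hf.compatible u hu
  have hpc : ∀ s i j k, pd s (fun v => D.c v i j k) u = 0 := fun s i j k => by
    rw [pd_congr H.isOpen (g := fun _ => stdProduct 𝕜 i j k) (fun v hv => by rw [H.c v hv]) hu,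
      pd_const]
  simp only [covDerivProduct, hpc, H.c u hu, Fin.sum_univ_three] at hc
  have c1 := hc 2 0 1 0
  have c2 := hc 2 1 1 0
  have c3 := hc 2 2 1 1
  simp [stdProduct] at c1 c2 c3
  have k1 : ∀ k, D.Γ₁ u k 1 0 = -D.Γ₁ u k 1 2 := fun k => by linear_combination hp 1 k
  refine ⟨fun k => ⟨by linear_combination hp 0 k, by rw [ht, k1], k1 k, ht _ _ _, ht _ _ _,
    by linear_combination hp 2 k - ht k 2 0⟩, ?_, ?_, ?_⟩
  · exact c1
  · linear_combination -c2 + ht 0 2 0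
  · linear_combination c3

theorem IsCanonicalOn.Γ₁_eq (H : IsCanonicalOn D Ω) {F : Profile 𝕜} {u : Fin 3 → 𝕜} (hu : u ∈ Ω)
    (hF : ConnectionMatches D F u) : D.Γ₁ u = modelΓ₁ F u := by
  obtain ⟨hk, h1, h2, h3⟩ := H.Γ₁_relations hu
  funext k i j
  fin_cases k <;> fin_cases i <;> fin_cases j <;>
    simp [modelΓ₁, hF.F₁, hF.F₂, hF.F₃, hF.F₄, hF.F₅, hF.F₆, hk, h1, h2, h3]

theorem IsCanonicalOn.Γ₂_eq_Γ₁ (H : IsCanonicalOn D Ω) {u : Fin 3 → 𝕜} (hu : u ∈ Ω) (k : Fin 3) :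
    D.Γ₂ u k 0 2 = D.Γ₁ u k 0 2 ∧ D.Γ₂ u k 1 2 = D.Γ₁ u k 1 2 ∧
      D.Γ₂ u k 1 1 = D.Γ₁ u k 1 1 := by
  have h : ∀ X i j, ∑ s, (D.Γ₁ u k i s - D.Γ₂ u k i s) * stdMul X s j
      = ∑ s, (D.Γ₁ u k j s - D.Γ₂ u k j s) * stdMul X s i := fun X i j => by
    have := H.isBiFlatOn.hydro (fun _ => X) contDiffOn_const u hu k i j
    rwa [dNabla_eq_iff, mulBy_stdProduct (H.c u hu)] at this
  simp only [Fin.sum_univ_three] at h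
  -- The test fields ∂₃ and ∂₂ act by matrices with a single nonzero entry, so on these index pairs
  -- only one difference of Christoffel symbols survives.
  have a1 := h ![0, 0, 1] 0 2
  have a2 := h ![0, 0, 1] 1 2
  have a3 := h ![0, 1, 0] 1 0
  simp [stdMul] at a1 a2 a3
  exact ⟨by linear_combination -a1, by linear_combination -a2, by linear_combination -a3⟩

/-- The components not shared with ∇⁽¹⁾ follow from ∇⁽²⁾E = 0, a linear relation that is solved for
Γ^k₂₁ and Γ^k₃₃ and then for Γ^k₁₁; u¹ and u³ are the divisors. -/
theorem IsCanonicalOn.Γ₂_eq (H : IsCanonicalOn D Ω) {F : Profile 𝕜} {u : Fin 3 → 𝕜} (hu : u ∈ Ω)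
    (hF : ConnectionMatches D F u) : D.Γ₂ u = modelΓ₂ F u := by
  obtain ⟨h0, -, h2, -⟩ := H.mem u hu
  obtain ⟨-, g1, g2, g3⟩ := H.Γ₁_relations hu
  have hh := H.Γ₂_eq_Γ₁ hu
  have ht := H.isBiFlatOn.flat₂.torsionless u hu
  have hp : ∀ i k, Pi.single (M := fun _ => 𝕜) k 1 i
      + (D.Γ₂ u k i 0 * u 0 + D.Γ₂ u k i 1 * u 1 + D.Γ₂ u k i 2 * u 2) = 0 := fun i k => by
    have := H.isBiFlatOn.flat₂.parallel u hu i k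
    rwa [H.pd_E hu, H.E u hu, Fin.sum_univ_three] at this
  have e20 : ∀ k, D.Γ₂ u k 2 0 = D.Γ₁ u k 0 2 := fun k => by rw [ht, (hh k).1]
  have e21 : ∀ k, D.Γ₂ u k 2 1 = D.Γ₁ u k 1 2 := fun k => by rw [ht, (hh k).2.1]
  have e10 : ∀ k, D.Γ₂ u k 1 0 = -(Pi.single (M := fun _ => 𝕜) k 1 1 + D.Γ₁ u k 1 1 * u 1
      + D.Γ₁ u k 1 2 * u 2) / u 0 := fun k => by
    rw [eq_div_iff h0, ← (hh k).2.1, ← (hh k).2.2]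
    linear_combination hp 1 k
  have e01 : ∀ k, D.Γ₂ u k 0 1 = -(Pi.single (M := fun _ => 𝕜) k 1 1 + D.Γ₁ u k 1 1 * u 1
      + D.Γ₁ u k 1 2 * u 2) / u 0 := fun k => by rw [ht, e10]
  have e22 : ∀ k, D.Γ₂ u k 2 2 = -(Pi.single (M := fun _ => 𝕜) k 1 2 + D.Γ₁ u k 0 2 * u 0
      + D.Γ₁ u k 1 2 * u 1) / u 2 := fun k => by
    rw [eq_div_iff h2, ← e20, ← e21]
    linear_combination hp 2 k
  have e00 : ∀ k, D.Γ₂ u k 0 0 = -(Pi.single (M := fun _ => 𝕜) k 1 0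
      + -(Pi.single (M := fun _ => 𝕜) k 1 1 + D.Γ₁ u k 1 1 * u 1
      + D.Γ₁ u k 1 2 * u 2) / u 0 * u 1 + D.Γ₁ u k 0 2 * u 2) / u 0 := fun k => by
    rw [eq_div_iff h0, ← e01, ← (hh k).1]
    linear_combination hp 0 k
  funext k i j
  fin_cases k <;> fin_cases i <;> fin_cases j <;>
    simp [modelΓ₂, hF.F₁, hF.F₂, hF.F₃, hF.F₄, hF.F₅, hF.F₆, hh, e20, e21, e10, e01, e22, e00,
      g1, g2, g3] <;> field_simp <;> ring

end ConnectionForm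

/-! ### The profile of a structure in canonical coordinates -/

section Descent

variable {𝕜 : Type*} [RCLike 𝕜] {Ω : Set (Fin 3 → 𝕜)}

/-- On a convex open set, a function annihilated by `∂₁ + ∂₃` and by the Euler field depends on
`z` only. -/
theorem eq_of_zCoord_eq (hΩ : IsOpen Ω) (hconv : Convex ℝ Ω) (hne : ∀ u ∈ Ω, u 1 ≠ 0)
    {g : (Fin 3 → 𝕜) → 𝕜} (hg : ∀ u ∈ Ω, DifferentiableAt 𝕜 g u)
    (he : ∀ u ∈ Ω, fderiv 𝕜 g u ![1, 0, 1] = 0) (hE : ∀ u ∈ Ω, fderiv 𝕜 g u u = 0)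
    {u v : Fin 3 → 𝕜} (hu : u ∈ Ω) (hv : v ∈ Ω) (h : zCoord u = zCoord v) : g u = g v := by
  have hzu := eq_add_zCoord_mul (hne u hu)
  have hzv := eq_add_zCoord_mul (hne v hv)
  rw [← h] at hzv
  set K : Set 𝕜 := (fun t : 𝕜 => u + t • (v - u)) ⁻¹' Ω
  have hpath : ∀ t : 𝕜, HasDerivAt (fun t : 𝕜 => u + t • (v - u)) (v - u) t := fun t => by
    simpa using ((hasDerivAt_id t).smul_const (v - u)).const_add u
  have hKo : IsOpen K := hΩ.preimage (by fun_prop)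
  have hKc : Convex ℝ K := by
    intro s hs t ht a b ha hb hab
    have := hconv hs ht ha hb hab
    have e : a • (u + s • (v - u)) + b • (u + t • (v - u)) = u + (a • s + b • t) • (v - u) := by
      rw [smul_add, smul_add, add_smul, smul_assoc, smul_assoc, add_add_add_comm, ← add_smul, hab,
        one_smul]
    change u + (a • s + b • t) • (v - u) ∈ Ω
    rwa [e] at this
  have hder : ∀ t ∈ K, HasDerivAt (fun t : 𝕜 => g (u + t • (v - u))) 0 t := by
    intro t ht
    have h1 := (hg _ ht).hasFDerivAt.comp_hasDerivAt t (hpath t)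
    refine h1.congr_deriv ?_
    set w := u + t • (v - u) with hw
    have hw1 := hne w ht
    have hzw : w 2 = w 0 + zCoord u * w 1 := by
      simp only [hw, Pi.add_apply, Pi.smul_apply, Pi.sub_apply, smul_eq_mul]
      linear_combination (1 - t) * hzu + t * hzv
    -- A level set of z lies in a linear plane u³ = u¹ + z u², which contains the whole segment. As
    -- w¹ ≠ 0 in zero-based indexing, this plane is spanned by e and the Euler vector w at every
    -- point w of the segment, and g is constant along both.
    have e : v - u = ((v 0 - u 0) - (v 1 - u 1) / w 1 * w 0) • (![1, 0, 1] : Fin 3 → 𝕜)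
        + ((v 1 - u 1) / w 1) • w := by
      funext i
      fin_cases i
      · simp
      · simp [hw1]
      · simp
        rw [hzw]
        field_simp
        linear_combination w 1 * (hzv - hzu)
    change fderiv 𝕜 g w (v - u) = 0
    have hwΩ : w ∈ Ω := ht
    clear_value w
    rw [e, map_add, map_smul, map_smul, he w hwΩ, hE w hwΩ, smul_zero, smul_zero, add_zero]
  have h0 : (0 : 𝕜) ∈ K := by change u + (0 : 𝕜) • (v - u) ∈ Ω; simpa using hu
  have h1 : (1 : 𝕜) ∈ K := by change u + (1 : 𝕜) • (v - u) ∈ Ω; simpa using hv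
  have := hKo.is_const_of_deriv_eq_zero hKc.isPreconnected
    (fun t ht => (hder t ht).differentiableAt.differentiableWithinAt)
    (fun t ht => (hder t ht).deriv) h0 h1
  simpa using this

/-- The function of `z` induced by a function on `Ω`. -/
def descend (Ω : Set (Fin 3 → 𝕜)) (g : (Fin 3 → 𝕜) → 𝕜) (z : 𝕜) : 𝕜 :=
  open Classical in if h : ∃ u ∈ Ω, zCoord u = z then g h.choose else 0

theorem descend_zCoord {g : (Fin 3 → 𝕜) → 𝕜}
    (hg : ∀ u ∈ Ω, ∀ v ∈ Ω, zCoord u = zCoord v → g u = g v) {u : Fin 3 → 𝕜} (hu : u ∈ Ω) :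
    descend Ω g (zCoord u) = g u := by
  have h : ∃ v ∈ Ω, zCoord v = zCoord u := ⟨u, hu, rfl⟩
  rw [descend, dif_pos h]
  exact hg _ h.choose_spec.1 _ hu h.choose_spec.2

/-- A curve through `u` on which `z` is the parameter. -/
def zCurve (u : Fin 3 → 𝕜) (z : 𝕜) : Fin 3 → 𝕜 := ![u 0, u 1, u 0 + z * u 1]

theorem zCurve_zCoord {u : Fin 3 → 𝕜} (h1 : u 1 ≠ 0) : zCurve u (zCoord u) = u := by
  funext i
  fin_cases i
  · rfl
  · rfl
  · exact (eq_add_zCoord_mul h1).symm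

theorem zCoord_zCurve {u : Fin 3 → 𝕜} (h1 : u 1 ≠ 0) (z : 𝕜) : zCoord (zCurve u z) = z := by
  simp [zCoord, zCurve, h1]

theorem contDiff_zCurve (u : Fin 3 → 𝕜) : ContDiff 𝕜 ∞ (zCurve u) := by
  rw [contDiff_pi]
  intro i
  fin_cases i
  · exact contDiff_const
  · exact contDiff_const
  · exact contDiff_const.add (contDiff_id.mul contDiff_const)

theorem eventually_zCurve_mem (hΩ : IsOpen Ω) {u : Fin 3 → 𝕜} (hu : u ∈ Ω) (h1 : u 1 ≠ 0) :
    ∀ᶠ z in 𝓝 (zCoord u), zCurve u z ∈ Ω :=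
  (contDiff_zCurve u).continuous.continuousAt.preimage_mem_nhds
    (by rw [zCurve_zCoord h1]; exact hΩ.mem_nhds hu)

theorem isOpen_image_zCoord (hΩ : IsOpen Ω) (hne : ∀ u ∈ Ω, u 1 ≠ 0) : IsOpen (zCoord '' Ω) := by
  rw [isOpen_iff_mem_nhds]
  rintro _ ⟨u, hu, rfl⟩
  filter_upwards [eventually_zCurve_mem hΩ hu (hne u hu)] with z hz
  exact ⟨_, hz, zCoord_zCurve (hne u hu) z⟩

theorem contDiffOn_descend (hΩ : IsOpen Ω) (hne : ∀ u ∈ Ω, u 1 ≠ 0) {g : (Fin 3 → 𝕜) → 𝕜}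
    (hg : ∀ u ∈ Ω, ∀ v ∈ Ω, zCoord u = zCoord v → g u = g v) (hs : ContDiffOn 𝕜 ∞ g Ω) :
    ContDiffOn 𝕜 ∞ (descend Ω g) (zCoord '' Ω) := by
  rintro _ ⟨u, hu, rfl⟩
  refine ContDiffAt.contDiffWithinAt ?_
  have h1 : ContDiffAt 𝕜 ∞ (fun z => g (zCurve u z)) (zCoord u) := by
    refine ContDiffAt.comp _ ?_ (contDiff_zCurve u).contDiffAt
    rw [zCurve_zCoord (hne u hu)]
    exact hs.contDiffAt (hΩ.mem_nhds hu)
  refine h1.congr_of_eventuallyEq ?_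
  filter_upwards [eventually_zCurve_mem hΩ hu (hne u hu)] with z hz
  rw [← descend_zCoord hg hz, zCoord_zCurve (hne u hu)]

variable {D : BiFlatData 𝕜 3}

/-- A component that both connections share is invariant under the unit field and homogeneous. -/
theorem IsCanonicalOn.mul_component_eq (H : IsCanonicalOn D Ω) (hconv : Convex ℝ Ω) {k i j : Fin 3}
    (h : ∀ u ∈ Ω, D.Γ₁ u k i j = D.Γ₂ u k i j) :
    ∀ u ∈ Ω, ∀ v ∈ Ω, zCoord u = zCoord v → u 1 * D.Γ₁ u k i j = v 1 * D.Γ₁ v k i j := by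
  have hG := fun u (hu : u ∈ Ω) => hasGrad_of_contDiffOn H.isOpen
    (H.isBiFlatOn.flat₁.smooth_Γ k i j) hu
  have hg : ∀ u (hu : u ∈ Ω), HasGrad (fun v => v 1 * D.Γ₁ v k i j) _ u := fun u hu =>
    (HasGrad.coord 1 u).mul (hG u hu)
  refine fun u hu v hv huv => eq_of_zCoord_eq H.isOpen hconv (fun u hu => (H.mem u hu).2.1)
    (fun u hu => (hg u hu).1) (fun u hu => ?_) (fun u hu => ?_) hu hv huv
  -- The field e is constant and parallel for ∇⁽¹⁾, so it annihilates the component.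
  · have := lieDerivative_connection_eq_zero H.isOpen H.isBiFlatOn.flat₁ (A := 0)
      (fun u hu k => ⟨((hasGrad_of_contDiffOn H.isOpen (contDiffOn_pi.1
        H.isBiFlatOn.fManifold.smooth_e k) hu)).1, fun s => H.pd_e hu s k⟩) hu k i j
    rw [(hg u hu).fderiv_apply, Fin.sum_univ_three]
    rw [H.e u hu, Fin.sum_univ_three] at this
    simp at this ⊢
    linear_combination u 1 * this
  -- For E, parallel for ∇⁽²⁾, the matrix A is the identity; one upper and two lower indices give
  -- degree -1, which the factor u² compensates.
  · have := lieDerivative_connection_eq_zero H.isOpen H.isBiFlatOn.flat₂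
      (A := fun s k => Pi.single (M := fun _ => 𝕜) k 1 s)
      (fun u hu k => ⟨((hasGrad_of_contDiffOn H.isOpen (contDiffOn_pi.1
        H.isBiFlatOn.smooth_E k) hu)).1, fun s => H.pd_E hu s k⟩) hu k i j
    rw [(hg u hu).fderiv_apply, Fin.sum_univ_three]
    have e : ∀ s, pd s (fun v => D.Γ₂ v k i j) u = pd s (fun v => D.Γ₁ v k i j) u := fun s =>
      pd_congr H.isOpen (fun v hv => (h v hv).symm) hu s
    simp only [H.E u hu, e] at this
    simp [Pi.single_apply, Finset.sum_sub_distrib, ← h u hu, Fin.sum_univ_three] at this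
    simp
    linear_combination u 1 * this

/-- The profile of a structure in canonical coordinates. -/
def BiFlatData.profile (D : BiFlatData 𝕜 3) (Ω : Set (Fin 3 → 𝕜)) : Profile 𝕜 where
  F₁ := descend Ω fun u => u 1 * D.Γ₁ u 2 1 2
  F₂ := descend Ω fun u => u 1 * D.Γ₁ u 0 0 2
  F₃ := descend Ω fun u => u 1 * D.Γ₁ u 0 1 1
  F₄ := descend Ω fun u => u 1 * D.Γ₁ u 2 0 2
  F₅ := descend Ω fun u => u 1 * D.Γ₁ u 1 0 2
  F₆ := descend Ω fun u => u 1 * D.Γ₁ u 1 1 1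

/-- In canonical coordinates on a convex set, the structure is a model. -/
theorem IsCanonicalOn.exists_profile (H : IsCanonicalOn D Ω) (hconv : Convex ℝ Ω) :
    ∃ (S : Set 𝕜) (F : Profile 𝕜), IsOpen S ∧ IsPreconnected S ∧ (0 : 𝕜) ∉ S ∧
      Ω ⊆ domainOver S ∧ D.AgreeOn (model F) Ω ∧ IsBiFlatOn (model F) (domainOver S) := by
  have hne : ∀ u ∈ Ω, u 1 ≠ 0 := fun u hu => (H.mem u hu).2.1
  have hS := isOpen_image_zCoord H.isOpen hne
  have h02 := fun k => H.mul_component_eq hconv (k := k) fun u hu => (H.Γ₂_eq_Γ₁ hu k).1.symm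
  have h12 := fun k => H.mul_component_eq hconv (k := k) fun u hu => (H.Γ₂_eq_Γ₁ hu k).2.1.symm
  have h11 := fun k => H.mul_component_eq hconv (k := k) fun u hu => (H.Γ₂_eq_Γ₁ hu k).2.2.symm
  have hsm : ∀ k i j, ContDiffOn 𝕜 ∞ (fun u => u 1 * D.Γ₁ u k i j) Ω := fun k i j =>
    (contDiff_apply 𝕜 𝕜 1).contDiffOn.mul (H.isBiFlatOn.flat₁.smooth_Γ k i j)
  set F := D.profile Ω with hFdef
  have hF : F.SmoothOn (zCoord '' Ω) :=
    ⟨contDiffOn_descend H.isOpen hne (h12 2) (hsm _ _ _),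
      contDiffOn_descend H.isOpen hne (h02 0) (hsm _ _ _),
      contDiffOn_descend H.isOpen hne (h11 0) (hsm _ _ _),
      contDiffOn_descend H.isOpen hne (h02 2) (hsm _ _ _),
      contDiffOn_descend H.isOpen hne (h02 1) (hsm _ _ _),
      contDiffOn_descend H.isOpen hne (h11 1) (hsm _ _ _)⟩
  have key : ∀ {k i j : Fin 3}, (∀ u ∈ Ω, ∀ v ∈ Ω, zCoord u = zCoord v →
      u 1 * D.Γ₁ u k i j = v 1 * D.Γ₁ v k i j) → ∀ u ∈ Ω,
      descend Ω (fun u => u 1 * D.Γ₁ u k i j) (zCoord u) / u 1 = D.Γ₁ u k i j :=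
    fun h u hu => by rw [descend_zCoord h hu, mul_div_cancel_left₀ _ (hne u hu)]
  have hm : ∀ u ∈ Ω, ConnectionMatches D F u := fun u hu =>
    ⟨key (h12 2) u hu, key (h02 0) u hu, key (h11 0) u hu, key (h02 2) u hu, key (h02 1) u hu,
      key (h11 1) u hu⟩
  -- S is the image of the coordinate domain under z, connected because the domain is convex. The
  -- system only involves z, so the model is bi-flat on all of `domainOver S`, not just on Ω.
  refine ⟨zCoord '' Ω, F, hS, hconv.isPreconnected.image _ (contDiffOn_zCoord hne).continuousOn,
    ?_, fun u hu => ?_, ⟨fun u hu => H.c u hu, fun u hu => H.e u hu, fun u hu => H.E u hu,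
      fun u hu => H.Einv hu, fun u hu => H.Γ₁_eq hu (hm u hu), fun u hu => H.Γ₂_eq hu (hm u hu)⟩,
    isBiFlatOn_model hS hF ?_⟩
  · rintro ⟨u, hu, h⟩
    exact zCoord_ne_zero (hne u hu) (H.mem u hu).2.2.2 h
  · obtain ⟨a, b, c, d⟩ := H.mem u hu
    exact ⟨a, b, c, d, u, hu, rfl⟩
  · rintro _ ⟨u, hu, rfl⟩
    refine systemAt_of_curvature_eq_zero (hne u hu) (hF.diffAt hS ⟨u, hu, rfl⟩) fun k l i j => ?_
    rw [← curvature_congr H.isOpen (fun v hv => H.Γ₁_eq hv (hm v hv)) hu]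
    exact H.isBiFlatOn.flat₁.flat u hu k l i j

end Descent

/-! ### First-order consequences of the Hertling–Manin condition in one tangent space -/

section Jets

variable {A : Type*} [CommRing A]

/-- The Hertling–Manin condition at a point, where the multiplication of the ring `A` is the
product of tangent vectors and `D v p q` is the derivative of `p ∘ q` in the direction `v`. -/
def HertlingManinAt (D : A → A → A → A) : Prop :=
  ∀ a b p q, D (a * b) p q - D (p * q) a b + D p a b * q + p * D q a b = a * D b p q + b * D a p q

/-- The product is invariant under the flow of an idempotent vector field. -/
theorem lieDerivative_idempotent {D : A → A → A → A} (hHM : HertlingManinAt D) {P : A}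
    (hP : P * P = P) {DP : A → A} (hDP : ∀ v, D v P P + 2 * P * DP v = DP v) (p q : A) :
    D P p q - DP (p * q) + DP p * q + p * DP q = 0 := by
  have h := hHM P P p q
  rw [hP] at h
  have e : ∀ v, D v P P = DP v - 2 * P * DP v := fun v => by linear_combination hDP v
  rw [e, e, e] at h
  -- The condition with both first arguments equal to P says that the claim holds after
  -- multiplication by 1 - 2P, and (1 - 2P)² = 1.
  linear_combination (1 - 2 * P) * h
    - 4 * (D P p q - DP (p * q) + DP p * q + p * DP q) * hP

/-- If `E` is an eventual identity with `[e, E] = e`, the Lie derivative of the product along `E`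
is the product. -/
theorem lieDerivative_euler {D D' : A → A → A → A} {E i : A} {D1 DE DI : A → A}
    (hEi : E * i = 1) (hunit : ∀ v q, D v 1 q + D1 v * q = 0)
    (hsymm : ∀ v p q, D v p q = D v q p)
    (hD' : ∀ v p q, D' v p q = D v i (p * q) + DI v * (p * q) + i * D v p q)
    (hunit' : ∀ v q, D' v E q + DE v * q * i = 0)
    (hHM' : ∀ a b p q, D' (i * (a * b)) p q - D' (i * (p * q)) a b + i * (D' p a b * q)
      + i * (p * D' q a b) = i * (a * D' b p q) + i * (b * D' a p q))
    (heuler : DE 1 - D1 E = 1) (p q : A) :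
    D E p q - DE (p * q) + DE p * q + p * DE q = p * q := by
  have hEE : i * (E * E) = E := by linear_combination E * hEi
  -- E is the unit of the dual product; inserting it twice into the Hertling–Manin condition gives
  -- L_E(*) = 0.
  have hstar : ∀ p q, D' E p q - DE (i * (p * q)) + i * (DE p * q) + i * (p * DE q) = 0 := by
    intro p q
    have h := hHM' E E p q
    rw [hEE] at h
    have e : ∀ v, D' v E E = -DE v := fun v => by linear_combination hunit' v E - DE v * hEi
    rw [e, e, e] at h
    linear_combination -h - 2 * D' E p q * hEi
  set κ := DI E - DE i with hκ
  have hL : ∀ p q, (D E i (p * q) - DE (i * (p * q)) + DE i * (p * q) + i * DE (p * q))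
      + i * (D E p q - DE (p * q) + DE p * q + p * DE q) + κ * (p * q) = 0 := fun p q => by
    have h1 := hstar p q
    rw [hD'] at h1
    linear_combination h1
  have h1 : ∀ p, D E p 1 - DE (p * 1) + DE p * 1 + p * DE 1 = p := fun p => by
    rw [hsymm, mul_one]
    linear_combination hunit E p + p * heuler
  -- For q = 1 the relation `hL` evaluates the terms that differentiate the product with i = E⁻¹.
  -- Subtracting this at pq from the general `hL` leaves i times the claim, and i is invertible.
  have h2 : ∀ p, (D E i p - DE (i * p) + DE i * p + i * DE p) + i * p + κ * p = 0 := fun p => by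
    have := hL p 1
    rw [h1, mul_one] at this
    linear_combination this
  have h3 := hL p q
  have h4 := h2 (p * q)
  linear_combination E * h3 - E * h4
    - (D E p q - DE (p * q) + DE p * q + p * DE q - p * q) * hEi

variable {𝕜 : Type*} [Field 𝕜] [CharZero 𝕜] [Algebra 𝕜 A]

/-- The brackets of the frame of idempotents and the nilpotent part of `E`, and the derivatives of
the eigenvalues of `E`. -/
theorem frame_relations {D : A → A → A → A} (hHM : HertlingManinAt D)
    {E P R N : A} {μ ν : 𝕜} {dμ dν : A →ₗ[𝕜] 𝕜} {DE : A → A} {DP DR DN : A →ₗ[𝕜] A}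
    (hLE : ∀ p q, D E p q - DE (p * q) + DE p * q + p * DE q = p * q)
    (hPP : P * P = P) (hRR : R * R = R) (hPR : P + R = 1) (hPN : P * N = N) (hNN : N * N = 0)
    (hE : E = μ • P + N + ν • R) (hN : N ≠ 0) (hR : R ≠ 0)
    (jPP : ∀ v, D v P P + DP v * P + P * DP v = DP v)
    (jRR : ∀ v, D v R R + DR v * R + R * DR v = DR v)
    (jPR : ∀ v, D v P R + DP v * R + P * DR v = 0)
    (jPN : ∀ v, D v P N + DP v * N + P * DN v = DN v)
    (jNN : ∀ v, D v N N + DN v * N + N * DN v = 0)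
    (jE : ∀ v, DE v = dμ v • P + μ • DP v + DN v + (dν v • R + ν • DR v)) :
    (dμ P = 1 ∧ dμ N = 0 ∧ dμ R = 0) ∧ (dν P = 0 ∧ dν N = 0 ∧ dν R = 1) ∧
      DN P = DP N ∧ DR P = DP R ∧ DN R = DR N := by
  have hPR0 : P * R = 0 := by linear_combination P * hPR - hPP
  have hRN : R * N = 0 := by linear_combination N * hPR - hPN
  have hReq : R = 1 - P := by linear_combination hPR
  have LP := lieDerivative_idempotent hHM hPP (DP := DP) fun v => by linear_combination jPP v
  have LR := lieDerivative_idempotent hHM hRR (DP := DR) fun v => by linear_combination jRR v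
  have two : ∀ x : A, 2 * x = 0 → x = 0 := fun x hx => by
    have : (2 : 𝕜) • x = 0 := by rw [two_smul, ← two_mul]; exact hx
    exact (smul_eq_zero.1 this).resolve_left two_ne_zero
  have smN : ∀ a : 𝕜, algebraMap 𝕜 A a * N = 0 → a = 0 := fun a h => by
    rw [← Algebra.smul_def] at h
    exact (smul_eq_zero.1 h).resolve_right hN
  have smR : ∀ a : 𝕜, algebraMap 𝕜 A a * R = 0 → a = 0 := fun a h => by
    rw [← Algebra.smul_def] at h
    exact (smul_eq_zero.1 h).resolve_right hR
  -- `[P, R] = 0`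
  have b1 : DR P = DP R := by
    have h1 := LP P R
    have h2 := LR P R
    rw [hPR0, map_zero] at h1 h2
    have e1 := jPR P
    have e2 := jPR R
    linear_combination (DP R - DR P) * hPR + e1 - h1 - e2 + h2
  -- `[P, N]`
  have h3 := LP P N
  rw [hPN] at h3
  have c1 : DN P - DP N = P * (DN P - DP N) := by linear_combination h3 - jPN P
  have h4 := LP N N
  rw [hNN, map_zero] at h4
  have c2 : N * (DN P - DP N) = 0 := two _ (by linear_combination jNN P - h4)
  -- `[R, N]`
  have h5 := LR P N
  rw [hPN] at h5
  have c3 : DN R - DR N = P * (DN R - DR N) := by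
    linear_combination h5 - jPN R - N * b1
  have h6 := LR N N
  rw [hNN, map_zero] at h6
  have c4 : N * (DN R - DR N) = 0 := two _ (by linear_combination jNN R - h6)
  simp only [Algebra.smul_def] at hE jE
  set m := algebraMap 𝕜 A μ
  set n := algebraMap 𝕜 A ν
  have DPE : DP E = m * DP P + DP N + n * DP R := by
    rw [hE, map_add, map_add]
    simp only [m, n, ← Algebra.smul_def, map_smul]
  have DRE : DR E = m * DR P + DR N + n * DR R := by
    rw [hE, map_add, map_add]
    simp only [m, n, ← Algebra.smul_def, map_smul]
  have DNE : DN E = m * DN P + DN N + n * DN R := by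
    rw [hE, map_add, map_add]
    simp only [m, n, ← Algebra.smul_def, map_smul]
  have hDE0 : DE 0 = 0 := by rw [jE]; simp only [map_zero]; ring
  -- `[P, E] = P`
  have d1 : DE P - DP E = P := by
    have h := hLE P P
    rw [hPP] at h
    have e := jPP E
    have k : (1 - 2 * P) * (DP E - DE P) = P := by linear_combination h - e
    linear_combination -(1 - 2 * P) * k - (4 * (DE P - DP E) - 2) * hPP
  have d2 : DE R - DR E = R := by
    have h := hLE R R
    rw [hRR] at h
    have e := jRR E
    have k : (1 - 2 * R) * (DR E - DE R) = R := by linear_combination h - e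
    linear_combination -(1 - 2 * R) * k - (4 * (DE R - DR E) - 2) * hRR
  rw [jE, DPE] at d1
  rw [jE, DRE] at d2
  -- This is [P, E] = P expanded by E = μP + N + νR. Since [P, N] = P[P, N] and N[P, N] = 0,
  -- multiplying by R isolates the derivative of ν and multiplying by N that of μ; what remains is
  -- [P, N] = 0. The same argument is used for R.
  have e1 : algebraMap 𝕜 A (dμ P) * P + (DN P - DP N) + algebraMap 𝕜 A (dν P) * R = P := by
    linear_combination d1 - n * b1
  have e2 : algebraMap 𝕜 A (dμ R) * P + (DN R - DR N) + algebraMap 𝕜 A (dν R) * R = R := by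
    linear_combination d2 + m * b1
  have f1 : dν P = 0 := smR _ (by
    linear_combination R * e1 - (algebraMap 𝕜 A (dν P)) * hRR
      - (algebraMap 𝕜 A (dμ P) - 1) * hPR0 - R * c1 - (DN P - DP N) * hPR0)
  have f2 : dμ P = 1 := by
    have : dμ P - 1 = 0 := smN _ (by
      rw [map_sub, map_one]
      linear_combination N * e1 - c2 - (algebraMap 𝕜 A (dμ P) - 1) * hPN
        - algebraMap 𝕜 A (dν P) * hRN)
    linear_combination this
  have f3 : dμ R = 0 := smN _ (by
    linear_combination N * e2 - c4 - algebraMap 𝕜 A (dμ R) * hPN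
      - (algebraMap 𝕜 A (dν R) - 1) * hRN)
  have f4 : dν R = 1 := by
    have : dν R - 1 = 0 := smR _ (by
      rw [map_sub, map_one]
      linear_combination R * e2 - (algebraMap 𝕜 A (dν R) - 1) * hRR
        - (algebraMap 𝕜 A (dμ R)) * hPR0 - R * c3 - (DN R - DR N) * hPR0)
    linear_combination this
  have g1 : DN P = DP N := by
    rw [f2, f1, map_one, map_zero] at e1
    linear_combination e1
  have g2 : DN R = DR N := by
    rw [f3, f4, map_one, map_zero] at e2
    linear_combination e2
  -- The bracket of E and N has only P and R parts; L_E(∘) = ∘, applied to P∘N = N and N∘N = 0,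
  -- shows that R and N annihilate it.
  have hEN : DN E - DE N = -(algebraMap 𝕜 A (dμ N) * P) - algebraMap 𝕜 A (dν N) * R := by
    rw [jE, DNE]
    linear_combination m * g1 + n * g2
  have h7 := hLE P N
  rw [hPN] at h7
  have h8 := hLE N N
  rw [hNN, hDE0] at h8
  have hdP : DP E = DE P - P := by rw [DPE, jE]; linear_combination -d1
  have k1 : R * (DN E - DE N) = 0 := by
    have := jPN E
    rw [hdP] at this
    rw [hReq]
    linear_combination h7 - this - hPN
  have f5 : dν N = 0 := smR _ (by
    rw [hEN] at k1
    linear_combination -k1 - algebraMap 𝕜 A (dμ N) * hPR0 - algebraMap 𝕜 A (dν N) * hRR)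
  have f6 : dμ N = 0 := by
    have k2 : N * (DN E - DE N) = 0 := two _ (by linear_combination jNN E - h8)
    rw [hEN] at k2
    exact smN _ (by
      linear_combination -k2 - algebraMap 𝕜 A (dμ N) * hPN - algebraMap 𝕜 A (dν N) * hRN)
  exact ⟨⟨f2, f6, f3⟩, ⟨f1, f5, f4⟩, g1, b1, g2⟩

end Jets

/-! ### Tangent spaces as commutative rings -/

section RingOfMul

variable {𝕜 : Type*} [Field 𝕜] {V : Type*} [AddCommGroup V] [Module 𝕜 V]

/-- A commutative associative bilinear product with unit `e`. -/
structure IsUnitalProduct (m : V →ₗ[𝕜] V →ₗ[𝕜] V) (e : V) : Prop where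
  comm : ∀ p q, m p q = m q p
  assoc : ∀ p q r, m (m p q) r = m p (m q r)
  unit : ∀ p, m e p = p

/-- The ring given by a commutative associative bilinear product. -/
@[reducible] def IsUnitalProduct.commRing {m : V →ₗ[𝕜] V →ₗ[𝕜] V} {e : V}
    (h : IsUnitalProduct m e) : CommRing V :=
  { ‹AddCommGroup V› with
    mul := fun p q => m p q
    one := e
    left_distrib := fun p q r => map_add (m p) q r
    right_distrib := fun p q r => by
      change m (p + q) r = m p r + m q r
      rw [map_add, LinearMap.add_apply]
    zero_mul := fun p => by
      change m 0 p = 0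
      rw [map_zero, LinearMap.zero_apply]
    mul_zero := fun p => map_zero (m p)
    mul_assoc := h.assoc
    one_mul := h.unit
    mul_one := fun p => (h.comm p e).trans (h.unit p)
    mul_comm := h.comm }

/-- A tangent space has no product of its own as a type; the ring structure is installed locally so
that the computation in rings applies to the bilinear map m. -/
theorem lieDerivative_euler_of_mul {m : V →ₗ[𝕜] V →ₗ[𝕜] V} {e : V} (hm : IsUnitalProduct m e)
    {D D' : V → V → V → V} {E i : V} {D1 DE DI : V → V}
    (hEi : m E i = e) (hunit : ∀ v q, D v e q + m (D1 v) q = 0)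
    (hsymm : ∀ v p q, D v p q = D v q p)
    (hD' : ∀ v p q, D' v p q = D v i (m p q) + m (DI v) (m p q) + m i (D v p q))
    (hunit' : ∀ v q, D' v E q + m (m (DE v) q) i = 0)
    (hHM' : ∀ a b p q, D' (m i (m a b)) p q - D' (m i (m p q)) a b + m i (m (D' p a b) q)
      + m i (m p (D' q a b)) = m i (m a (D' b p q)) + m i (m b (D' a p q)))
    (heuler : DE e - D1 E = e) (p q : V) :
    D E p q - DE (m p q) + m (DE p) q + m p (DE q) = m p q :=
  letI := hm.commRing
  lieDerivative_euler (A := V) hEi hunit hsymm hD' hunit' hHM' heuler p q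

theorem frame_relations_of_mul [CharZero 𝕜] {m : V →ₗ[𝕜] V →ₗ[𝕜] V} {e : V}
    (hm : IsUnitalProduct m e)
    {D : V → V → V → V}
    (hHM : ∀ a b p q, D (m a b) p q - D (m p q) a b + m (D p a b) q + m p (D q a b)
      = m a (D b p q) + m b (D a p q))
    {E P R N : V} {μ ν : 𝕜} {dμ dν : V →ₗ[𝕜] 𝕜} {DE : V → V} {DP DR DN : V →ₗ[𝕜] V}
    (hLE : ∀ p q, D E p q - DE (m p q) + m (DE p) q + m p (DE q) = m p q)
    (hPP : m P P = P) (hRR : m R R = R) (hPR : P + R = e) (hPN : m P N = N) (hNN : m N N = 0)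
    (hE : E = μ • P + N + ν • R) (hN : N ≠ 0) (hR : R ≠ 0)
    (jPP : ∀ v, D v P P + m (DP v) P + m P (DP v) = DP v)
    (jRR : ∀ v, D v R R + m (DR v) R + m R (DR v) = DR v)
    (jPR : ∀ v, D v P R + m (DP v) R + m P (DR v) = 0)
    (jPN : ∀ v, D v P N + m (DP v) N + m P (DN v) = DN v)
    (jNN : ∀ v, D v N N + m (DN v) N + m N (DN v) = 0)
    (jE : ∀ v, DE v = dμ v • P + μ • DP v + DN v + (dν v • R + ν • DR v)) :
    (dμ P = 1 ∧ dμ N = 0 ∧ dμ R = 0) ∧ (dν P = 0 ∧ dν N = 0 ∧ dν R = 1) ∧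
      DN P = DP N ∧ DR P = DP R ∧ DN R = DR N :=
  letI := hm.commRing
  letI : Algebra 𝕜 V := Algebra.ofModule (fun a p q => by
    change m (a • p) q = a • m p q
    rw [map_smul, LinearMap.smul_apply]) (fun a p q => map_smul (m p) a q)
  frame_relations (A := V) hHM hLE hPP hRR hPR hPN hNN hE hN hR jPP jRR jPR jPN jNN jE

end RingOfMul

/-! ### Products of vector fields and their derivatives -/

section ProductField

variable {𝕜 : Type*} [RCLike 𝕜] {n : ℕ}

/-- The bilinear product of tangent vectors with components `T`. -/
def mulL (T : Fin n → Fin n → Fin n → 𝕜) :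
    (Fin n → 𝕜) →ₗ[𝕜] (Fin n → 𝕜) →ₗ[𝕜] (Fin n → 𝕜) :=
  LinearMap.mk₂ 𝕜 (fun p q i => ∑ j, ∑ k, T i j k * p j * q k)
    (fun p p' q => by ext i; simp [mul_add, add_mul, Finset.sum_add_distrib])
    (fun a p q => by
      ext i; simp only [Pi.smul_apply, smul_eq_mul, Finset.mul_sum]
      exact Finset.sum_congr rfl fun j _ => Finset.sum_congr rfl fun k _ => by ring)
    (fun p q q' => by ext i; simp [mul_add, Finset.sum_add_distrib])
    (fun a p q => by
      ext i; simp only [Pi.smul_apply, smul_eq_mul, Finset.mul_sum]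
      exact Finset.sum_congr rfl fun j _ => Finset.sum_congr rfl fun k _ => by ring)

theorem mulL_apply (T : Fin n → Fin n → Fin n → 𝕜) (p q : Fin n → 𝕜) (i : Fin n) :
    mulL T p q i = ∑ j, ∑ k, T i j k * p j * q k := rfl

theorem mulL_single_right (T : Fin n → Fin n → Fin n → 𝕜) (p : Fin n → 𝕜) (q i : Fin n) :
    mulL T p (Pi.single q 1) i = ∑ j, T i j q * p j := by
  simp [mulL_apply, Pi.single_apply]

theorem mulL_single_left (T : Fin n → Fin n → Fin n → 𝕜) (p : Fin n) (q : Fin n → 𝕜) (i : Fin n) :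
    mulL T (Pi.single p 1) q i = ∑ k, T i p k * q k := by
  simp only [mulL_apply, Pi.single_apply]
  rw [Finset.sum_eq_single p]
  · simp
  · intro j _ hj; simp [hj]
  · simp

theorem mulL_single_single (T : Fin n → Fin n → Fin n → 𝕜) (p q i : Fin n) :
    mulL T (Pi.single p 1) (Pi.single q 1) i = T i p q := by
  rw [mulL_single_left]; simp [Pi.single_apply]

/-- The derivative of the product with components `c`. -/
def dMul (c : Comp 𝕜 n) (u : Fin n → 𝕜) :
    (Fin n → 𝕜) →ₗ[𝕜] (Fin n → 𝕜) →ₗ[𝕜] (Fin n → 𝕜) →ₗ[𝕜] (Fin n → 𝕜) where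
  toFun v := mulL fun i j k => fderiv 𝕜 (fun w => c w i j k) u v
  map_add' v w := by
    ext p q i
    simp [mulL_apply, add_mul, Finset.sum_add_distrib]
  map_smul' a v := by
    ext p q i
    simp only [map_smul, smul_eq_mul, LinearMap.smul_apply, RingHom.id_apply, LinearMap.comp_apply,
      LinearMap.coe_single, Pi.smul_apply, mulL_apply, Finset.mul_sum]
    exact Finset.sum_congr rfl fun j _ => Finset.sum_congr rfl fun k _ => by ring

theorem dMul_apply (c : Comp 𝕜 n) (u v : Fin n → 𝕜) :
    dMul c u v = mulL fun i j k => fderiv 𝕜 (fun w => c w i j k) u v := rfl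

theorem dMul_single (c : Comp 𝕜 n) (u : Fin n → 𝕜) (s p q i : Fin n) :
    dMul c u (Pi.single s 1) (Pi.single p 1) (Pi.single q 1) i = pd s (fun w => c w i p q) u := by
  rw [dMul_apply, mulL_single_single, pd]

theorem pi_single_induction {P : (Fin n → 𝕜) → Prop} (zero : P 0)
    (add : ∀ v w, P v → P w → P (v + w)) (smul : ∀ (a : 𝕜) v, P v → P (a • v))
    (single : ∀ i, P (Pi.single i 1)) (v : Fin n → 𝕜) : P v := by
  rw [pi_eq_sum_univ' v]
  exact Finset.sum_induction _ P add zero fun i _ => smul _ _ (single i)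

theorem hasFDerivAt_mulL {c : Comp 𝕜 n} {X Y : (Fin n → 𝕜) → Fin n → 𝕜} {u : Fin n → 𝕜}
    (hc : ∀ i j k, DifferentiableAt 𝕜 (fun w => c w i j k) u) (hX : DifferentiableAt 𝕜 X u)
    (hY : DifferentiableAt 𝕜 Y u) :
    DifferentiableAt 𝕜 (fun w => mulL (c w) (X w) (Y w)) u ∧
    ∀ v, fderiv 𝕜 (fun w => mulL (c w) (X w) (Y w)) u v
      = dMul c u v (X u) (Y u) + mulL (c u) (fderiv 𝕜 X u v) (Y u)
        + mulL (c u) (X u) (fderiv 𝕜 Y u v) := by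
  have hXi : ∀ i, HasFDerivAt (fun w => X w i)
      ((ContinuousLinearMap.proj (R := 𝕜) (φ := fun _ : Fin n => 𝕜) i).comp (fderiv 𝕜 X u)) u :=
    fun i => (hasFDerivAt_pi'.1 hX.hasFDerivAt) i
  have hYi : ∀ i, HasFDerivAt (fun w => Y w i)
      ((ContinuousLinearMap.proj (R := 𝕜) (φ := fun _ : Fin n => 𝕜) i).comp (fderiv 𝕜 Y u)) u :=
    fun i => (hasFDerivAt_pi'.1 hY.hasFDerivAt) i
  have key : ∀ i, HasFDerivAt (fun w => mulL (c w) (X w) (Y w) i) _ u := fun i =>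
    HasFDerivAt.fun_sum (u := Finset.univ) fun j _ => HasFDerivAt.fun_sum (u := Finset.univ)
      fun k _ => ((hc i j k).hasFDerivAt.mul (hXi j)).mul (hYi k)
  have hd : HasFDerivAt (fun w => mulL (c w) (X w) (Y w))
      (ContinuousLinearMap.pi fun i => fderiv 𝕜 (fun w => mulL (c w) (X w) (Y w) i) u) u :=
    hasFDerivAt_pi.2 fun i => (key i).differentiableAt.hasFDerivAt
  refine ⟨hd.differentiableAt, fun v => ?_⟩
  rw [hd.fderiv]
  ext i
  rw [ContinuousLinearMap.pi_apply, (key i).fderiv]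
  simp only [sum_apply, Pi.add_apply, dMul_apply, mulL_apply,
    ← Finset.sum_add_distrib]
  refine Finset.sum_congr rfl fun j _ => Finset.sum_congr rfl fun k _ => ?_
  simp
  ring

variable {c : Comp 𝕜 n} {e : (Fin n → 𝕜) → Fin n → 𝕜} {Ω : Set (Fin n → 𝕜)} {u : Fin n → 𝕜}

theorem IsFManifoldOn.isUnitalProduct (h : IsFManifoldOn c e Ω) (hu : u ∈ Ω) :
    IsUnitalProduct (mulL (c u)) (e u) where
  comm p q := by
    ext i
    rw [mulL_apply, mulL_apply, Finset.sum_comm]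
    refine Finset.sum_congr rfl fun j _ => Finset.sum_congr rfl fun k _ => ?_
    rw [h.comm u hu]; ring
  assoc := by
    refine pi_single_induction ?_ ?_ ?_ fun a => ?_
    · simp
    · intro v w hv hw q r; simp only [map_add, LinearMap.add_apply, hv, hw]
    · intro a v hv q r; simp only [map_smul, LinearMap.smul_apply, hv]
    refine pi_single_induction ?_ ?_ ?_ fun b => ?_
    · simp
    · intro v w hv hw r; simp only [map_add, LinearMap.add_apply, hv, hw]
    · intro a v hv r; simp only [map_smul, LinearMap.smul_apply, hv]
    refine pi_single_induction ?_ ?_ ?_ fun r => ?_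
    · simp
    · intro v w hv hw; simp only [map_add, hv, hw]
    · intro a v hv; simp only [map_smul, hv]
    ext i
    rw [mulL_single_right, mulL_single_left]
    simp only [mulL_single_single]
    have := h.assoc u hu i r a b
    rw [Finset.sum_congr rfl fun s _ => by rw [h.comm u hu i s r]]
    rw [this]
    exact Finset.sum_congr rfl fun s _ => by rw [h.comm u hu s r b]
  unit p := by
    ext i
    rw [mulL_apply]
    have : ∀ j k, c u i j k * e u j * p k = (c u i j k * e u j) * p k := fun _ _ => rfl
    rw [Finset.sum_comm]
    simp only [← Finset.sum_mul, h.unit u hu]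
    simp

/-- Every term is linear in each of a, b, p, q, so the component form on coordinate vectors
suffices. -/
theorem IsFManifoldOn.hertlingManin_mulL (h : IsFManifoldOn c e Ω) (hu : u ∈ Ω) :
    ∀ a b p q, dMul c u (mulL (c u) a b) p q - dMul c u (mulL (c u) p q) a b
        + mulL (c u) (dMul c u p a b) q + mulL (c u) p (dMul c u q a b)
      = mulL (c u) a (dMul c u b p q) + mulL (c u) b (dMul c u a p q) := by
  refine pi_single_induction ?_ ?_ ?_ fun a => ?_
  · intro b p q; simp
  · intro v w hv hw b p q
    have := congrArg₂ (· + ·) (hv b p q) (hw b p q)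
    simp only [map_add, LinearMap.add_apply] at this ⊢
    linear_combination (exp := 1) this
  · intro x v hv b p q
    have := congrArg (x • ·) (hv b p q)
    simp only [map_smul, LinearMap.smul_apply, smul_add, smul_sub] at this ⊢
    exact this
  refine pi_single_induction ?_ ?_ ?_ fun b => ?_
  · intro p q; simp
  · intro v w hv hw p q
    have := congrArg₂ (· + ·) (hv p q) (hw p q)
    simp only [map_add, LinearMap.add_apply] at this ⊢
    linear_combination (exp := 1) this
  · intro x v hv p q
    have := congrArg (x • ·) (hv p q)
    simp only [map_smul, LinearMap.smul_apply, smul_add, smul_sub] at this ⊢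
    exact this
  refine pi_single_induction ?_ ?_ ?_ fun p => ?_
  · intro q; simp
  · intro v w hv hw q
    have := congrArg₂ (· + ·) (hv q) (hw q)
    simp only [map_add, LinearMap.add_apply] at this ⊢
    linear_combination (exp := 1) this
  · intro x v hv q
    have := congrArg (x • ·) (hv q)
    simp only [map_smul, LinearMap.smul_apply, smul_add, smul_sub] at this ⊢
    exact this
  refine pi_single_induction ?_ ?_ ?_ fun q => ?_
  · simp
  · intro v w hv hw
    have := congrArg₂ (· + ·) hv hw
    simp only [map_add, LinearMap.add_apply] at this ⊢
    linear_combination (exp := 1) this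
  · intro x v hv
    have := congrArg (x • ·) hv
    simp only [map_smul, LinearMap.smul_apply, smul_add, smul_sub] at this ⊢
    exact this
  ext k
  have hD : ∀ x y z w : Fin n, dMul c u (mulL (c u) (Pi.single x 1) (Pi.single y 1))
      (Pi.single z 1) (Pi.single w 1) k = ∑ s, c u s x y * pd s (fun v => c v k z w) u := by
    intro x y z w
    rw [dMul_apply, mulL_single_single]
    conv_lhs => rw [pi_eq_sum_univ' (mulL (c u) (Pi.single x 1) (Pi.single y 1))]
    rw [map_sum]
    refine Finset.sum_congr rfl fun s _ => ?_
    rw [map_smul, smul_eq_mul, mulL_single_single, pd]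
  have := h.hertlingManin u hu a b p q k
  simp only [Finset.sum_add_distrib, Finset.sum_sub_distrib] at this
  simp only [Pi.add_apply, Pi.sub_apply, hD, mulL_single_right, mulL_single_left, dMul_single]
  exact this

end ProductField

/-! ### The Lie derivative of the product along E -/

section EulerField

variable {𝕜 : Type*} [RCLike 𝕜] {n : ℕ} {Ω : Set (Fin n → 𝕜)} {u : Fin n → 𝕜}

theorem SmoothComp.differentiableAt {T : Comp 𝕜 n} (hT : SmoothComp T Ω) (hΩ : IsOpen Ω)
    (hu : u ∈ Ω) (i j k : Fin n) : DifferentiableAt 𝕜 (fun w => T w i j k) u :=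
  ((hT i j k).contDiffAt (hΩ.mem_nhds hu)).differentiableAt (by simp)

/-- Differentiating an identity `X ∘ Y = Z`. -/
theorem jet_of_mulL_eq {c : Comp 𝕜 n} {X Y Z : (Fin n → 𝕜) → Fin n → 𝕜} (hc : SmoothComp c Ω)
    (hΩ : IsOpen Ω) (hu : u ∈ Ω) (hX : DifferentiableAt 𝕜 X u) (hY : DifferentiableAt 𝕜 Y u)
    (h : ∀ w ∈ Ω, mulL (c w) (X w) (Y w) = Z w) (v : Fin n → 𝕜) :
    dMul c u v (X u) (Y u) + mulL (c u) (fderiv 𝕜 X u v) (Y u)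
      + mulL (c u) (X u) (fderiv 𝕜 Y u v) = fderiv 𝕜 Z u v := by
  rw [← (hasFDerivAt_mulL (hc.differentiableAt hΩ hu) hX hY).2 v]
  have : (fun w => mulL (c w) (X w) (Y w)) =ᶠ[𝓝 u] Z :=
    Filter.eventually_of_mem (hΩ.mem_nhds hu) h
  rw [this.fderiv_eq]

theorem mulL_dualProduct (c : Comp 𝕜 n) (i : (Fin n → 𝕜) → Fin n → 𝕜) (u p q : Fin n → 𝕜) :
    mulL (dualProduct c i u) p q = mulL (c u) (i u) (mulL (c u) p q) := by
  have key : ∀ a b, mulL (dualProduct c i u) (Pi.single a 1) (Pi.single b 1)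
      = mulL (c u) (i u) (mulL (c u) (Pi.single a 1) (Pi.single b 1)) := by
    intro a b
    ext k
    rw [mulL_single_single, mulL_apply]
    simp only [mulL_single_single, dualProduct]
  refine pi_single_induction (P := fun p => ∀ q, mulL (dualProduct c i u) p q
    = mulL (c u) (i u) (mulL (c u) p q)) ?_ ?_ ?_ ?_ p q
  · simp
  · intro v w hv hw q; simp only [map_add, LinearMap.add_apply, hv, hw]
  · intro a v hv q; simp only [map_smul, LinearMap.smul_apply, hv]
  intro a q
  refine pi_single_induction (P := fun q => mulL (dualProduct c i u) (Pi.single a 1) q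
    = mulL (c u) (i u) (mulL (c u) (Pi.single a 1) q)) ?_ ?_ ?_ ?_ q
  · simp
  · intro v w hv hw; simp only [map_add, hv, hw]
  · intro a v hv; simp only [map_smul, hv]
  exact key a

/-- The hypotheses of `lieDerivative_euler_of_mul` are the first derivatives of e∘q = q, of
commutativity, of p*q = E⁻¹∘(p∘q) and of E*q = q, together with the Hertling–Manin condition for *
and [e, E] = e. -/
theorem IsBiFlatOn.lieDerivative_E {D : BiFlatData 𝕜 n} (h : IsBiFlatOn D Ω) (hΩ : IsOpen Ω)
    (hu : u ∈ Ω) (p q : Fin n → 𝕜) :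
    dMul D.c u (D.E u) p q - fderiv 𝕜 D.E u (mulL (D.c u) p q)
      + mulL (D.c u) (fderiv 𝕜 D.E u p) q + mulL (D.c u) p (fderiv 𝕜 D.E u q)
      = mulL (D.c u) p q := by
  have hm := h.fManifold.isUnitalProduct hu
  have hc := h.fManifold.smooth_c
  have hdiff : ∀ {X : (Fin n → 𝕜) → Fin n → 𝕜}, ContDiffOn 𝕜 ∞ X Ω → DifferentiableAt 𝕜 X u :=
    fun hX => (hX.contDiffAt (hΩ.mem_nhds hu)).differentiableAt (by simp)
  have hstar : ∀ p q, mulL (D.cStar u) p q = mulL (D.c u) (D.Einv u) (mulL (D.c u) p q) :=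
    mulL_dualProduct _ _ u
  refine lieDerivative_euler_of_mul hm (D := fun v p q => dMul D.c u v p q)
    (D' := fun v p q => dMul D.cStar u v p q) (i := D.Einv u)
    (D1 := fderiv 𝕜 D.e u) (DE := fderiv 𝕜 D.E u) (DI := fderiv 𝕜 D.Einv u)
    ?_ ?_ ?_ ?_ ?_ ?_ ?_ p q
  · ext i
    rw [mulL_apply]; exact h.inverse u hu i
  · intro v q
    have := jet_of_mulL_eq hc hΩ hu (hdiff h.fManifold.smooth_e) (differentiableAt_const q)
      (fun w hw => (h.fManifold.isUnitalProduct hw).unit q) v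
    simpa using this
  · intro v p q
    have h1 := jet_of_mulL_eq hc hΩ hu (differentiableAt_const p) (differentiableAt_const q)
      (fun w hw => (h.fManifold.isUnitalProduct hw).comm p q) v
    have h2 := (hasFDerivAt_mulL (hc.differentiableAt hΩ hu) (differentiableAt_const q)
      (differentiableAt_const p)).2 v
    simpa [h2] using h1
  · intro v p q
    have h1 := jet_of_mulL_eq h.eventual.smooth_c hΩ hu (differentiableAt_const p)
      (differentiableAt_const q) (fun w hw => mulL_dualProduct _ _ w p q) v
    have h2 := hasFDerivAt_mulL (hc.differentiableAt hΩ hu) (differentiableAt_const p)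
      (differentiableAt_const q)
    have h3 := (hasFDerivAt_mulL (hc.differentiableAt hΩ hu) (hdiff h.smooth_Einv) h2.1).2 v
    rw [h3, h2.2] at h1
    simpa using h1
  · intro v q
    have := jet_of_mulL_eq h.eventual.smooth_c hΩ hu (hdiff h.smooth_E) (differentiableAt_const q)
      (fun w hw => (h.eventual.isUnitalProduct hw).unit q) v
    rw [hstar, hm.comm (D.Einv u)] at this
    simpa using this
  · intro a b p q
    have := h.eventual.hertlingManin_mulL hu a b p q
    simpa only [hstar] using this
  · exact h.euler u hu

end EulerField

/-! ### Idempotents and nilpotent part of E -/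

section JordanAlgebra

/-- The idempotents `P`, `R` and the nilpotent `N` of the decomposition `E = μ P + N + ν R`. -/
structure IsJordanFrame {𝕜 V : Type*} [Field 𝕜] [AddCommGroup V] [Module 𝕜 V]
    (m : V →ₗ[𝕜] V →ₗ[𝕜] V) (e E P N R : V) (μ ν : 𝕜) : Prop where
  ne : μ ≠ ν
  PP : m P P = P
  RR : m R R = R
  PR : P + R = e
  PN : m P N = N
  NN : m N N = 0
  E_eq : E = μ • P + N + ν • R
  N_ne : N ≠ 0
  R_ne : R ≠ 0

/-- X = E - μ sends p₁ to 0, p₂ to p₁ and p₃ to κp₃, where κ = ν - μ. As 1 is a combination of the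
p's, X³ = κX² in the ring itself. Hence R = X²/κ² is idempotent with XR = κR, and N = X - κR squares
to zero. Finally Np₂ = p₁ and Rp₃ = p₃ are nonzero. -/
theorem jordan_relations {𝕜 A : Type*} [Field 𝕜] [CommRing A] [Algebra 𝕜 A] {E p₁ p₂ p₃ : A}
    {μ ν a b c : 𝕜} (hμν : μ ≠ ν) (h₁ : E * p₁ = μ • p₁) (h₂ : E * p₂ = p₁ + μ • p₂)
    (h₃ : E * p₃ = ν • p₃) (h : 1 = a • p₁ + b • p₂ + c • p₃) (hp₁ : p₁ ≠ 0) (hp₃ : p₃ ≠ 0)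
    {P N R : A} (hR : R = ((ν - μ)⁻¹ ^ 2) • ((E - μ • (1 : A)) * (E - μ • (1 : A))))
    (hP : P = 1 - R) (hN : N = E - μ • (1 : A) - (ν - μ) • R) :
    P * P = P ∧ R * R = R ∧ P * N = N ∧ N * N = 0 ∧ E = μ • P + N + ν • R ∧ N ≠ 0 ∧ R ≠ 0 := by
  have hκ : ν - μ ≠ 0 := sub_ne_zero.2 hμν.symm
  obtain ⟨κ, hκdef⟩ : ∃ κ, κ = ν - μ := ⟨_, rfl⟩
  obtain ⟨X, hX⟩ : ∃ X, X = E - μ • (1 : A) := ⟨_, rfl⟩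
  obtain ⟨k, hk⟩ : ∃ k : A, k = algebraMap 𝕜 A κ := ⟨_, rfl⟩
  obtain ⟨l, hl⟩ : ∃ l : A, l = algebraMap 𝕜 A κ⁻¹ := ⟨_, rfl⟩
  have hkl : k * l = 1 := by rw [hk, hl, ← map_mul, hκdef, mul_inv_cancel₀ hκ, map_one]
  have x₁ : X * p₁ = 0 := by rw [hX, sub_mul, h₁, smul_mul_assoc, one_mul, sub_self]
  have x₂ : X * p₂ = p₁ := by rw [hX, sub_mul, h₂, smul_mul_assoc, one_mul, add_sub_cancel_right]
  have x₃ : X * p₃ = k * p₃ := by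
    rw [hX, sub_mul, h₃, smul_mul_assoc, one_mul, ← sub_smul, ← hκdef, hk, Algebra.smul_def]
  have cubic : X * X * X = k * (X * X) := by
    have h' : (1 : A) = algebraMap 𝕜 A a * p₁ + algebraMap 𝕜 A b * p₂ + algebraMap 𝕜 A c * p₃ := by
      simpa only [Algebra.smul_def] using h
    have : (X * X * X - k * (X * X)) * 1 = 0 := by
      rw [h']
      linear_combination ((X * X - k * X) * (algebraMap 𝕜 A a) + (X - k) * algebraMap 𝕜 A b) * x₁
        + (X * X - k * X) * algebraMap 𝕜 A b * x₂ + X * X * algebraMap 𝕜 A c * x₃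
    rwa [mul_one, sub_eq_zero] at this
  rw [← hX, ← hκdef, Algebra.smul_def, map_pow, ← hl] at hR
  rw [← hX, ← hκdef, Algebra.smul_def, ← hk] at hN
  have hRR : R * R = R := by
    rw [hR]
    linear_combination l ^ 4 * (X + k) * cubic + l ^ 2 * X ^ 2 * (k * l + 1) * hkl
  have hRN : R * N = 0 := by
    rw [hN]
    linear_combination X * hR - k * hRR + l ^ 2 * cubic - k * hR
  refine ⟨?_, hRR, ?_, ?_, ?_, ?_, ?_⟩
  · rw [hP]; linear_combination hRR
  · rw [hP]; linear_combination -hRN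
  · linear_combination N * hN + X * hN - k * hRN - k * X * hR - k * l ^ 2 * cubic
      - (k * l + 1) * X ^ 2 * hkl
  · rw [hP, hN, hk, hκdef, map_sub, Algebra.smul_def, Algebra.smul_def, hX, Algebra.smul_def]
    ring
  · intro h0
    apply hp₁
    have := congrArg (· * p₂) h0
    rw [hN, hR] at this
    linear_combination this - x₂ + k * l ^ 2 * X * x₂ + k * l ^ 2 * x₁
  · intro h0
    apply hp₃
    have := congrArg (· * p₃) h0
    rw [hR] at this
    linear_combination this - (k * l + 1) * p₃ * hkl - l ^ 2 * X * x₃ - l ^ 2 * k * x₃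

theorem IsUnitalProduct.isJordanFrame {𝕜 V : Type*} [Field 𝕜] [AddCommGroup V] [Module 𝕜 V]
    {m : V →ₗ[𝕜] V →ₗ[𝕜] V} {e : V} (hm : IsUnitalProduct m e) {E p₁ p₂ p₃ : V}
    {μ ν a b c : 𝕜} (hμν : μ ≠ ν) (h₁ : m E p₁ = μ • p₁) (h₂ : m E p₂ = p₁ + μ • p₂)
    (h₃ : m E p₃ = ν • p₃) (h : e = a • p₁ + b • p₂ + c • p₃) (hp₁ : p₁ ≠ 0) (hp₃ : p₃ ≠ 0)
    {P N R : V} (hR : R = ((ν - μ)⁻¹ ^ 2) • m (E - μ • e) (E - μ • e))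
    (hP : P = e - R) (hN : N = E - μ • e - (ν - μ) • R) :
    IsJordanFrame m e E P N R μ ν :=
  letI := hm.commRing
  letI : Algebra 𝕜 V := Algebra.ofModule (fun a p q => by
    change m (a • p) q = a • m p q
    rw [map_smul, LinearMap.smul_apply]) (fun a p q => map_smul (m p) a q)
  have H := jordan_relations (A := V) hμν h₁ h₂ h₃ h hp₁ hp₃ hR hP hN
  ⟨hμν, H.1, H.2.1, by rw [hP, sub_add_cancel], H.2.2.1, H.2.2.2.1, H.2.2.2.2.1, H.2.2.2.2.2.1,
    H.2.2.2.2.2.2⟩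

end JordanAlgebra

/-! ### Eigenvalues as rational functions of the matrix -/

section JordanMatrix

variable {𝕜 : Type*} [RCLike 𝕜]

/-- The sum of the two eigenvalues of a matrix with Jordan blocks of sizes two and one. -/
def eigSum (A : Matrix (Fin 3) (Fin 3) 𝕜) : 𝕜 :=
  (3 * (A * A * A).trace - A.trace * (A * A).trace) / (3 * (A * A).trace - A.trace ^ 2)

/-- The double eigenvalue of a matrix with Jordan blocks of sizes two and one. -/
def eigDouble (A : Matrix (Fin 3) (Fin 3) 𝕜) : 𝕜 := A.trace - eigSum A

/-- The simple eigenvalue of a matrix with Jordan blocks of sizes two and one. -/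
def eigSimple (A : Matrix (Fin 3) (Fin 3) 𝕜) : 𝕜 := 2 * eigSum A - A.trace

/-- With tₖ = tr Aᵏ one has 3t₂ - t₁² = 2(μ - ν)² and 3t₃ - t₁t₂ = 2(μ - ν)²(μ + ν), which explains
`eigSum`. Such formulas make the eigenvalues smooth functions of the point without any choice of
branches. -/
theorem eig_of_jordan {A P : Matrix (Fin 3) (Fin 3) 𝕜} {μ ν : 𝕜} (hμν : μ ≠ ν)
    (hP : IsUnit P.det) (h : A * P = P * !![μ, 1, 0; 0, μ, 0; 0, 0, ν]) :
    3 * (A * A).trace - A.trace ^ 2 ≠ 0 ∧ eigDouble A = μ ∧ eigSimple A = ν := by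
  obtain ⟨J, hJ⟩ : ∃ J : Matrix (Fin 3) (Fin 3) 𝕜, J = !![μ, 1, 0; 0, μ, 0; 0, 0, ν] := ⟨_, rfl⟩
  rw [← hJ] at h
  have tr : ∀ B K : Matrix (Fin 3) (Fin 3) 𝕜, B * P = P * K → B.trace = K.trace := by
    intro B K hBK
    have : B = P * K * P⁻¹ := by
      rw [← hBK, Matrix.mul_assoc, Matrix.mul_nonsing_inv _ hP, Matrix.mul_one]
    rw [this, Matrix.trace_mul_comm, ← Matrix.mul_assoc, Matrix.nonsing_inv_mul _ hP,
      Matrix.one_mul]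
  have hh2 : A * A * P = P * (J * J) := by
    rw [Matrix.mul_assoc, h, ← Matrix.mul_assoc, h, Matrix.mul_assoc]
  have hh3 : A * A * A * P = P * (J * J * J) := by
    rw [Matrix.mul_assoc, h, ← Matrix.mul_assoc, hh2, Matrix.mul_assoc]
  have t1 : A.trace = 2 * μ + ν := by
    rw [tr _ _ h, hJ]; simp [Matrix.trace, Fin.sum_univ_three]; ring
  have t2 : (A * A).trace = 2 * μ ^ 2 + ν ^ 2 := by
    rw [tr _ _ hh2, hJ]; simp [Matrix.trace, Fin.sum_univ_three]; ring
  have t3 : (A * A * A).trace = 2 * μ ^ 3 + ν ^ 3 := by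
    rw [tr _ _ hh3, hJ]; simp [Matrix.trace, Fin.sum_univ_three]; ring
  have hne : 3 * (A * A).trace - A.trace ^ 2 ≠ 0 := by
    have : 3 * (A * A).trace - A.trace ^ 2 = 2 * (μ - ν) ^ 2 := by rw [t1, t2]; ring
    rw [this]
    exact mul_ne_zero two_ne_zero (pow_ne_zero 2 (sub_ne_zero.2 hμν))
  have hs : eigSum A = μ + ν := by
    rw [eigSum, div_eq_iff hne, t1, t2, t3]; ring
  refine ⟨hne, ?_, ?_⟩
  · rw [eigDouble, hs, t1]; ring
  · rw [eigSimple, hs, t1]; ring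

end JordanMatrix

/-! ### The fields P, N, R and their smoothness -/

section FrameFields

variable {𝕜 : Type*} [RCLike 𝕜]

/-- The double eigenvalue of `L`. -/
def BiFlatData.μ (D : BiFlatData 𝕜 3) (u : Fin 3 → 𝕜) : 𝕜 := eigDouble (D.L u)

/-- The simple eigenvalue of `L`. -/
def BiFlatData.ν (D : BiFlatData 𝕜 3) (u : Fin 3 → 𝕜) : 𝕜 := eigSimple (D.L u)

/-- The idempotent belonging to the simple eigenvalue of `L`. -/
def BiFlatData.R (D : BiFlatData 𝕜 3) (u : Fin 3 → 𝕜) : Fin 3 → 𝕜 :=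
  ((D.ν u - D.μ u)⁻¹ ^ 2) • mulL (D.c u) (D.E u - D.μ u • D.e u) (D.E u - D.μ u • D.e u)

/-- The idempotent belonging to the double eigenvalue of `L`. -/
def BiFlatData.P (D : BiFlatData 𝕜 3) (u : Fin 3 → 𝕜) : Fin 3 → 𝕜 := D.e u - D.R u

/-- The nilpotent part of `E`. -/
def BiFlatData.N (D : BiFlatData 𝕜 3) (u : Fin 3 → 𝕜) : Fin 3 → 𝕜 :=
  D.E u - D.μ u • D.e u - (D.ν u - D.μ u) • D.R u

theorem BiFlatData.L_mulVec (D : BiFlatData 𝕜 3) (u p : Fin 3 → 𝕜) :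
    (D.L u).mulVec p = mulL (D.c u) (D.E u) p := by
  ext i
  simp only [Matrix.mulVec, dotProduct, BiFlatData.L, Matrix.of_apply, mulBy, mulL_apply,
    Finset.sum_mul]
  rw [Finset.sum_comm]

variable {Ω : Set (Fin 3 → 𝕜)} {u : Fin 3 → 𝕜} {D : BiFlatData 𝕜 3}

theorem IsBiFlatOn.isJordanFrame (h : IsBiFlatOn D Ω) (hu : u ∈ Ω)
    (hJ : HasJordanTypeTwoOne (D.L u)) :
    IsJordanFrame (mulL (D.c u)) (D.e u) (D.E u) (D.P u) (D.N u) (D.R u) (D.μ u) (D.ν u) := by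
  obtain ⟨μ, ν, P, hμν, hP, hA⟩ := hJ
  obtain ⟨-, hμ, hν⟩ := eig_of_jordan hμν hP hA
  have col : ∀ j : Fin 3, mulL (D.c u) (D.E u) (P.col j)
      = (P * !![μ, 1, 0; 0, μ, 0; 0, 0, ν]).col j := by
    intro j
    rw [← hA, ← D.L_mulVec]; rfl
  have hcol : ∀ j, P.col j ≠ 0 := by
    intro j hj
    exact hP.ne_zero (Matrix.det_eq_zero_of_column_eq_zero j fun i => congrFun hj i)
  have hμ' : D.μ u = μ := hμ
  have hν' : D.ν u = ν := hν
  refine (h.fManifold.isUnitalProduct hu).isJordanFrame (p₁ := P.col 0) (p₂ := P.col 1)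
    (p₃ := P.col 2) (a := (P⁻¹.mulVec (D.e u)) 0) (b := (P⁻¹.mulVec (D.e u)) 1)
    (c := (P⁻¹.mulVec (D.e u)) 2) (by rwa [hμ', hν']) ?_ ?_ ?_ ?_ (hcol 0) (hcol 2) rfl rfl rfl
  · rw [col, hμ']; ext i; simp [Matrix.mul_apply, Fin.sum_univ_three, mul_comm]
  · rw [col, hμ']; ext i; simp [Matrix.mul_apply, Fin.sum_univ_three, mul_comm]
  · rw [col, hν']; ext i; simp [Matrix.mul_apply, Fin.sum_univ_three, mul_comm]
  · have : D.e u = P.mulVec (P⁻¹.mulVec (D.e u)) := by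
      rw [Matrix.mulVec_mulVec, Matrix.mul_nonsing_inv _ hP, Matrix.one_mulVec]
    conv_lhs => rw [this]
    generalize P⁻¹.mulVec (D.e u) = x
    ext i; simp [Matrix.mulVec, dotProduct, Fin.sum_univ_three, mul_comm]

theorem contDiffOn_mulL {n : ℕ} {Ω : Set (Fin n → 𝕜)} {c : Comp 𝕜 n}
    {X Y : (Fin n → 𝕜) → Fin n → 𝕜} (hc : SmoothComp c Ω) (hX : ContDiffOn 𝕜 ∞ X Ω)
    (hY : ContDiffOn 𝕜 ∞ Y Ω) : ContDiffOn 𝕜 ∞ (fun w => mulL (c w) (X w) (Y w)) Ω := by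
  rw [contDiffOn_pi]
  intro i
  simp only [mulL_apply]
  exact ContDiffOn.sum fun j _ => ContDiffOn.sum fun k _ =>
    ((hc i j k).mul (contDiffOn_pi.1 hX j)).mul (contDiffOn_pi.1 hY k)

theorem IsBiFlatOn.contDiffOn_eig (h : IsBiFlatOn D Ω)
    (hJ : ∀ u ∈ Ω, HasJordanTypeTwoOne (D.L u)) :
    ContDiffOn 𝕜 ∞ D.μ Ω ∧ ContDiffOn 𝕜 ∞ D.ν Ω := by
  have hL : ∀ i j, ContDiffOn 𝕜 ∞ (fun u => D.L u i j) Ω := fun i j => by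
    simp only [BiFlatData.L, Matrix.of_apply, mulBy]
    exact ContDiffOn.sum fun s _ => (h.fManifold.smooth_c i s j).mul (contDiffOn_pi.1 h.smooth_E s)
  have hmul : ∀ A B : (Fin 3 → 𝕜) → Matrix (Fin 3) (Fin 3) 𝕜,
      (∀ i j, ContDiffOn 𝕜 ∞ (fun u => A u i j) Ω) → (∀ i j, ContDiffOn 𝕜 ∞ (fun u => B u i j) Ω) →
      ∀ i j, ContDiffOn 𝕜 ∞ (fun u => (A u * B u) i j) Ω := by
    intro A B hA hB i j
    simp only [Matrix.mul_apply]
    exact ContDiffOn.sum fun s _ => (hA i s).mul (hB s j)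
  have htr : ∀ A : (Fin 3 → 𝕜) → Matrix (Fin 3) (Fin 3) 𝕜,
      (∀ i j, ContDiffOn 𝕜 ∞ (fun u => A u i j) Ω) → ContDiffOn 𝕜 ∞ (fun u => (A u).trace) Ω := by
    intro A hA
    simp only [Matrix.trace, Matrix.diag]
    exact ContDiffOn.sum fun s _ => hA s s
  have h1 := htr _ hL
  have h2 := htr _ (hmul _ _ hL hL)
  have h3 := htr _ (hmul _ _ (hmul _ _ hL hL) hL)
  have hs : ContDiffOn 𝕜 ∞ (fun u => eigSum (D.L u)) Ω := by
    refine ContDiffOn.div ((contDiffOn_const.mul h3).sub (h1.mul h2))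
      ((contDiffOn_const.mul h2).sub (h1.pow 2)) fun u hu => ?_
    obtain ⟨μ, ν, P, hμν, hP, hA⟩ := hJ u hu
    exact (eig_of_jordan hμν hP hA).1
  exact ⟨h1.sub hs, (contDiffOn_const.mul hs).sub h1⟩

theorem IsBiFlatOn.contDiffOn_frame (h : IsBiFlatOn D Ω)
    (hJ : ∀ u ∈ Ω, HasJordanTypeTwoOne (D.L u)) :
    ContDiffOn 𝕜 ∞ D.P Ω ∧ ContDiffOn 𝕜 ∞ D.N Ω ∧ ContDiffOn 𝕜 ∞ D.R Ω := by
  obtain ⟨hμ, hν⟩ := h.contDiffOn_eig hJ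
  have hX : ContDiffOn 𝕜 ∞ (fun u => D.E u - D.μ u • D.e u) Ω :=
    h.smooth_E.sub (hμ.smul h.fManifold.smooth_e)
  have hR : ContDiffOn 𝕜 ∞ D.R Ω :=
    (((hν.sub hμ).inv fun u hu => sub_ne_zero.2 (h.isJordanFrame hu (hJ u hu)).ne.symm).pow 2).smul
      (contDiffOn_mulL h.fManifold.smooth_c hX hX)
  exact ⟨h.fManifold.smooth_e.sub hR, hX.sub ((hν.sub hμ).smul hR), hR⟩

end FrameFields

/-! ### Coordinates from a commuting frame -/

section CommutingFrame

variable {𝕜 : Type*} [RCLike 𝕜] {n : ℕ} {Ω : Set (Fin n → 𝕜)}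

/-- The linear map taking the standard basis to the vectors `F i`. -/
def frameMap (F : Fin n → Fin n → 𝕜) : (Fin n → 𝕜) →L[𝕜] (Fin n → 𝕜) :=
  ∑ i, (ContinuousLinearMap.proj (R := 𝕜) (φ := fun _ : Fin n => 𝕜) i).smulRight (F i)

theorem frameMap_apply (F : Fin n → Fin n → 𝕜) (x : Fin n → 𝕜) :
    frameMap F x = ∑ i, x i • F i := by
  simp [frameMap, sum_apply]

theorem frameMap_single (F : Fin n → Fin n → 𝕜) (i : Fin n) :
    frameMap F (Pi.single i 1) = F i := by
  rw [frameMap_apply, Finset.sum_eq_single i]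
  · simp
  · intro j _ hj; simp [hj]
  · simp

theorem exists_frameEquiv {F : Fin n → Fin n → 𝕜} (hF : LinearIndependent 𝕜 F) :
    ∃ A : (Fin n → 𝕜) ≃L[𝕜] (Fin n → 𝕜), (A : (Fin n → 𝕜) →L[𝕜] (Fin n → 𝕜)) = frameMap F := by
  have hinj : Function.Injective (frameMap F : (Fin n → 𝕜) →ₗ[𝕜] (Fin n → 𝕜)) := by
    rw [← LinearMap.ker_eq_bot, LinearMap.ker_eq_bot']
    intro x hx
    ext i
    refine Fintype.linearIndependent_iff.1 hF x ?_ i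
    rw [← frameMap_apply]; exact hx
  refine ⟨(LinearEquiv.ofInjectiveEndo _ hinj).toContinuousLinearEquiv, ?_⟩
  ext x i
  rfl

/-- The coordinate one-forms of a frame. -/
def coframe (F : Fin n → (Fin n → 𝕜) → Fin n → 𝕜) (i : Fin n) (u : Fin n → 𝕜) :
    (Fin n → 𝕜) →L[𝕜] 𝕜 :=
  (ContinuousLinearMap.proj (R := 𝕜) (φ := fun _ : Fin n => 𝕜) i).comp
    (ContinuousLinearMap.inverse (frameMap fun j => F j u))

variable {F : Fin n → (Fin n → 𝕜) → Fin n → 𝕜} {u : Fin n → 𝕜}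

theorem coframe_apply (hF : LinearIndependent 𝕜 fun j => F j u) (i j : Fin n) :
    coframe F i u (F j u) = if i = j then 1 else 0 := by
  obtain ⟨A, hA⟩ := exists_frameEquiv hF
  have hj : F j u = A (Pi.single j 1) := by
    rw [← frameMap_single (fun j => F j u) j, ← hA]; rfl
  rw [coframe, ← hA, ContinuousLinearMap.inverse_equiv, hj]
  simp [Pi.single_apply]

theorem contDiffOn_coframe (hs : ∀ i, ContDiffOn 𝕜 ∞ (F i) Ω)
    (hF : ∀ u ∈ Ω, LinearIndependent 𝕜 fun j => F j u) (i : Fin n) :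
    ContDiffOn 𝕜 ∞ (coframe F i) Ω := by
  have hM : ContDiffOn 𝕜 ∞ (fun u => frameMap fun j => F j u) Ω := by
    unfold frameMap
    exact ContDiffOn.sum fun j _ => contDiffOn_const.smulRight (hs j)
  intro u hu
  refine contDiffWithinAt_const.clm_comp ?_
  obtain ⟨A, hA⟩ := exists_frameEquiv (hF u hu)
  have := contDiffAt_map_inverse (n := ∞) A
  rw [hA] at this
  exact this.comp_contDiffWithinAt u (hM u hu)

theorem frame_expansion (hF : LinearIndependent 𝕜 fun j => F j u) (x : Fin n → 𝕜) :
    ∃ a : Fin n → 𝕜, x = ∑ i, a i • F i u := by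
  obtain ⟨A, hA⟩ := exists_frameEquiv hF
  refine ⟨A.symm x, ?_⟩
  rw [← frameMap_apply, ← hA]
  simp

/-- The pairings of the coframe with the frame are constant, so dωᵢ(Fⱼ, Fₖ) = -ωᵢ([Fⱼ, Fₖ]): the
coframe is closed because the frame commutes. -/
theorem fderiv_coframe_symm (hΩ : IsOpen Ω) (hs : ∀ i, ContDiffOn 𝕜 ∞ (F i) Ω)
    (hF : ∀ u ∈ Ω, LinearIndependent 𝕜 fun j => F j u)
    (hcomm : ∀ u ∈ Ω, ∀ i j, fderiv 𝕜 (F i) u (F j u) = fderiv 𝕜 (F j) u (F i u)) (i : Fin n)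
    (hu : u ∈ Ω) (x y : Fin n → 𝕜) :
    fderiv 𝕜 (coframe F i) u x y = fderiv 𝕜 (coframe F i) u y x := by
  have hd : DifferentiableAt 𝕜 (coframe F i) u :=
    ((contDiffOn_coframe hs hF i).contDiffAt (hΩ.mem_nhds hu)).differentiableAt (by simp)
  have key : ∀ j v, fderiv 𝕜 (coframe F i) u v (F j u)
      = -coframe F i u (fderiv 𝕜 (F j) u v) := by
    intro j v
    have hFj : DifferentiableAt 𝕜 (F j) u :=
      ((hs j).contDiffAt (hΩ.mem_nhds hu)).differentiableAt (by simp)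
    have h1 := (hd.hasFDerivAt.clm_apply hFj.hasFDerivAt).fderiv
    have h2 : (fun w => coframe F i w (F j w)) =ᶠ[𝓝 u] fun _ => if i = j then 1 else 0 :=
      Filter.eventually_of_mem (hΩ.mem_nhds hu) fun w hw => coframe_apply (hF w hw) i j
    rw [h2.fderiv_eq] at h1
    have := congrArg (fun T => T v) h1
    simp at this
    linear_combination -this
  obtain ⟨a, ha⟩ := frame_expansion (hF u hu) x
  obtain ⟨b, hb⟩ := frame_expansion (hF u hu) y
  rw [ha, hb]
  simp only [map_sum, map_smul, sum_apply, smul_apply, key]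
  simp only [Finset.smul_sum]
  rw [Finset.sum_comm]
  exact Finset.sum_congr rfl fun j _ => Finset.sum_congr rfl fun k _ => by
    rw [hcomm u hu k j, smul_comm]

/-- A commuting frame on a convex domain consists of coordinate vector fields. -/
theorem exists_coordinate_of_commuting_frame (hΩ : IsOpen Ω) (hconv : Convex ℝ Ω)
    (hs : ∀ i, ContDiffOn 𝕜 ∞ (F i) Ω) (hF : ∀ u ∈ Ω, LinearIndependent 𝕜 fun j => F j u)
    (hcomm : ∀ u ∈ Ω, ∀ i j, fderiv 𝕜 (F i) u (F j u) = fderiv 𝕜 (F j) u (F i u)) (i : Fin n) :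
    ∃ t : (Fin n → 𝕜) → 𝕜, ContDiffOn 𝕜 ∞ t Ω ∧
      ∀ u ∈ Ω, ∀ j, fderiv 𝕜 t u (F j u) = if i = j then 1 else 0 := by
  have hω := contDiffOn_coframe hs hF i
  -- Poincaré lemma on a convex set. Convexity is real, so the derivative of the form is restricted
  -- to ℝ, while the form itself and the derivative of the primitive stay 𝕜-linear.
  obtain ⟨t, ht⟩ := hconv.exists_forall_hasFDerivWithinAt_of_hasFDerivWithinAt_symmetric
    (𝕜 := 𝕜) (dω := fun u => (fderiv 𝕜 (coframe F i) u).restrictScalars ℝ)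
    (fun u hu => (((hω.contDiffAt (hΩ.mem_nhds hu)).differentiableAt
      (by simp)).hasFDerivAt.restrictScalars ℝ).hasFDerivWithinAt)
    (fun u hu x _ y _ => fderiv_coframe_symm hΩ hs hF hcomm i hu x y)
  have ht' : ∀ u ∈ Ω, HasFDerivAt t (coframe F i u) u := fun u hu =>
    (ht u hu).hasFDerivAt (hΩ.mem_nhds hu)
  refine ⟨t, ?_, fun u hu j => ?_⟩
  · rw [contDiffOn_infty_iff_fderiv_of_isOpen hΩ]
    exact ⟨fun u hu => (ht' u hu).differentiableAt.differentiableWithinAt,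
      hω.congr fun u hu => (ht' u hu).fderiv⟩
  · rw [(ht' u hu).fderiv, coframe_apply (hF u hu)]

end CommutingFrame

/-! ### The frame commutes, and μ, ν are two of its coordinates -/

section JordanFrame

variable {𝕜 : Type*} [RCLike 𝕜] {Ω : Set (Fin 3 → 𝕜)} {u : Fin 3 → 𝕜} {D : BiFlatData 𝕜 3}

theorem IsJordanFrame.mul_zero {V : Type*} [AddCommGroup V] [Module 𝕜 V]
    {m : V →ₗ[𝕜] V →ₗ[𝕜] V} {e E P N R : V} {μ ν : 𝕜} (hm : IsUnitalProduct m e)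
    (h : IsJordanFrame m e E P N R μ ν) : m P R = 0 ∧ m R P = 0 ∧ m R N = 0 ∧ m N R = 0 := by
  have hP : m P e = P := (hm.comm P e).trans (hm.unit P)
  have h1 : m P R = 0 := by
    rw [← h.PR, map_add, h.PP] at hP
    simpa using hP
  have h2 := hm.unit N
  rw [← h.PR, map_add, LinearMap.add_apply, h.PN] at h2
  have h3 : m R N = 0 := by simpa using h2
  exact ⟨h1, (hm.comm R P).trans h1, h3, (hm.comm N R).trans h3⟩

theorem IsJordanFrame.linearIndependent {V : Type*} [AddCommGroup V] [Module 𝕜 V]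
    {m : V →ₗ[𝕜] V →ₗ[𝕜] V} {e E P N R : V} {μ ν : 𝕜} (hm : IsUnitalProduct m e)
    (h : IsJordanFrame m e E P N R μ ν) : LinearIndependent 𝕜 ![P, N, R] := by
  obtain ⟨z1, z2, z3, z4⟩ := h.mul_zero hm
  rw [Fintype.linearIndependent_iff]
  intro g hg
  simp only [Fin.sum_univ_three, Matrix.cons_val] at hg
  have hR := congrArg (m R) hg
  simp only [map_add, map_smul, z2, z3, h.RR, smul_zero, zero_add, map_zero] at hR
  have hN := congrArg (m N) hg
  simp only [map_add, map_smul, hm.comm N P, h.PN, h.NN, z4, smul_zero, add_zero, map_zero] at hN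
  have g2 := (smul_eq_zero.1 hR).resolve_right h.R_ne
  have g0 := (smul_eq_zero.1 hN).resolve_right h.N_ne
  rw [g2, g0, zero_smul, zero_smul, zero_add, add_zero] at hg
  have g1 := (smul_eq_zero.1 hg).resolve_right h.N_ne
  intro i
  fin_cases i
  exacts [g0, g1, g2]

/-- The multiplication table of P, N, R and the decomposition of E hold in a neighbourhood and may
be differentiated; `frame_relations_of_mul` then works in the single tangent space at u. -/
theorem IsBiFlatOn.frame_relations (h : IsBiFlatOn D Ω) (hΩ : IsOpen Ω)
    (hJ : ∀ u ∈ Ω, HasJordanTypeTwoOne (D.L u)) (hu : u ∈ Ω) :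
    (fderiv 𝕜 D.μ u (D.P u) = 1 ∧ fderiv 𝕜 D.μ u (D.N u) = 0 ∧ fderiv 𝕜 D.μ u (D.R u) = 0) ∧
    (fderiv 𝕜 D.ν u (D.P u) = 0 ∧ fderiv 𝕜 D.ν u (D.N u) = 0 ∧ fderiv 𝕜 D.ν u (D.R u) = 1) ∧
    fderiv 𝕜 D.N u (D.P u) = fderiv 𝕜 D.P u (D.N u) ∧
    fderiv 𝕜 D.R u (D.P u) = fderiv 𝕜 D.P u (D.R u) ∧
    fderiv 𝕜 D.N u (D.R u) = fderiv 𝕜 D.R u (D.N u) := by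
  have hjf := fun w (hw : w ∈ Ω) => h.isJordanFrame hw (hJ w hw)
  have hj := hjf u hu
  have hm := fun w (hw : w ∈ Ω) => h.fManifold.isUnitalProduct hw
  obtain ⟨sP, sN, sR⟩ := h.contDiffOn_frame hJ
  obtain ⟨sμ, sν⟩ := h.contDiffOn_eig hJ
  have hdiff : ∀ {X : (Fin 3 → 𝕜) → Fin 3 → 𝕜}, ContDiffOn 𝕜 ∞ X Ω → DifferentiableAt 𝕜 X u :=
    fun hX => (hX.contDiffAt (hΩ.mem_nhds hu)).differentiableAt (by simp)
  have hdiff' : ∀ {X : (Fin 3 → 𝕜) → 𝕜}, ContDiffOn 𝕜 ∞ X Ω → DifferentiableAt 𝕜 X u :=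
    fun hX => (hX.contDiffAt (hΩ.mem_nhds hu)).differentiableAt (by simp)
  have jet := fun {X Y Z : (Fin 3 → 𝕜) → Fin 3 → 𝕜} (hX : ContDiffOn 𝕜 ∞ X Ω)
    (hY : ContDiffOn 𝕜 ∞ Y Ω) => jet_of_mulL_eq (Z := Z) h.fManifold.smooth_c hΩ hu (hdiff hX)
      (hdiff hY)
  refine frame_relations_of_mul (hm u hu) (D := fun v p q => dMul D.c u v p q)
    (DE := fderiv 𝕜 D.E u) (dμ := (fderiv 𝕜 D.μ u : (Fin 3 → 𝕜) →ₗ[𝕜] 𝕜))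
    (dν := (fderiv 𝕜 D.ν u : (Fin 3 → 𝕜) →ₗ[𝕜] 𝕜))
    (DP := (fderiv 𝕜 D.P u : (Fin 3 → 𝕜) →ₗ[𝕜] (Fin 3 → 𝕜)))
    (DR := (fderiv 𝕜 D.R u : (Fin 3 → 𝕜) →ₗ[𝕜] (Fin 3 → 𝕜)))
    (DN := (fderiv 𝕜 D.N u : (Fin 3 → 𝕜) →ₗ[𝕜] (Fin 3 → 𝕜)))
    (h.fManifold.hertlingManin_mulL hu) (h.lieDerivative_E hΩ hu) hj.PP hj.RR hj.PR hj.PN hj.NN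
    hj.E_eq hj.N_ne hj.R_ne
    (jet sP sP fun w hw => (hjf w hw).PP) (jet sR sR fun w hw => (hjf w hw).RR) ?_
    (jet sP sN fun w hw => (hjf w hw).PN) ?_ ?_
  · intro v
    have := jet sP sR (fun w hw => ((hjf w hw).mul_zero (hm w hw)).1) v
    simpa using this
  · intro v
    have := jet sN sN (fun w hw => (hjf w hw).NN) v
    simpa using this
  · intro v
    have h1 := (((hdiff' sμ).hasFDerivAt.smul (hdiff sP).hasFDerivAt).add
      (hdiff sN).hasFDerivAt).add ((hdiff' sν).hasFDerivAt.smul (hdiff sR).hasFDerivAt)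
    have h2 : D.E =ᶠ[𝓝 u] D.μ • D.P + D.N + D.ν • D.R :=
      Filter.eventually_of_mem (hΩ.mem_nhds hu) fun w hw => (hjf w hw).E_eq
    have h3 := congrArg (fun T => T v) (h2.fderiv_eq.trans h1.fderiv)
    refine h3.trans ?_
    simp
    abel

end JordanFrame

/-! ### Changes of chart from the inverse function theorem -/

section ChangeOfChart

variable {𝕜 : Type*} [RCLike 𝕜] {n : ℕ}

theorem trans_mem_maximalAtlas {H M : Type*} [TopologicalSpace H] [TopologicalSpace M]
    [ChartedSpace H M] {G : StructureGroupoid H} {φ : OpenPartialHomeomorph M H}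
    {T : OpenPartialHomeomorph H H} (hφ : φ ∈ G.maximalAtlas M) (hT : T ∈ G) :
    φ.trans T ∈ G.maximalAtlas M := by
  rw [mem_maximalAtlas_iff] at hφ ⊢
  intro e he
  constructor
  · rw [OpenPartialHomeomorph.trans_symm_eq_symm_trans_symm, OpenPartialHomeomorph.trans_assoc]
    exact G.trans (G.symm hT) (hφ e he).1
  · rw [← OpenPartialHomeomorph.trans_assoc]
    exact G.trans (hφ e he).2 hT

/-- The inverse function theorem, with a ball as the image. -/
theorem exists_openPartialHomeomorph_of_contDiffOn {U : Set (Fin n → 𝕜)}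
    {τ : (Fin n → 𝕜) → Fin n → 𝕜} {a : Fin n → 𝕜} (hU : IsOpen U) (ha : a ∈ U)
    (hτ : ContDiffOn 𝕜 ∞ τ U)
    (hinv : ∀ u ∈ U, Function.Injective (fderiv 𝕜 τ u)) :
    ∃ T ∈ contDiffGroupoid ∞ 𝓘(𝕜, Fin n → 𝕜), a ∈ T.source ∧ T.source ⊆ U ∧
      Convex ℝ T.target ∧ (T : (Fin n → 𝕜) → Fin n → 𝕜) = τ := by
  have hAt : ∀ u ∈ U, ContDiffAt 𝕜 ∞ τ u := fun u hu => hτ.contDiffAt (hU.mem_nhds hu)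
  have hequiv : ∀ u ∈ U, ∃ A : (Fin n → 𝕜) ≃L[𝕜] (Fin n → 𝕜),
      HasFDerivAt τ (A : (Fin n → 𝕜) →L[𝕜] (Fin n → 𝕜)) u := fun u hu => by
    refine ⟨(LinearEquiv.ofInjectiveEndo (fderiv 𝕜 τ u : (Fin n → 𝕜) →ₗ[𝕜] (Fin n → 𝕜))
      (hinv u hu)).toContinuousLinearEquiv, ?_⟩
    exact ((hAt u hu).differentiableAt (by simp)).hasFDerivAt
  obtain ⟨A, hA⟩ := hequiv a ha
  obtain ⟨T₀, hT₀, hcoe₀⟩ : ∃ T₀ : OpenPartialHomeomorph (Fin n → 𝕜) (Fin n → 𝕜),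
      a ∈ T₀.source ∧ (T₀ : (Fin n → 𝕜) → Fin n → 𝕜) = τ :=
    ⟨(hAt a ha).toOpenPartialHomeomorph τ hA (by simp),
      (hAt a ha).mem_toOpenPartialHomeomorph_source hA (by simp), rfl⟩
  obtain ⟨T₁, hT₁, hsub₁, hcoe₁⟩ : ∃ T₁ : OpenPartialHomeomorph (Fin n → 𝕜) (Fin n → 𝕜),
      a ∈ T₁.source ∧ T₁.source ⊆ U ∧ (T₁ : (Fin n → 𝕜) → Fin n → 𝕜) = τ :=
    ⟨T₀.restrOpen U hU, ⟨hT₀, ha⟩, fun x hx => hx.2, hcoe₀⟩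
  obtain ⟨r, hr, hball⟩ := Metric.isOpen_iff.1 T₁.open_target (T₁ a) (T₁.map_source hT₁)
  have htarget : (T₁.trans (OpenPartialHomeomorph.ofSet (Metric.ball (T₁ a) r)
      Metric.isOpen_ball)).target = Metric.ball (T₁ a) r := by
    rw [OpenPartialHomeomorph.trans_target]
    simpa using hball
  have hsource : (T₁.trans (OpenPartialHomeomorph.ofSet (Metric.ball (T₁ a) r)
      Metric.isOpen_ball)).source ⊆ U := fun x hx => hsub₁ hx.1
  refine ⟨T₁.trans (OpenPartialHomeomorph.ofSet (Metric.ball (T₁ a) r) Metric.isOpen_ball),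
    ?_, ⟨hT₁, Metric.mem_ball_self hr⟩, hsource, ?_, hcoe₁⟩
  · rw [contDiffGroupoid, mem_groupoid_of_pregroupoid]
    refine ⟨?_, ?_⟩
    · have : ContDiffOn 𝕜 ∞ T₁ (T₁.trans (OpenPartialHomeomorph.ofSet (Metric.ball (T₁ a) r)
          Metric.isOpen_ball)).source :=
        (hcoe₁ ▸ hτ : ContDiffOn 𝕜 ∞ T₁ U).mono hsource
      simpa [contDiffPregroupoid] using this
    · have : ContDiffOn 𝕜 ∞ T₁.symm (Metric.ball (T₁ a) r) := fun w hw => by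
        have hu := hsub₁ (T₁.map_target (hball hw))
        obtain ⟨A, hA⟩ := hequiv _ hu
        refine (T₁.contDiffAt_symm (f₀' := A) (hball hw) ?_ ?_).contDiffWithinAt
        · rw [hcoe₁]; exact hA
        · rw [hcoe₁]; exact hAt _ hu
      rw [htarget]
      simpa [contDiffPregroupoid] using this
  · rw [htarget]; exact convex_ball _ _

end ChangeOfChart

/-! ### Invertibility of E and the standard multiplication table -/

section CanonicalCoordinates

variable {𝕜 : Type*} [RCLike 𝕜] {Ω : Set (Fin 3 → 𝕜)} {u : Fin 3 → 𝕜} {D : BiFlatData 𝕜 3}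

/-- N∘E = μN and R∘E = νR with N, R ≠ 0; a zero eigenvalue would contradict the invertibility of E.
-/
theorem IsBiFlatOn.eig_ne_zero (h : IsBiFlatOn D Ω) (hu : u ∈ Ω)
    (hJ : HasJordanTypeTwoOne (D.L u)) : D.μ u ≠ 0 ∧ D.ν u ≠ 0 := by
  have hm := h.fManifold.isUnitalProduct hu
  have hj := h.isJordanFrame hu hJ
  obtain ⟨z1, z2, z3, z4⟩ := hj.mul_zero hm
  have hEi : mulL (D.c u) (D.E u) (D.Einv u) = D.e u := by
    ext i; rw [mulL_apply]; exact h.inverse u hu i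
  have key : ∀ (X : Fin 3 → 𝕜) (x : 𝕜), X ≠ 0 → mulL (D.c u) X (D.E u) = x • X → x ≠ 0 := by
    rintro X x hX hXE rfl
    apply hX
    rw [← hm.unit X, hm.comm, ← hEi, ← hm.assoc, hXE, zero_smul, map_zero, LinearMap.zero_apply]
  refine ⟨key _ _ hj.N_ne ?_, key _ _ hj.R_ne ?_⟩
  · conv_lhs => rw [hj.E_eq]
    simp only [map_add, map_smul, hm.comm (D.N u) (D.P u), hj.PN, hj.NN, z4, smul_zero, add_zero]
  · conv_lhs => rw [hj.E_eq]
    simp only [map_add, map_smul, z2, z3, hj.RR, smul_zero, zero_add]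

/-- The tangent vectors `∂₁, u² ∂₂, ∂₃` have the multiplication table of the standard product. -/
theorem eq_stdProduct_of_frame {T : Fin 3 → Fin 3 → Fin 3 → 𝕜} {s : 𝕜} (hs : s ≠ 0)
    (h00 : mulL T ![1, 0, 0] ![1, 0, 0] = ![1, 0, 0])
    (h01 : mulL T ![1, 0, 0] ![0, s, 0] = ![0, s, 0])
    (h10 : mulL T ![0, s, 0] ![1, 0, 0] = ![0, s, 0])
    (h11 : mulL T ![0, s, 0] ![0, s, 0] = 0)
    (h02 : mulL T ![1, 0, 0] ![0, 0, 1] = 0) (h20 : mulL T ![0, 0, 1] ![1, 0, 0] = 0)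
    (h12 : mulL T ![0, s, 0] ![0, 0, 1] = 0) (h21 : mulL T ![0, 0, 1] ![0, s, 0] = 0)
    (h22 : mulL T ![0, 0, 1] ![0, 0, 1] = ![0, 0, 1]) : T = stdProduct 𝕜 := by
  funext i j k
  have f00 := congrFun h00 i
  have f01 := congrFun h01 i
  have f10 := congrFun h10 i
  have f11 := congrFun h11 i
  have f02 := congrFun h02 i
  have f20 := congrFun h20 i
  have f12 := congrFun h12 i
  have f21 := congrFun h21 i
  have f22 := congrFun h22 i
  simp [mulL_apply, Fin.sum_univ_three, hs] at f00 f01 f10 f11 f02 f20 f12 f21 f22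
  fin_cases j <;> fin_cases k <;> fin_cases i <;> simp_all [stdProduct]

end CanonicalCoordinates

/-! ### Canonical charts -/

section CanonicalCoordinates

variable {𝕜 : Type*} [RCLike 𝕜] {Ω : Set (Fin 3 → 𝕜)} {u : Fin 3 → 𝕜} {D : BiFlatData 𝕜 3}

/-- Canonical coordinates near a point, as a map between coordinate domains. -/
theorem IsBiFlatOn.exists_canonical_map (h : IsBiFlatOn D Ω) (hΩ : IsOpen Ω)
    (hJ : ∀ u ∈ Ω, HasJordanTypeTwoOne (D.L u)) {U : Set (Fin 3 → 𝕜)} (hU : IsOpen U)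
    (hconv : Convex ℝ U) (hUΩ : U ⊆ Ω) :
    ∃ (τ : (Fin 3 → 𝕜) → Fin 3 → 𝕜), ContDiffOn 𝕜 ∞ τ U ∧
      ∀ u ∈ U, τ u 0 = D.μ u ∧ τ u 1 ≠ 0 ∧ τ u 2 = D.ν u ∧ fderiv 𝕜 τ u (D.P u) = ![1, 0, 0] ∧
        fderiv 𝕜 τ u (D.N u) = ![0, τ u 1, 0] ∧ fderiv 𝕜 τ u (D.R u) = ![0, 0, 1] := by
  obtain ⟨sP, sN, sR⟩ := h.contDiffOn_frame hJ
  replace sP := sP.mono hUΩ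
  replace sN := sN.mono hUΩ
  replace sR := sR.mono hUΩ
  obtain ⟨sμ, sν⟩ := h.contDiffOn_eig hJ
  replace sμ := sμ.mono hUΩ
  replace sν := sν.mono hUΩ
  -- Only the coordinate dual to N has to be constructed; μ and ν already are dual to P and R.
  obtain ⟨t, st, ht⟩ := exists_coordinate_of_commuting_frame (F := ![D.P, D.N, D.R]) hU hconv
    (fun i => by fin_cases i <;> assumption)
    (fun u hu => by
      have := (h.isJordanFrame (hUΩ hu) (hJ u (hUΩ hu))).linearIndependent
        (h.fManifold.isUnitalProduct (hUΩ hu))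
      have hF : (fun j => ![D.P, D.N, D.R] j u) = ![D.P u, D.N u, D.R u] := by
        funext j; fin_cases j <;> rfl
      rw [hF]; exact this)
    (fun u hu i j => by
      obtain ⟨-, -, r1, r2, r3⟩ := h.frame_relations hΩ hJ (hUΩ hu)
      fin_cases i <;> fin_cases j <;>
        first | rfl | exact r1 | exact r2 | exact r3 | exact r1.symm | exact r2.symm | exact r3.symm)
    1
  -- Replacing t by u² = exp t turns N = ∂_t into u²∂₂, the form required by E = u¹∂₁ + u²∂₂ + u³∂₃,
  -- and makes u² nonzero.
  have sexp : ContDiffOn 𝕜 ∞ (fun u => NormedSpace.exp (t u)) U :=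
    fun u hu => ((NormedSpace.exp_analytic (𝕂 := 𝕜) (t u)).contDiffAt).comp_contDiffWithinAt u (st u hu)
  have hτ : ContDiffOn 𝕜 ∞ (fun u => ![D.μ u, NormedSpace.exp (t u), D.ν u]) U := by
    rw [contDiffOn_pi]
    intro i
    fin_cases i
    exacts [sμ, sexp, sν]
  refine ⟨_, hτ, fun u hu => ?_⟩
  have hd : ∀ {f : (Fin 3 → 𝕜) → 𝕜}, ContDiffOn 𝕜 ∞ f U → HasFDerivAt f (fderiv 𝕜 f u) u :=
    fun hf => ((hf.contDiffAt (hU.mem_nhds hu)).differentiableAt (by simp)).hasFDerivAt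
  have hdexp : HasFDerivAt (fun u => NormedSpace.exp (t u))
      (NormedSpace.exp (t u) • fderiv 𝕜 t u) u :=
    (hasDerivAt_exp (x := t u)).comp_hasFDerivAt u (hd st)
  have hfd : ∀ v, fderiv 𝕜 (fun u => ![D.μ u, NormedSpace.exp (t u), D.ν u]) u v
      = ![fderiv 𝕜 D.μ u v, NormedSpace.exp (t u) * fderiv 𝕜 t u v, fderiv 𝕜 D.ν u v] := by
    intro v
    have : HasFDerivAt (fun u => ![D.μ u, NormedSpace.exp (t u), D.ν u])
        (ContinuousLinearMap.pi ![fderiv 𝕜 D.μ u, NormedSpace.exp (t u) • fderiv 𝕜 t u,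
          fderiv 𝕜 D.ν u]) u := by
      rw [hasFDerivAt_pi]
      intro i
      fin_cases i
      exacts [hd sμ, hdexp, hd sν]
    rw [this.fderiv]
    ext i
    fin_cases i <;> simp
  obtain ⟨⟨m1, m2, m3⟩, ⟨n1, n2, n3⟩, -⟩ := h.frame_relations hΩ hJ (hUΩ hu)
  have t1 : fderiv 𝕜 t u (D.P u) = 0 := ht u hu 0
  have t2 : fderiv 𝕜 t u (D.N u) = 1 := ht u hu 1
  have t3 : fderiv 𝕜 t u (D.R u) = 0 := ht u hu 2
  refine ⟨rfl, (NormedSpace.isUnit_exp _).ne_zero, rfl, ?_, ?_, ?_⟩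
  · rw [hfd, m1, n1, t1, mul_zero]
  · rw [hfd, m2, n2, t2, mul_one]; rfl
  · rw [hfd, m3, n3, t3, mul_zero]

theorem injective_of_frame {A : (Fin 3 → 𝕜) →L[𝕜] (Fin 3 → 𝕜)} {F : Fin 3 → Fin 3 → 𝕜} {s : 𝕜}
    (hs : s ≠ 0) (hF : LinearIndependent 𝕜 F) (h0 : A (F 0) = ![1, 0, 0])
    (h1 : A (F 1) = ![0, s, 0]) (h2 : A (F 2) = ![0, 0, 1]) : Function.Injective A := by
  rw [injective_iff_map_eq_zero]
  intro x hx
  obtain ⟨a, ha⟩ := frame_expansion (F := fun i _ => F i) (u := (0 : Fin 3 → 𝕜)) hF x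
  rw [ha, map_sum, Fin.sum_univ_three, map_smul, map_smul, map_smul, h0, h1, h2] at hx
  have x0 := congrFun hx 0
  have x1 := congrFun hx 1
  have x2 := congrFun hx 2
  simp [hs] at x0 x1 x2
  rw [ha, Fin.sum_univ_three, x0, x1, x2]
  simp

/-- The change of coordinates respects the products, in terms of vectors. -/
theorem TransformsAt.mulL_fderiv {n : ℕ} {D D' : BiFlatData 𝕜 n} {τ : (Fin n → 𝕜) → Fin n → 𝕜}
    {u : Fin n → 𝕜} (h : TransformsAt D D' τ u) (hτ : DifferentiableAt 𝕜 τ u) (p q : Fin n → 𝕜) :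
    mulL (D'.c (τ u)) (fderiv 𝕜 τ u p) (fderiv 𝕜 τ u q) = fderiv 𝕜 τ u (mulL (D.c u) p q) := by
  have hpd : ∀ a j, pd a (fun v => τ v j) u = fderiv 𝕜 τ u (Pi.single a 1) j := by
    intro a j
    rw [pd, (hasFDerivAt_pi'.1 hτ.hasFDerivAt j).fderiv]; rfl
  refine pi_single_induction (P := fun p => ∀ q, mulL (D'.c (τ u)) (fderiv 𝕜 τ u p)
    (fderiv 𝕜 τ u q) = fderiv 𝕜 τ u (mulL (D.c u) p q)) ?_ ?_ ?_ (fun a => ?_) p q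
  · simp
  · intro v w hv hw q; simp only [map_add, LinearMap.add_apply, hv, hw]
  · intro a v hv q; simp only [map_smul, LinearMap.smul_apply, hv]
  refine pi_single_induction ?_ ?_ ?_ fun b => ?_
  · simp
  · intro v w hv hw; simp only [map_add, hv, hw]
  · intro a v hv; simp only [map_smul, hv]
  ext i
  have := h.product i a b
  simp only [hpd] at this
  rw [mulL_apply, this]
  conv_rhs => rw [pi_eq_sum_univ' (mulL (D.c u) (Pi.single a 1) (Pi.single b 1))]
  rw [map_sum, Finset.sum_apply]
  refine Finset.sum_congr rfl fun l _ => ?_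
  rw [map_smul, mulL_single_single, Pi.smul_apply, smul_eq_mul, mul_comm]

/-- The derivative of τ carries P, N, R to ∂₁, u²∂₂, ∂₃ and respects products, so the multiplication
table is transported; e = P + R and E = μP + N + νR give the two fields. -/
theorem TransformsAt.canonical {D' : BiFlatData 𝕜 3} {τ : (Fin 3 → 𝕜) → Fin 3 → 𝕜}
    (H : TransformsAt D D' τ u) (hτ : DifferentiableAt 𝕜 τ u) (h : IsBiFlatOn D Ω) (hu : u ∈ Ω)
    (hJ : HasJordanTypeTwoOne (D.L u)) (h0 : τ u 0 = D.μ u) (h1 : τ u 1 ≠ 0)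
    (h2 : τ u 2 = D.ν u) (hP : fderiv 𝕜 τ u (D.P u) = ![1, 0, 0])
    (hN : fderiv 𝕜 τ u (D.N u) = ![0, τ u 1, 0]) (hR : fderiv 𝕜 τ u (D.R u) = ![0, 0, 1]) :
    D'.c (τ u) = stdProduct 𝕜 ∧ D'.e (τ u) = ![1, 0, 1] ∧ D'.E (τ u) = τ u := by
  have hm := h.fManifold.isUnitalProduct hu
  have hj := h.isJordanFrame hu hJ
  obtain ⟨z1, z2, z3, z4⟩ := hj.mul_zero hm
  have key := H.mulL_fderiv hτ
  refine ⟨eq_stdProduct_of_frame h1 ?_ ?_ ?_ ?_ ?_ ?_ ?_ ?_ ?_, ?_, ?_⟩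
  · rw [← hP, key, hj.PP]
  · rw [← hP, ← hN, key, hj.PN]
  · rw [← hP, ← hN, key, hm.comm, hj.PN]
  · rw [← hN, key, hj.NN, map_zero]
  · rw [← hP, ← hR, key, z1, map_zero]
  · rw [← hP, ← hR, key, z2, map_zero]
  · rw [← hN, ← hR, key, z4, map_zero]
  · rw [← hN, ← hR, key, z3, map_zero]
  · rw [← hR, key, hj.RR]
  · rw [H.unit, ← hj.PR, map_add, hP, hR]
    ext i; fin_cases i <;> simp
  · rw [H.field, hj.E_eq, map_add, map_add, map_smul, map_smul, hP, hN, hR, ← h0, ← h2]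
    ext i; fin_cases i <;> simp

theorem BiFlatFManifold.exists_isCanonicalOn {M : Type*} [TopologicalSpace M]
    [ChartedSpace (Fin 3 → 𝕜) M] [IsManifold 𝓘(𝕜, Fin 3 → 𝕜) ∞ M] (B : BiFlatFManifold 𝕜 3 M)
    (hB : B.IsRegularTwoOne) (p : M) :
    ∃ ψ ∈ IsManifold.maximalAtlas 𝓘(𝕜, Fin 3 → 𝕜) ∞ M, p ∈ ψ.source ∧ Convex ℝ ψ.target ∧
      IsCanonicalOn (B.data ψ) ψ.target := by
  obtain ⟨φ, hφ, hp⟩ : ∃ φ ∈ IsManifold.maximalAtlas 𝓘(𝕜, Fin 3 → 𝕜) ∞ M, p ∈ φ.source :=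
    ⟨chartAt _ p, IsManifold.chart_mem_maximalAtlas p, mem_chart_source _ p⟩
  obtain ⟨r, hr, hball⟩ := Metric.isOpen_iff.1 φ.open_target (φ p) (φ.map_source hp)
  obtain ⟨U, hU, hUconv, hUφ, hpU⟩ : ∃ U : Set (Fin 3 → 𝕜), IsOpen U ∧ Convex ℝ U ∧
      U ⊆ φ.target ∧ φ p ∈ U :=
    ⟨_, Metric.isOpen_ball, convex_ball _ _, hball, Metric.mem_ball_self hr⟩
  have hD := B.isBiFlat φ hφ
  have hJ : ∀ u ∈ φ.target, HasJordanTypeTwoOne ((B.data φ).L u) := hB φ hφ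
  obtain ⟨τ, sτ, hτ⟩ := hD.exists_canonical_map φ.open_target hJ hU hUconv hUφ
  obtain ⟨T, hT, hpT, hTU, hTconv, hTτ⟩ := exists_openPartialHomeomorph_of_contDiffOn hU hpU sτ
    fun u hu => by
      obtain ⟨-, h1, -, hP, hN, hR⟩ := hτ u hu
      exact injective_of_frame h1 ((hD.isJordanFrame (hUφ hu) (hJ u (hUφ hu))).linearIndependent
        (hD.fManifold.isUnitalProduct (hUφ hu))) hP hN hR
  have hψ := trans_mem_maximalAtlas hφ hT
  have htarget : (φ.trans T).target = T.target := by
    rw [OpenPartialHomeomorph.trans_target, inter_eq_left]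
    exact fun w hw => hUφ (hTU (T.map_target hw))
  have hpoint : ∀ w ∈ (φ.trans T).target, ∃ u ∈ U, τ u = w ∧
      (B.data (φ.trans T)).c w = stdProduct 𝕜 ∧ (B.data (φ.trans T)).e w = ![1, 0, 1] ∧
      (B.data (φ.trans T)).E w = w := by
    intro w hw
    rw [htarget] at hw
    have huT := T.map_target hw
    have huU := hTU huT
    have huw : τ (T.symm w) = w := by rw [← hTτ, T.right_inv hw]
    -- The transition map between the two charts coincides with τ only on U; this is enough because
    -- the transformation law at a point depends on germs.
    have hσ : ∀ v ∈ U, (φ.symm.trans (φ.trans T)) v = τ v := by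
      intro v hv
      change T (φ (φ.symm v)) = τ v
      rw [φ.right_inv (hUφ hv), hTτ]
    have hev : (φ.symm.trans (φ.trans T) : (Fin 3 → 𝕜) → Fin 3 → 𝕜) =ᶠ[𝓝 (T.symm w)] τ :=
      Filter.eventually_of_mem (hU.mem_nhds huU) hσ
    have hsource : T.symm w ∈ (φ.symm.trans (φ.trans T)).source := by
      refine ⟨hUφ huU, φ.map_target (hUφ huU), ?_⟩
      change φ (φ.symm (T.symm w)) ∈ T.source
      rwa [φ.right_inv (hUφ huU)]
    have H := B.transform φ hφ _ hψ _ hsource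
    have hd : DifferentiableAt 𝕜 τ (T.symm w) :=
      (sτ.contDiffAt (hU.mem_nhds huU)).differentiableAt (by simp)
    refine ⟨T.symm w, huU, huw, ?_⟩
    obtain ⟨h0, h1, h2, hP, hN, hR⟩ := hτ _ huU
    have := H.canonical (hev.differentiableAt_iff.2 hd) hD (hUφ huU) (hJ _ (hUφ huU))
      (by rw [hev.self_of_nhds, h0]) (by rwa [hev.self_of_nhds]) (by rw [hev.self_of_nhds, h2])
      (by rw [hev.fderiv_eq, hP]) (by rw [hev.fderiv_eq, hN, hev.self_of_nhds])
      (by rw [hev.fderiv_eq, hR])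
    rwa [hev.self_of_nhds, huw] at this
  refine ⟨φ.trans T, hψ, ⟨hp, hpT⟩, htarget ▸ hTconv, (φ.trans T).open_target,
    B.isBiFlat _ hψ, fun w hw => ?_, fun w hw => ?_, fun w hw => ?_, fun w hw => ?_⟩
  · obtain ⟨u, hu, rfl, -⟩ := hpoint w hw
    obtain ⟨h0, h1, h2, -⟩ := hτ u hu
    obtain ⟨e0, e2⟩ := hD.eig_ne_zero (hUφ hu) (hJ u (hUφ hu))
    rw [h0, h2]
    exact ⟨e0, h1, e2, (hD.isJordanFrame (hUφ hu) (hJ u (hUφ hu))).ne⟩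
  · obtain ⟨u, -, -, h, -, -⟩ := hpoint w hw; exact h
  · obtain ⟨u, -, -, -, h, -⟩ := hpoint w hw; exact h
  · obtain ⟨u, -, -, -, -, h⟩ := hpoint w hw; exact h

end CanonicalCoordinates

end

/-! ### The main theorem -/

theorem mainTheorem5 {𝕜 : Type*} [RCLike 𝕜] :
    -- every such bi-flat manifold has, around each point, the canonical form of some profile
    (∀ (M : Type*) [TopologicalSpace M] [ChartedSpace (Fin 3 → 𝕜) M]
        [IsManifold 𝓘(𝕜, Fin 3 → 𝕜) ∞ M] (B : BiFlatFManifold 𝕜 3 M),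
        B.IsRegularTwoOne → ∀ p : M,
          ∃ ψ ∈ IsManifold.maximalAtlas 𝓘(𝕜, Fin 3 → 𝕜) ∞ M, p ∈ ψ.source ∧
            ∃ (S : Set 𝕜) (F : Profile 𝕜), IsOpen S ∧ IsPreconnected S ∧ (0 : 𝕜) ∉ S ∧
              ψ.target ⊆ domainOver S ∧
              (B.data ψ).AgreeOn (model F) ψ.target ∧
              IsBiFlatOn (model F) (domainOver S)) ∧
    -- for `I₁ ≠ 0` the profile of a canonical form gives a solution of Painlevé V
    (∀ (S : Set 𝕜) (F : Profile 𝕜), IsOpen S → IsPreconnected S → (0 : 𝕜) ∉ S →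
        IsBiFlatOn (model F) (domainOver S) →
          ∃ I₁ I₂ I₃ a : 𝕜, F.HasIntegrals S I₁ I₂ I₃ a ∧
            (I₁ ≠ 0 →
              IsPainleveVSolution a (-I₂ ^ 2 / 2) (I₁ * I₃ + I₁) (-I₁ ^ 2 / 2)
                {x | x⁻¹ ∈ F.genericSet I₁ S} (F.painleveFunction I₁) ∧
              ((∀ z ∈ S, F.F₁ z = 0) ∨ (∀ z ∈ S, z * F.F₁ z = I₁) ∨
                ∀ z ∈ S, ∀ᶠ w in 𝓝[≠] z, w ∈ F.genericSet I₁ S))) ∧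
    -- each solution of Painlevé V comes from exactly one canonical form with given integrals
    (∀ (a b g d : 𝕜) (X : Set 𝕜) (y : 𝕜 → 𝕜), IsPainleveVSolution a b g d X y →
        ∀ I₁ I₂ I₃ : 𝕜, I₁ ≠ 0 → -2 * d = I₁ ^ 2 → -2 * b = I₂ ^ 2 → g = I₁ * I₃ + I₁ →
          ∃ F : Profile 𝕜,
            (IsBiFlatOn (model F) (domainOver {z | z⁻¹ ∈ X}) ∧
              F.HasIntegrals {z | z⁻¹ ∈ X} I₁ I₂ I₃ a ∧
              F.genericSet I₁ {z | z⁻¹ ∈ X} = {z | z⁻¹ ∈ X} ∧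
              EqOn (F.painleveFunction I₁) y X) ∧
            (∀ u ∈ domainOver {z | z⁻¹ ∈ X}, HasJordanTypeTwoOne ((model F).L u)) ∧
            ∀ G : Profile 𝕜,
              IsBiFlatOn (model G) (domainOver {z | z⁻¹ ∈ X}) →
              G.HasIntegrals {z | z⁻¹ ∈ X} I₁ I₂ I₃ a →
              EqOn (G.painleveFunction I₁) y X →
                G.AgreeOn F {z | z⁻¹ ∈ X}) := by
  refine ⟨fun M _ _ _ B hB p => ?_, fun S F hS hc h0 h => painleve_of_isBiFlatOn_model hS hc h0 h,
    fun a b g d X y hy I₁ I₂ I₃ h₁ hd hb hg =>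
      exists_profile_of_isPainleveVSolution hy h₁ hd hb hg⟩
  obtain ⟨ψ, hψ, hp, hconv, H⟩ := B.exists_isCanonicalOn hB p
  exact ⟨ψ, hψ, hp, H.exists_profile hconv⟩
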